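/- Let $Y$ be a separable metric space of observations (for example $\mathbb R$; an observation may include covariates) with a $\sigma$-finite Borel reference measure $\lambda$ that is positive on nonempty open sets, let $\Theta$ be a measurable space of parameters, and fix a number of chains $K$ and weights $w$ in the simplex $\{w\in[0,1]^K:\sum_k w_k=1\}$. Chain $k$ has a $\sigma$-finite, possibly improper, prior measure $\pi_k$ on $\Theta$ (for example the prior of a common model, restricted to the part $\Theta_k$ of the parameter space that the chain explores) and a jointly measurable likelihood $p_k(t\mid\theta)\ge 0$ with $\int p_k(t\mid\theta)\,\lambda(dt)=1$ for all $\theta$. Its stationary distribution given $y_{1:n}$, $n\ge1$, is the posterior $p_k(d\theta\mid y_{1:n})\propto\prod_{i\le n}p_k(y_i\mid\theta)\,\pi_k(d\theta)$, assumed proper, and $p_k(t\mid y_{1:n})=\int p_k(t\mid\theta)\,p_k(d\theta\mid y_{1:n})$ is its predictive density. The data $y_1,y_2,\dots$ are independent with an arbitrary common law $P$, and $\mathrm E_{\tilde y\mid y_{1:n}}$ is the expectation over a new observation $\tilde y\sim P$ independent of $y_{1:n}$. For each $n\ge 1$, chain $k$ produces draws $\theta_{k1},\theta_{k2},\dots$,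 each with conditional distribution $p_k(d\theta\mid y_{1:n})$ given $y_{1:n}$; they need not be independent. The leave-one-out predictive densities are approximated by $$p^S_{k,-i}(y_i)=\frac{\sum_{s=1}^S p_k(y_i\mid\theta_{ks})\,r_{iks}}{\sum_{s=1}^S r_{iks}},$$ where $r_{ik1},\dots,r_{ikS}$ are the Pareto-smoothed versions of the raw ratios $1/p_k(y_i\mid\theta_{ks})$: with $M=\lceil\min(S/5,\,3\sqrt S)\rceil$, the $M$ largest raw ratios are replaced, in increasing order, by the cutoff (the next largest ratio) plus the $(j-\tfrac12)/M$ quantiles, $j=1,\dots,M$, of a generalized Pareto distribution fitted to their exceedances over the cutoff (by the Zhang–Stephens estimator, with the shape estimate $\hat k$ shrunk to $(M\hat k+5)/(M+10)$), truncated on the right at the largest raw ratio. The ratios are left unchanged if $M<5$, if the first quartile of the exceedances is $0$, or if all exceedances are equal. Assume the following regularity conditions. 1. For each $k$ there is a function $B_k$ on $Y$ such that $p_k(\tilde y\mid y)>0$ and $|\log p_k(\tilde y\mid y)|\le B_k(\tilde y)<\infty$ for all $\tilde y\in Y$, all $n\ge1$ and all $y\in Y^n$; and $\mathrm E_{\tilde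 y\sim P}\,g(\tilde y)<\infty$, where $g(\tilde y)=\max\{(\log\sum_k w_k e^{-B_k(\tilde y)})^4,\ (\log\sum_k w_k e^{B_k(\tilde y)})^4\}$. 2. For each $k$, the predictive densities $\tilde y\mapsto p_k(\tilde y\mid y)$, over all $n\ge1$ and $y\in Y^n$, are uniformly equicontinuous. Then, for all $n\ge1$, the expected log predictive density $\mathrm E_{\tilde y\mid y_{1:n}}\log\sum_k w_k\,p_k(\tilde y\mid y_{1:n})$ exists for every data set (the integrand is integrable); for all $n,S\ge1$ the difference below is square integrable; and $$\frac1n\sum_{i=1}^n\log\sum_{k=1}^K w_k\,p^S_{k,-i}(y_i)\;-\;\mathrm E_{\tilde y\mid y_{1:n}}\log\sum_{k=1}^K w_k\,p_k(\tilde y\mid y_{1:n})\ \xrightarrow{L_2}\ 0\qquad\text{as } n\to\infty,\ S\to\infty \text{ jointly, in any manner.}$$ -/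

import Mathlib

open MeasureTheory ProbabilityTheory Filter Topology
open scoped ENNReal

noncomputable section

/-! ### Posterior and predictive distributions -/

section Bayes

variable {Θ Y : Type*} [MeasurableSpace Θ]

/-- The posterior distribution `p(dθ | v)` of the parameter given the observations `v`, for a
(possibly improper) prior `π` and a likelihood `f θ t = p(t | θ)`: the measure with density
`∏ i, f θ (v i)` with respect to `π`, normalized. It is a probability measure exactly when the
normalizing constant is positive and finite. -/
def chainPosterior (π : Measure Θ) (f : Θ → Y → ℝ) {n : ℕ} (v : Fin n → Y) : Measure Θ :=
  ((π.withDensity fun θ => ENNReal.ofReal (∏ i, f θ (v i))) Set.univ)⁻¹ •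
    π.withDensity fun θ => ENNReal.ofReal (∏ i, f θ (v i))

/-- The posterior predictive density `p(t | v) = ∫ p(t | θ) p(dθ | v)`. -/
def predictive (π : Measure Θ) (f : Θ → Y → ℝ) {n : ℕ} (v : Fin n → Y) (t : Y) : ℝ :=
  ∫ θ, f θ t ∂(chainPosterior π f v)

end Bayes

/-! ### Fitting a generalized Pareto distribution

The sample is `x 1 ≤ x 2 ≤ ... ≤ x M` (indices from `1` to `M`), and the estimator is the
quasi-Bayesian one of Zhang and Stephens, in the parametrization with shape `k` and scale `σ`
where the distribution function is `1 - (1 + k x / σ) ^ (-1 / k)`. -/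

/-- Number of grid points. -/
def gpdGridSize (M : ℕ) : ℕ := 30 + Nat.sqrt M

/-- The `j`-th grid point (`1 ≤ j ≤ gpdGridSize M`) for the auxiliary parameter `b = -k / σ`;
`x ⌊M / 4 + 1 / 2⌋` is the first sample quartile. -/
def gpdGrid (M : ℕ) (x : ℕ → ℝ) (j : ℕ) : ℝ :=
  1 / x M + (1 - Real.sqrt ((gpdGridSize M : ℝ) / ((j : ℝ) - 1 / 2))) /
    (3 * x ⌊(M : ℝ) / 4 + 1 / 2⌋₊)

/-- The mean of the sample. -/
def gpdMean (M : ℕ) (x : ℕ → ℝ) : ℝ := (∑ j ∈ Finset.Icc 1 M, x j) / (M : ℝ)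

/-- The shape that maximizes the likelihood for a given value of `b = -k / σ`. -/
def gpdShapeAt (M : ℕ) (x : ℕ → ℝ) (b : ℝ) : ℝ :=
  (∑ j ∈ Finset.Icc 1 M, Real.log (1 - b * x j)) / (M : ℝ)

/-- The profile log likelihood of `b`, with its limit (the exponential case) at `b = 0`. -/
def gpdProfile (M : ℕ) (x : ℕ → ℝ) (b : ℝ) : ℝ :=
  if b = 0 then (M : ℝ) * (-Real.log (gpdMean M x) - 1)
  else (M : ℝ) * (Real.log (-b / gpdShapeAt M x b) - gpdShapeAt M x b - 1)

/-- The estimate of `b`: average of the grid points, weighted by the profile likelihood. -/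
def gpdB (M : ℕ) (x : ℕ → ℝ) : ℝ :=
  (∑ j ∈ Finset.Icc 1 (gpdGridSize M), gpdGrid M x j * Real.exp (gpdProfile M x (gpdGrid M x j))) /
    ∑ j ∈ Finset.Icc 1 (gpdGridSize M), Real.exp (gpdProfile M x (gpdGrid M x j))

/-- The estimated scale `σ = -k / b`, with its limit at `b = 0`. -/
def gpdScale (M : ℕ) (x : ℕ → ℝ) : ℝ :=
  if gpdB M x = 0 then gpdMean M x else -gpdShapeAt M x (gpdB M x) / gpdB M x

/-- The estimated shape `k`, shrunk towards `1 / 2` with the weight of ten observations. -/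
def gpdShape (M : ℕ) (x : ℕ → ℝ) : ℝ :=
  ((M : ℝ) * gpdShapeAt M x (gpdB M x) + 10 * (1 / 2)) / ((M : ℝ) + 10)

/-- The quantile function of the generalized Pareto distribution with shape `k`, scale `σ`. -/
def gpdQuantile (k σ q : ℝ) : ℝ :=
  if k = 0 then -σ * Real.log (1 - q) else σ * ((1 - q) ^ (-k) - 1) / k

/-! ### Pareto-smoothed importance sampling -/

/-- Number of largest importance ratios that are smoothed, out of `S`: `⌈min (S / 5) (3 √S)⌉`. -/
def psisTailLength (S : ℕ) : ℕ := ⌈min ((S : ℝ) / 5) (3 * Real.sqrt S)⌉₊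

/-- The `j`-th smallest ratio, `j = 0, ..., S - 1` (and `0` for other indices). -/
def sortedRatio {S : ℕ} (r : Fin S → ℝ) (j : ℕ) : ℝ :=
  if h : j < S then r (Tuple.sort r ⟨j, h⟩) else 0

/-- The cutoff: the largest ratio that is not in the tail. -/
def psisCutoff {S : ℕ} (r : Fin S → ℝ) : ℝ := sortedRatio r (S - psisTailLength S - 1)

/-- The exceedances over the cutoff in increasing order, indexed by `1, ..., psisTailLength S`. -/
def psisExceedance {S : ℕ} (r : Fin S → ℝ) (j : ℕ) : ℝ :=
  sortedRatio r (S - psisTailLength S + j - 1) - psisCutoff r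

/-- A generalized Pareto distribution is fitted if the tail has at least five draws, the first
quartile of the exceedances is positive, and the exceedances are not all equal; otherwise the
ratios are left as they are. -/
def PsisFits {S : ℕ} (r : Fin S → ℝ) : Prop :=
  5 ≤ psisTailLength S ∧
  0 < psisExceedance r ⌊(psisTailLength S : ℝ) / 4 + 1 / 2⌋₊ ∧
  psisExceedance r 1 < psisExceedance r (psisTailLength S)

open Classical in
/-- The Pareto-smoothed importance ratios of the raw ratios `r`. The `j`-th smallest of the
`M` tail ratios is replaced by the `(j - 1 / 2) / M` quantile of the fitted generalized Pareto
distribution (its expected order statistic), truncated on the right at the largest raw ratio. -/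
def psisRatio {S : ℕ} (r : Fin S → ℝ) (s : Fin S) : ℝ :=
  let M := psisTailLength S
  let rank : ℕ := ((Tuple.sort r).symm s : Fin S)
  if PsisFits r ∧ S - M ≤ rank then
    min
      (psisCutoff r + gpdQuantile (gpdShape M (psisExceedance r)) (gpdScale M (psisExceedance r))
        ((((rank - (S - M) + 1 : ℕ) : ℝ) - 1 / 2) / (M : ℝ)))
      (sortedRatio r (S - 1))
  else r s

/-- The approximation `p^S(t)` of the leave-one-out predictive density of an observation `t` from
`S` posterior draws `θ` : the mean of `p(t | θ s)`, weighted by the Pareto-smoothed versions of the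
raw leave-one-out importance ratios `1 / p(t | θ s)`. -/
def psisLoo {Θ Y : Type*} (f : Θ → Y → ℝ) {S : ℕ} (θ : Fin S → Θ) (t : Y) : ℝ :=
  (∑ s, f (θ s) t * psisRatio (fun s' => 1 / f (θ s') t) s) /
    ∑ s, psisRatio (fun s' => 1 / f (θ s') t) s

/-! ### Stacking -/

section Stacking

variable {K : ℕ} {Θ Y : Type*}

/-- The stacking objective `(1 / n) ∑ i, log ∑ k, w k * p^S_{k, -i}(y i)` for the data `v` and the
draws `θ k s`, `k < K`, `s < S`. -/
def stackingObjective (f : Fin K → Θ → Y → ℝ) (w : Fin K → ℝ) {n S : ℕ} (v : Fin n → Y)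
    (θ : Fin K → Fin S → Θ) : ℝ :=
  (1 / (n : ℝ)) * ∑ i, Real.log (∑ k, w k * psisLoo (f k) (θ k) (v i))

/-- The log density at `t` of the stacked predictive distribution given the data `v`. -/
def stackedLogPredictive [MeasurableSpace Θ] (π : Fin K → Measure Θ) (f : Fin K → Θ → Y → ℝ)
    (w : Fin K → ℝ) {n : ℕ} (v : Fin n → Y) (t : Y) : ℝ :=
  Real.log (∑ k, w k * predictive (π k) (f k) v t)

/-- The stacked expected log predictive density for a new observation, drawn from the distribution
`P` of the data and independent of the data `v`. -/
def stackedElpd [MeasurableSpace Θ] [MeasurableSpace Y] (P : Measure Y) (π : Fin K → Measure Θ)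
    (f : Fin K → Θ → Y → ℝ) (w : Fin K → ℝ) {n : ℕ} (v : Fin n → Y) : ℝ :=
  ∫ t, stackedLogPredictive π f w v t ∂P

end Stacking

end

/-! The error is split at the mean over the data of the stacked log predictive density given all the
data.

From there to the expectation under `P` the step is a uniform law of large numbers
(`exists_uniform_law`). Up to `ε` and a tail of the envelope, functions with a common square
integrable envelope and a common modulus of continuity are step functions on finitely many cells, so
one random variable bounds the error for all of them at once. It does not matter that the predictive
density is built from the same data.

For the other part, Pareto smoothing keeps the weights in the range of the raw ratios
(`psisRatio_mem_Icc`). The approximate leave-one-out density is therefore a mean of `p(y_i | θ_s)`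
with weights of bounded ratio, and it is close to `p(y_i | y)` as soon as the averaged numbers are
(`sq_log_weighted_mean_sub_le`), for any number of draws and any dependence between them. It remains
to show that the log likelihood at the observations degenerates under the posterior
(`tendsto_integral_sq_log_sub_predictive`).

To begin with, the likelihood inherits the envelope and the modulus of continuity of the predictive
densities. Let `A` be the set of parameters that violate a bound, and take a data set for which the
posterior probability of `A` nearly attains its supremum over all data sets. A further observation
preserves this probability on average and cannot raise it above the supremum, so it can hardly
change it: the likelihood is nearly uncorrelated with `A` (`exists_uncorrelated`). Its mean over `A`
is then nearly a predictive density, which obeys the bound; so `A` is null.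

The uniform law thus applies to the log likelihood, and the posterior concentrates where the mean
log likelihood is near its essential supremum `l` (`exists_tendsto_integral_meanLogLik`). The
posterior mean of the log likelihood of the data is at most about `l` per observation, while by
Jensen's inequality the expected leave-one-out log predictive density is at least about `l`. The
difference of the two (`looGap`) is a relative entropy of the posterior with respect to the
leave-one-out posterior. It is nonnegative, so it tends to zero on average, and where the envelope
is bounded it dominates the mean square deviation of the log likelihood. -/

set_option linter.unusedSectionVars false

noncomputable section

/-! ### Range of the Pareto-smoothed ratios -/

section ParetoSmoothing

theorem sortedRatio_mono {S : ℕ} (r : Fin S → ℝ) {i j : ℕ} (hij : i ≤ j) (hj : j < S) :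
    sortedRatio r i ≤ sortedRatio r j := by
  have hi : i < S := lt_of_le_of_lt hij hj
  simp only [sortedRatio, hi, hj, dif_pos]
  exact Tuple.monotone_sort r (show (⟨i, hi⟩ : Fin S) ≤ ⟨j, hj⟩ from hij)

theorem sortedRatio_mem_Icc {S : ℕ} {r : Fin S → ℝ} {lo hi : ℝ} (h : ∀ s, r s ∈ Set.Icc lo hi)
    {j : ℕ} (hj : j < S) : sortedRatio r j ∈ Set.Icc lo hi := by
  simp only [sortedRatio, hj, dif_pos]
  exact h _

/-- The square root exceeds `1` because `j - 1/2` is smaller than the number of grid points. Below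
`1 / x M` the arguments `1 - b * x j` of the logarithms in the profile likelihood stay positive. -/
theorem gpdGrid_lt {M : ℕ} {x : ℕ → ℝ} (hx : 0 < x ⌊(M : ℝ) / 4 + 1 / 2⌋₊) {j : ℕ}
    (hj : j ∈ Finset.Icc 1 (gpdGridSize M)) : gpdGrid M x j < 1 / x M := by
  rw [Finset.mem_Icc] at hj
  have h1 : (1 : ℝ) ≤ j := by exact_mod_cast hj.1
  have h2 : (j : ℝ) ≤ gpdGridSize M := by exact_mod_cast hj.2
  have h3 : 1 < Real.sqrt ((gpdGridSize M : ℝ) / ((j : ℝ) - 1 / 2)) := by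
    rw [Real.lt_sqrt zero_le_one, lt_div_iff₀ (by linarith)]
    linarith
  have h4 : (1 - Real.sqrt ((gpdGridSize M : ℝ) / ((j : ℝ) - 1 / 2))) /
      (3 * x ⌊(M : ℝ) / 4 + 1 / 2⌋₊) < 0 := div_neg_of_neg_of_pos (by linarith) (by linarith)
  unfold gpdGrid
  linarith

theorem gpdB_lt {M : ℕ} {x : ℕ → ℝ} (hx : 0 < x ⌊(M : ℝ) / 4 + 1 / 2⌋₊) :
    gpdB M x < 1 / x M := by
  have hne : (Finset.Icc 1 (gpdGridSize M)).Nonempty :=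
    Finset.nonempty_Icc.mpr (by unfold gpdGridSize; omega)
  unfold gpdB
  rw [div_lt_iff₀ (Finset.sum_pos (fun _ _ => Real.exp_pos _) hne), Finset.mul_sum]
  exact Finset.sum_lt_sum_of_nonempty hne fun j hj =>
    mul_lt_mul_of_pos_right (gpdGrid_lt hx hj) (Real.exp_pos _)

/-- The fitted scale is nonnegative. -/
theorem gpdScale_nonneg {M : ℕ} {x : ℕ → ℝ} (hx : 0 < x ⌊(M : ℝ) / 4 + 1 / 2⌋₊)
    (hx0 : ∀ j ∈ Finset.Icc 1 M, 0 ≤ x j) (hxM : ∀ j ∈ Finset.Icc 1 M, x j ≤ x M)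
    (hM : 0 < x M) : 0 ≤ gpdScale M x := by
  unfold gpdScale
  split_ifs with hb
  · exact div_nonneg (Finset.sum_nonneg hx0) (Nat.cast_nonneg _)
  -- The shape and `b` have opposite signs. For `b < 0` all logarithms are nonnegative; for `b > 0`
  -- the bound `b < 1 / x M` keeps their arguments in `(0, 1]`.
  rcases lt_or_gt_of_ne hb with hb | hb
  · refine div_nonneg_of_nonpos (neg_nonpos.mpr ?_) hb.le
    refine div_nonneg (Finset.sum_nonneg fun j hj => Real.log_nonneg ?_) (Nat.cast_nonneg _)
    nlinarith [hx0 j hj]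
  · refine div_nonneg (neg_nonneg.mpr ?_) hb.le
    refine div_nonpos_of_nonpos_of_nonneg (Finset.sum_nonpos fun j hj => ?_) (Nat.cast_nonneg _)
    have h1 : gpdB M x * x M < 1 := by
      have := gpdB_lt hx
      rwa [lt_div_iff₀ hM] at this
    have h2 : gpdB M x * x j ≤ gpdB M x * x M := mul_le_mul_of_nonneg_left (hxM j hj) hb.le
    exact Real.log_nonpos (by linarith) (by nlinarith [hx0 j hj])

theorem gpdQuantile_nonneg {k σ q : ℝ} (hσ : 0 ≤ σ) (hq0 : 0 ≤ q) (hq1 : q < 1) :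
    0 ≤ gpdQuantile k σ q := by
  unfold gpdQuantile
  split_ifs with hk
  · have := Real.log_nonpos (x := 1 - q) (by linarith) (by linarith)
    nlinarith
  rcases lt_or_gt_of_ne hk with hk | hk
  · refine div_nonneg_of_nonpos (mul_nonpos_of_nonneg_of_nonpos hσ ?_) hk.le
    have := Real.rpow_le_one (x := 1 - q) (z := -k) (by linarith) (by linarith) (by linarith)
    linarith
  · refine div_nonneg (mul_nonneg hσ ?_) hk.le
    have := Real.one_le_rpow_of_pos_of_le_one_of_nonpos (x := 1 - q) (z := -k) (by linarith)
      (by linarith) (by linarith)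
    linarith

/-- From `5 ≤ M < S / 5 + 1` follows `S > 20`, hence `S / 5 + 1 < S`. It guarantees that the natural
subtraction `S - M - 1` in the index of the cutoff is a true one. -/
theorem psisTailLength_lt {S : ℕ} (h : 5 ≤ psisTailLength S) : psisTailLength S < S := by
  have h1 : psisTailLength S ≤ ⌈(S : ℝ) / 5⌉₊ := Nat.ceil_mono (min_le_left _ _)
  have h2 : ((⌈(S : ℝ) / 5⌉₊ : ℕ) : ℝ) < (S : ℝ) / 5 + 1 := Nat.ceil_lt_add_one (by positivity)
  have h3 : (psisTailLength S : ℝ) ≤ (⌈(S : ℝ) / 5⌉₊ : ℕ) := by exact_mod_cast h1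
  have h4 : (5 : ℝ) ≤ psisTailLength S := by exact_mod_cast h
  have h5 : (psisTailLength S : ℝ) < S := by linarith
  exact_mod_cast h5

/-- Pareto smoothing does not leave the range of the raw ratios. -/
theorem psisRatio_mem_Icc {S : ℕ} {r : Fin S → ℝ} {lo hi : ℝ} (h : ∀ s, r s ∈ Set.Icc lo hi)
    (s : Fin S) : psisRatio r s ∈ Set.Icc lo hi := by
  have hS : 0 < S := lt_of_le_of_lt (Nat.zero_le _) s.2
  unfold psisRatio
  simp only
  split_ifs with hc
  swap
  · exact h s
  obtain ⟨⟨hM, hq, hlt⟩, hrank⟩ := hc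
  set M := psisTailLength S with hMdef
  have hMS : M < S := psisTailLength_lt hM
  have hcut := sortedRatio_mem_Icc h (j := S - M - 1) (by omega)
  have hmax := sortedRatio_mem_Icc h (j := S - 1) (by omega)
  have hx0 : ∀ j ∈ Finset.Icc 1 M, 0 ≤ psisExceedance r j := fun j hj => by
    rw [Finset.mem_Icc] at hj
    exact sub_nonneg.mpr (sortedRatio_mono r (by omega) (by omega))
  have hxM : ∀ j ∈ Finset.Icc 1 M, psisExceedance r j ≤ psisExceedance r M := fun j hj => by
    rw [Finset.mem_Icc] at hj
    exact sub_le_sub_right (sortedRatio_mono r (by omega) (by omega)) _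
  have hMpos : 0 < psisExceedance r M :=
    lt_of_le_of_lt (hx0 1 (Finset.mem_Icc.mpr ⟨le_rfl, by omega⟩)) hlt
  have hσ := gpdScale_nonneg hq hx0 hxM hMpos
  -- Nonnegative quantiles keep the smoothed ratio above the cutoff, and the truncation keeps it
  -- below the largest raw ratio; both are values of `r`.
  refine ⟨le_min ?_ hmax.1, (min_le_right _ _).trans hmax.2⟩
  refine le_trans (b := psisCutoff r) hcut.1 (le_add_of_nonneg_right (gpdQuantile_nonneg hσ ?_ ?_))
  · refine div_nonneg ?_ (Nat.cast_nonneg _)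
    push_cast
    have : (0 : ℝ) ≤ ((((Tuple.sort r).symm s : Fin S) : ℕ) - (S - M) : ℕ) := Nat.cast_nonneg _
    linarith
  · have hMR : (0 : ℝ) < M := by
      have : 0 < M := by omega
      exact_mod_cast this
    rw [div_lt_one hMR]
    have h1 : (((Tuple.sort r).symm s : Fin S) : ℕ) - (S - M) + 1 ≤ M := by
      have := ((Tuple.sort r).symm s).2
      omega
    have h2 : (((((Tuple.sort r).symm s : Fin S) : ℕ) - (S - M) + 1 : ℕ) : ℝ) ≤ M := by
      exact_mod_cast h1
    linarith

/-- The approximate leave-one-out density is a weighted mean with weights of bounded ratio. -/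
theorem psisLoo_eq_weighted_mean {Θ Y : Type*} {f : Θ → Y → ℝ} {S : ℕ}
    {θ : Fin S → Θ} {t : Y} {b : ℝ}
    (h : ∀ s, f (θ s) t ∈ Set.Icc (Real.exp (-b)) (Real.exp b)) :
    ∃ ρ : Fin S → ℝ, (∀ s, ρ s ∈ Set.Icc (Real.exp (-b)) (Real.exp b)) ∧
      psisLoo f θ t = (∑ s, f (θ s) t * ρ s) / ∑ s, ρ s := by
  -- The interval `[exp (-b), exp b]` is invariant under inversion, so it contains the raw ratios
  -- together with the likelihoods.
  refine ⟨_, fun s => psisRatio_mem_Icc (fun s' => ?_) s, rfl⟩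
  have h0 : 0 < f (θ s') t := (Real.exp_pos _).trans_le (h s').1
  constructor
  · rw [Real.exp_neg, ← one_div]
    exact one_div_le_one_div_of_le h0 (h s').2
  · rw [← neg_neg b, Real.exp_neg, ← one_div]
    exact one_div_le_one_div_of_le (Real.exp_pos _) (h s').1

end ParetoSmoothing

/-! ### Measurability of the Pareto-smoothed ratios -/

section Measurability

/-- The sorting permutation is characterized by monotonicity and by the order of indices among ties,
which are finitely many comparisons of coordinates. -/
theorem measurableSet_sort_eq {S : ℕ} (σ : Equiv.Perm (Fin S)) :
    MeasurableSet {r : Fin S → ℝ | Tuple.sort r = σ} := by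
  have : {r : Fin S → ℝ | Tuple.sort r = σ} =
      {r | ∀ i j, i ≤ j → r (σ i) ≤ r (σ j)} ∩
        {r | ∀ i j, i < j → r (σ i) = r (σ j) → σ i < σ j} := by
    ext r
    rw [Set.mem_ofPred_eq, eq_comm, Tuple.eq_sort_iff]
    rfl
  rw [this]
  refine MeasurableSet.inter ?_ ?_
  · simp only [Set.ofPred_forall]
    exact MeasurableSet.iInter fun i => MeasurableSet.iInter fun j => MeasurableSet.iInter fun _ =>
      measurableSet_le (measurable_pi_apply _) (measurable_pi_apply _)
  · simp only [Set.ofPred_forall]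
    refine MeasurableSet.iInter fun i => MeasurableSet.iInter fun j => MeasurableSet.iInter fun _ =>
      ?_
    by_cases h : σ i < σ j
    · simp [h]
    · simp only [h, imp_false]
      exact (measurableSet_eq_fun (f := fun r : Fin S → ℝ => r (σ i)) (g := fun r => r (σ j))
        (measurable_pi_apply _) (measurable_pi_apply _)).compl

/-- A function of `r` and of its sorting permutation is measurable if it is so for every fixed
permutation. -/
theorem measurable_of_sort {S : ℕ} {β : Type*} [MeasurableSpace β]
    {g : Equiv.Perm (Fin S) → (Fin S → ℝ) → β} (hg : ∀ σ, Measurable (g σ)) :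
    Measurable fun r => g (Tuple.sort r) r := by
  intro A hA
  have : (fun r => g (Tuple.sort r) r) ⁻¹' A =
      ⋃ σ, {r : Fin S → ℝ | Tuple.sort r = σ} ∩ g σ ⁻¹' A := by
    ext r; simp
  rw [this]
  exact MeasurableSet.iUnion fun σ => (measurableSet_sort_eq σ).inter (hg σ hA)

theorem measurable_sortedRatio {S : ℕ} (j : ℕ) :
    Measurable fun r : Fin S → ℝ => sortedRatio r j := by
  unfold sortedRatio
  split_ifs with h
  · exact measurable_of_sort (g := fun σ r => r (σ ⟨j, h⟩)) fun σ => measurable_pi_apply _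
  · exact measurable_const

theorem measurable_psisExceedance {S : ℕ} (j : ℕ) :
    Measurable fun r : Fin S → ℝ => psisExceedance r j :=
  (measurable_sortedRatio _).sub (measurable_sortedRatio _)

/-! ### Measurability of the generalized Pareto fit. -/

section Fit

variable {α : Type*} [MeasurableSpace α] {M : ℕ} {x : α → ℕ → ℝ}

theorem measurable_gpdGrid (hx : ∀ j, Measurable fun a => x a j) (j : ℕ) :
    Measurable fun a => gpdGrid M (x a) j := by
  have h1 := hx M
  have h2 := hx ⌊(M : ℝ) / 4 + 1 / 2⌋₊
  unfold gpdGrid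
  fun_prop

theorem measurable_gpdMean (hx : ∀ j, Measurable fun a => x a j) :
    Measurable fun a => gpdMean M (x a) := by
  unfold gpdMean
  fun_prop

theorem measurable_gpdShapeAt (hx : ∀ j, Measurable fun a => x a j) {b : α → ℝ}
    (hb : Measurable b) : Measurable fun a => gpdShapeAt M (x a) (b a) := by
  unfold gpdShapeAt
  fun_prop

theorem measurable_gpdProfile (hx : ∀ j, Measurable fun a => x a j) {b : α → ℝ}
    (hb : Measurable b) : Measurable fun a => gpdProfile M (x a) (b a) := by
  have h1 := measurable_gpdMean (M := M) hx
  have h2 := measurable_gpdShapeAt (M := M) hx hb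
  unfold gpdProfile
  exact Measurable.ite (hb (measurableSet_singleton 0)) (by fun_prop) (by fun_prop)

theorem measurable_gpdB (hx : ∀ j, Measurable fun a => x a j) :
    Measurable fun a => gpdB M (x a) := by
  have h1 := fun j => measurable_gpdGrid (M := M) hx j
  have h2 := fun j => measurable_gpdProfile (M := M) hx (h1 j)
  unfold gpdB
  fun_prop

theorem measurable_gpdScale (hx : ∀ j, Measurable fun a => x a j) :
    Measurable fun a => gpdScale M (x a) := by
  have h1 := measurable_gpdB (M := M) hx
  have h2 := measurable_gpdMean (M := M) hx
  have h3 := measurable_gpdShapeAt (M := M) hx h1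
  unfold gpdScale
  exact Measurable.ite (h1 (measurableSet_singleton 0)) h2 (by fun_prop)

theorem measurable_gpdShape (hx : ∀ j, Measurable fun a => x a j) :
    Measurable fun a => gpdShape M (x a) := by
  have h3 := measurable_gpdShapeAt (M := M) hx (measurable_gpdB (M := M) hx)
  unfold gpdShape
  fun_prop

theorem measurable_gpdQuantile {k σ : α → ℝ} (hk : Measurable k) (hσ : Measurable σ) (q : ℝ) :
    Measurable fun a => gpdQuantile (k a) (σ a) q := by
  unfold gpdQuantile
  exact Measurable.ite (hk (measurableSet_singleton 0)) (by fun_prop) (by fun_prop)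

end Fit

theorem measurable_psisRatio {S : ℕ} (s : Fin S) :
    Measurable fun r : Fin S → ℝ => psisRatio r s := by
  classical
  have hfit : MeasurableSet {r : Fin S → ℝ | PsisFits r} :=
    MeasurableSet.inter (MeasurableSet.const _) (MeasurableSet.inter
      (measurableSet_lt measurable_const (measurable_psisExceedance _))
      (measurableSet_lt (measurable_psisExceedance _) (measurable_psisExceedance _)))
  unfold psisRatio
  simp only
  refine measurable_of_sort (g := fun σ r => if PsisFits r ∧
    S - psisTailLength S ≤ ((σ.symm s : Fin S) : ℕ) then min (psisCutoff r +
      gpdQuantile (gpdShape (psisTailLength S) (psisExceedance r))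
        (gpdScale (psisTailLength S) (psisExceedance r))
        ((((((σ.symm s : Fin S) : ℕ) - (S - psisTailLength S) + 1 : ℕ) : ℝ) - 1 / 2) /
          (psisTailLength S : ℝ))) (sortedRatio r (S - 1)) else r s) fun σ => ?_
  refine Measurable.ite (hfit.inter (MeasurableSet.const _)) ?_ (measurable_pi_apply _)
  exact ((measurable_sortedRatio _).add (measurable_gpdQuantile
    (measurable_gpdShape measurable_psisExceedance)
    (measurable_gpdScale measurable_psisExceedance) _)).min (measurable_sortedRatio _)

theorem measurable_psisLoo {α Θ Y : Type*} [MeasurableSpace α] [MeasurableSpace Θ]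
    [MeasurableSpace Y] {f : Θ → Y → ℝ} (hf : Measurable fun z : Θ × Y => f z.1 z.2) {S : ℕ}
    {θ : α → Fin S → Θ} (hθ : ∀ s, Measurable fun a => θ a s) {t : α → Y} (ht : Measurable t) :
    Measurable fun a => psisLoo f (θ a) (t a) := by
  have h1 : ∀ s, Measurable fun a => f (θ a s) (t a) := fun s => hf.comp ((hθ s).prodMk ht)
  have h2 : ∀ s, Measurable fun a => psisRatio (fun s' => 1 / f (θ a s') (t a)) s := fun s =>
    (measurable_psisRatio s).comp (measurable_pi_iff.mpr fun s' => (h1 s').const_div 1)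
  unfold psisLoo
  fun_prop


end Measurability

/-! ### Posterior updates -/

section Posterior

variable {Θ Y : Type*} [MeasurableSpace Θ] [MeasurableSpace Y]

/-- A prior and a likelihood with proper posteriors and positive predictive densities. -/
structure BayesModel (lam : Measure Y) (π : Measure Θ) (f : Θ → Y → ℝ) : Prop where
  meas : Measurable fun z : Θ × Y => f z.1 z.2
  nonneg : ∀ θ t, 0 ≤ f θ t
  density : ∀ θ, ∫⁻ t, ENNReal.ofReal (f θ t) ∂lam = 1
  proper : ∀ n, ∀ v : Fin (n + 1) → Y, IsProbabilityMeasure (chainPosterior π f v)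
  pos : ∀ n, ∀ (v : Fin (n + 1) → Y) (t : Y), 0 < predictive π f v t

variable {lam : Measure Y} {π : Measure Θ} {f : Θ → Y → ℝ}

/-- In `ℝ≥0∞` both `∞ * 0` and `0 * ∞` are `0`, so a degenerate normalizing constant would give
total mass `0` instead of `1`. -/
theorem ne_zero_top_of_isProbabilityMeasure_inv_smul {α : Type*} [MeasurableSpace α]
    {ν : Measure α} (h : IsProbabilityMeasure ((ν Set.univ)⁻¹ • ν)) :
    ν Set.univ ≠ 0 ∧ ν Set.univ ≠ ∞ := by
  have h1 : (ν Set.univ)⁻¹ * ν Set.univ = 1 := h.measure_univ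
  constructor
  · intro h0; simp [h0] at h1
  · intro h0; simp [h0] at h1

namespace BayesModel



theorem meas_param (hc : BayesModel lam π f) (t : Y) : Measurable fun θ => f θ t :=
  hc.meas.comp (measurable_id.prodMk measurable_const)

/-- The integral of a function that is not integrable is `0` by convention, so a positive predictive
density forces integrability. -/
theorem integrable_likelihood (hc : BayesModel lam π f) {n : ℕ} (v : Fin (n + 1) → Y) (t : Y) :
    Integrable (fun θ => f θ t) (chainPosterior π f v) := by
  by_contra h
  exact (hc.pos n v t).ne' (integral_undef h)

theorem ofReal_predictive (hc : BayesModel lam π f) {n : ℕ} (v : Fin (n + 1) → Y) (t : Y) :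
    ENNReal.ofReal (predictive π f v t) =
      ∫⁻ θ, ENNReal.ofReal (f θ t) ∂(chainPosterior π f v) :=
  ofReal_integral_eq_lintegral_ofReal (hc.integrable_likelihood v t)
    (ae_of_all _ fun θ => hc.nonneg θ t)

/-- One more observation tilts the posterior by its likelihood. -/
theorem posterior_eq_withDensity (hc : BayesModel lam π f) {n : ℕ} (v : Fin (n + 2) → Y) (i : Fin (n + 2)) :
    chainPosterior π f v = (chainPosterior π f (i.removeNth v)).withDensity fun θ =>
      ENNReal.ofReal (f θ (v i) / predictive π f (i.removeNth v) (v i)) := by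
  have hp := hc.pos n (i.removeNth v) (v i)
  have hfm : Measurable fun θ => ENNReal.ofReal (f θ (v i)) := (hc.meas_param _).ennreal_ofReal
  have hgm : Measurable fun θ => ENNReal.ofReal (∏ j, f θ (i.removeNth v j)) :=
    (Finset.measurable_prod _ fun j _ => hc.meas_param _).ennreal_ofReal
  have hprod : (fun θ => ENNReal.ofReal (∏ j, f θ (v j))) =
      (fun θ => ENNReal.ofReal (∏ j, f θ (i.removeNth v j))) *
        fun θ => ENNReal.ofReal (f θ (v i)) := by
    ext θ
    rw [Pi.mul_apply, Fin.prod_univ_succAbove _ i, mul_comm, ENNReal.ofReal_mul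
      (Finset.prod_nonneg fun j _ => hc.nonneg _ _)]
    rfl
  set ν := π.withDensity fun θ => ENNReal.ofReal (∏ j, f θ (i.removeNth v j)) with hν
  have hQ' : chainPosterior π f (i.removeNth v) = (ν Set.univ)⁻¹ • ν := rfl
  obtain ⟨hZ0, hZt⟩ := ne_zero_top_of_isProbabilityMeasure_inv_smul
    (hQ' ▸ hc.proper n (i.removeNth v))
  have hνf : π.withDensity (fun θ => ENNReal.ofReal (∏ j, f θ (v j))) =
      ν.withDensity fun θ => ENNReal.ofReal (f θ (v i)) := by
    rw [hprod, withDensity_mul _ hgm hfm]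
  have hQ : chainPosterior π f v = ((ν.withDensity fun θ => ENNReal.ofReal (f θ (v i)))
      Set.univ)⁻¹ • ν.withDensity fun θ => ENNReal.ofReal (f θ (v i)) := by
    rw [← hνf]; rfl
  have hpred := hc.ofReal_predictive (i.removeNth v) (v i)
  rw [hQ', lintegral_smul_measure, ← setLIntegral_univ, ← withDensity_apply _ MeasurableSet.univ,
    smul_eq_mul] at hpred
  have hdens : (fun θ => ENNReal.ofReal (f θ (v i) / predictive π f (i.removeNth v) (v i))) =
      (ENNReal.ofReal (predictive π f (i.removeNth v) (v i)))⁻¹ •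
        fun θ => ENNReal.ofReal (f θ (v i)) := by
    ext θ
    rw [Pi.smul_apply, ENNReal.ofReal_div_of_pos hp, smul_eq_mul, ENNReal.div_eq_inv_mul]
  rw [hdens, withDensity_smul _ hfm, hQ, hQ', withDensity_smul_measure, smul_smul, hpred]
  congr 1
  rw [ENNReal.mul_inv (Or.inl (ENNReal.inv_ne_zero.mpr hZt)) (Or.inl (ENNReal.inv_ne_top.mpr hZ0)),
    inv_inv, mul_right_comm, ENNReal.mul_inv_cancel hZ0 hZt, one_mul]

theorem integral_posterior (hc : BayesModel lam π f) {n : ℕ} (v : Fin (n + 2) → Y) (i : Fin (n + 2)) (h : Θ → ℝ) :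
    ∫ θ, h θ ∂(chainPosterior π f v) =
      (∫ θ, f θ (v i) * h θ ∂(chainPosterior π f (i.removeNth v))) /
        predictive π f (i.removeNth v) (v i) := by
  have hp := hc.pos n (i.removeNth v) (v i)
  rw [hc.posterior_eq_withDensity v i, integral_withDensity_eq_integral_toReal_smul
    ((hc.meas_param _).div_const _).ennreal_ofReal (ae_of_all _ fun _ => ENNReal.ofReal_lt_top),
    ← integral_div]
  refine integral_congr_ae (ae_of_all _ fun θ => ?_)
  simp only [smul_eq_mul]
  rw [ENNReal.toReal_ofReal (div_nonneg (hc.nonneg _ _) hp.le)]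
  ring

/-- The point `t` is arbitrary, so every data set can be enlarged at will. This is how assumptions
on the predictive densities of all data sets become statements about the likelihood. -/
theorem predictive_mul_integral_cons (hc : BayesModel lam π f) {n : ℕ} (v : Fin (n + 1) → Y) (t : Y) (h : Θ → ℝ) :
    predictive π f v t * ∫ θ, h θ ∂(chainPosterior π f (Fin.cons t v : Fin (n + 2) → Y)) =
      ∫ θ, f θ t * h θ ∂(chainPosterior π f v) := by
  have h1 := hc.integral_posterior (Fin.cons t v : Fin (n + 2) → Y) 0 h
  have h2 : (0 : Fin (n + 2)).removeNth (Fin.cons t v : Fin (n + 2) → Y) = v := by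
    rw [Fin.removeNth_zero, Fin.tail_cons]
  rw [h2, Fin.cons_zero] at h1
  rw [h1, mul_div_cancel₀ _ (hc.pos n v t).ne']

/-- Posterior second moments of the likelihood are products of predictive densities; equicontinuity
reaches the likelihood along this way. -/
theorem predictive_mul_predictive_cons (hc : BayesModel lam π f) {n : ℕ} (v : Fin (n + 1) → Y) (s t : Y) :
    predictive π f v t * predictive π f (Fin.cons t v : Fin (n + 2) → Y) s =
      ∫ θ, f θ t * f θ s ∂(chainPosterior π f v) :=
  hc.predictive_mul_integral_cons v t _

/-- The posterior as a Markov kernel. -/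
def kernel (hc : BayesModel lam π f) [SigmaFinite π] (n : ℕ) : Kernel (Fin (n + 1) → Y) Θ where
  toFun v := chainPosterior π f v
  measurable' := by
    have hg : Measurable fun z : (Fin (n + 1) → Y) × Θ =>
        ENNReal.ofReal (∏ i, f z.2 (z.1 i)) :=
      (Finset.measurable_prod _ fun i _ => hc.meas.comp
        (measurable_snd.prodMk ((measurable_pi_apply i).comp measurable_fst))).ennreal_ofReal
    refine Measure.measurable_of_measurable_coe _ fun C hC => ?_
    have h1 : ∀ v : Fin (n + 1) → Y, chainPosterior π f v C =
        (∫⁻ θ, ENNReal.ofReal (∏ i, f θ (v i)) ∂π)⁻¹ *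
          ∫⁻ θ in C, ENNReal.ofReal (∏ i, f θ (v i)) ∂π := fun v => by
      rw [chainPosterior, Measure.smul_apply, withDensity_apply _ hC,
        withDensity_apply _ MeasurableSet.univ, setLIntegral_univ, smul_eq_mul]
    simp_rw [h1]
    exact (Measurable.lintegral_prod_right' hg).inv.mul (Measurable.lintegral_prod_right' hg)

theorem kernel_apply (hc : BayesModel lam π f) [SigmaFinite π] {n : ℕ} (v : Fin (n + 1) → Y) :
    hc.kernel n v = chainPosterior π f v := rfl

instance isMarkovKernel_kernel (hc : BayesModel lam π f) [SigmaFinite π] (n : ℕ) : IsMarkovKernel (hc.kernel n) :=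
  ⟨fun v => hc.proper n v⟩

theorem measurable_predictive (hc : BayesModel lam π f) [SigmaFinite π] (n : ℕ) :
    Measurable fun z : (Fin (n + 1) → Y) × Y => predictive π f z.1 z.2 := by
  have h1 : Measurable fun z : (Fin (n + 1) → Y) × Y =>
      ∫⁻ θ, ENNReal.ofReal (f θ z.2) ∂((hc.kernel n).comap Prod.fst measurable_fst) z :=
    Measurable.lintegral_kernel_prod_right' (κ := (hc.kernel n).comap Prod.fst measurable_fst)
      (f := fun z : ((Fin (n + 1) → Y) × Y) × Θ => ENNReal.ofReal (f z.2 z.1.2))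
      (hc.meas.comp (measurable_snd.prodMk (measurable_snd.comp measurable_fst))).ennreal_ofReal
  convert h1.ennreal_toReal using 2 with z
  rw [Kernel.comap_apply, hc.kernel_apply, ← hc.ofReal_predictive,
    ENNReal.toReal_ofReal (hc.pos _ _ _).le]

end BayesModel

end Posterior

/-! ### Regularity of the likelihood from regularity of the predictive densities -/

section Regularity

variable {Θ Y : Type*} [MeasurableSpace Θ] [MeasurableSpace Y]

/-- The largest posterior probability of a set of parameters, over all data sets. -/
def supMass (π : Measure Θ) (f : Θ → Y → ℝ) (A : Set Θ) : ℝ :=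
  ⨆ d : Σ n : ℕ, (Fin (n + 1) → Y), (chainPosterior π f d.2).real A

variable {lam : Measure Y} {π : Measure Θ} {f : Θ → Y → ℝ}

namespace BayesModel

theorem le_supMass (hc : BayesModel lam π f) {n : ℕ} (v : Fin (n + 1) → Y) (A : Set Θ) :
    (chainPosterior π f v).real A ≤ supMass π f A := by
  refine le_ciSup (f := fun d : Σ n : ℕ, (Fin (n + 1) → Y) => (chainPosterior π f d.2).real A)
    ⟨1, ?_⟩ ⟨n, v⟩
  rintro _ ⟨d, rfl⟩
  have := hc.proper d.1 d.2
  exact measureReal_le_one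

theorem predictive_mul_real_cons (hc : BayesModel lam π f) {n : ℕ} (v : Fin (n + 1) → Y) (t : Y)
    {A : Set Θ} (hA : MeasurableSet A) :
    predictive π f v t * (chainPosterior π f (Fin.cons t v : Fin (n + 2) → Y)).real A =
      ∫ θ in A, f θ t ∂(chainPosterior π f v) := by
  have h := hc.predictive_mul_integral_cons v t (A.indicator 1)
  rw [integral_indicator_one hA] at h
  rw [h, ← integral_indicator hA]
  refine integral_congr_ae (ae_of_all _ fun θ => ?_)
  by_cases hθ : θ ∈ A <;> simp [hθ]

/-- Divided by the predictive density, the left side is the probability of `A` given one more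
observation `t`, hence at most the supremum. -/
theorem setIntegral_le_supMass (hc : BayesModel lam π f) {n : ℕ} (v : Fin (n + 1) → Y) (t : Y)
    {A : Set Θ} (hA : MeasurableSet A) :
    ∫ θ in A, f θ t ∂(chainPosterior π f v) ≤ supMass π f A * predictive π f v t := by
  rw [← hc.predictive_mul_real_cons v t hA, mul_comm]
  exact mul_le_mul_of_nonneg_right (hc.le_supMass _ A) (hc.pos _ _ _).le

theorem real_eq_zero_of_supMass_le (hc : BayesModel lam π f) {A : Set Θ} (h : supMass π f A ≤ 0)
    {n : ℕ} (v : Fin (n + 1) → Y) : chainPosterior π f v A = 0 := by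
  have := hc.proper n v
  have := (hc.le_supMass v A).trans h
  rw [← measureReal_eq_zero_iff]
  exact le_antisymm this measureReal_nonneg

/-- A uniform upper bound of the predictive densities at a point bounds the likelihood. -/
theorem ae_le_of_predictive_le (hc : BayesModel lam π f) {t : Y} {u : ℝ}
    (hu : ∀ n, ∀ v : Fin (n + 1) → Y, predictive π f v t ≤ u) {n : ℕ} (v : Fin (n + 1) → Y) :
    ∀ᵐ θ ∂(chainPosterior π f v), f θ t ≤ u := by
  have : Nonempty (Σ n : ℕ, (Fin (n + 1) → Y)) := ⟨⟨n, v⟩⟩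
  have hu0 : 0 < u := (hc.pos n v t).trans_le (hu n v)
  have key : ∀ c, u < c → ∀ᵐ θ ∂(chainPosterior π f v), f θ t < c := fun c hcu => by
    have hA : MeasurableSet {θ | c ≤ f θ t} := measurableSet_le measurable_const (hc.meas_param t)
    have hle : supMass π f {θ | c ≤ f θ t} ≤ 0 := by
      -- The bound improves itself: for every data set `c Q(A) ≤ ∫_A f ≤ supMass(A) * u`. Taking the
      -- supremum over data sets costs a factor `u / c < 1`, which is possible only for `supMass(A)
      -- = 0`.
      have h1 : supMass π f {θ | c ≤ f θ t} ≤ supMass π f {θ | c ≤ f θ t} * (u / c) := by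
        refine ciSup_le fun d => ?_
        have := hc.proper d.1 d.2
        have h2 : c * (chainPosterior π f d.2).real {θ | c ≤ f θ t} ≤
            ∫ θ in {θ | c ≤ f θ t}, f θ t ∂(chainPosterior π f d.2) := by
          rw [mul_comm, ← smul_eq_mul, ← setIntegral_const]
          exact setIntegral_mono_on (integrable_const _).integrableOn
            (hc.integrable_likelihood _ _).integrableOn hA fun θ hθ => hθ
        have h3 := h2.trans (hc.setIntegral_le_supMass d.2 t hA)
        have h4 : 0 ≤ supMass π f {θ | c ≤ f θ t} :=
          measureReal_nonneg.trans (hc.le_supMass v _)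
        have h5 := h3.trans (mul_le_mul_of_nonneg_left (hu _ d.2) h4)
        rw [← mul_div_assoc, le_div_iff₀ (hu0.trans hcu)]
        linarith
      have h2 : u / c < 1 := (div_lt_one (hu0.trans hcu)).mpr hcu
      nlinarith
    have h0 := hc.real_eq_zero_of_supMass_le hle v
    rw [ae_iff]
    simpa using h0
  have h2 : ∀ᵐ θ ∂(chainPosterior π f v), ∀ m : ℕ, f θ t < u + 1 / ((m : ℝ) + 1) :=
    ae_all_iff.mpr fun m => key _ (lt_add_of_pos_right _ Nat.one_div_pos_of_nat)
  filter_upwards [h2] with θ hθ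
  refine le_of_forall_pos_lt_add fun ε hε => ?_
  obtain ⟨m, hm⟩ := exists_nat_one_div_lt hε
  linarith [hθ m]

end BayesModel

variable [MetricSpace Y]

/-- A Bayesian model whose predictive densities, over all data sets, have an envelope and are
uniformly equicontinuous. -/
structure RegularModel (lam : Measure Y) (π : Measure Θ) (f : Θ → Y → ℝ) (B : Y → ℝ) : Prop
    extends BayesModel lam π f where
  bound : ∀ n, ∀ (v : Fin (n + 1) → Y) (t : Y), |Real.log (predictive π f v t)| ≤ B t
  equi : UniformEquicontinuous
    fun (d : Σ n : ℕ, (Fin (n + 1) → Y)) (t : Y) => predictive π f d.2 t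

namespace RegularModel

variable {B : Y → ℝ}

theorem predictive_le (hr : RegularModel lam π f B) {n : ℕ} (v : Fin (n + 1) → Y) (t : Y) :
    predictive π f v t ≤ Real.exp (B t) := by
  rw [← Real.log_le_iff_le_exp (hr.pos n v t)]
  exact (abs_le.mp (hr.bound n v t)).2

theorem le_predictive (hr : RegularModel lam π f B) {n : ℕ} (v : Fin (n + 1) → Y) (t : Y) :
    Real.exp (-B t) ≤ predictive π f v t := by
  rw [← Real.le_log_iff_exp_le (hr.pos n v t)]
  exact (abs_le.mp (hr.bound n v t)).1

theorem ae_le_exp (hr : RegularModel lam π f B) {n : ℕ} (v : Fin (n + 1) → Y) (t : Y) :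
    ∀ᵐ θ ∂(chainPosterior π f v), f θ t ≤ Real.exp (B t) :=
  hr.ae_le_of_predictive_le (fun _ v => hr.predictive_le v t) v

theorem integrable_likelihood_mul (hr : RegularModel lam π f B) {n : ℕ} (v : Fin (n + 1) → Y)
    (s t : Y) : Integrable (fun θ => f θ s * f θ t) (chainPosterior π f v) := by
  refine (hr.integrable_likelihood v t).bdd_mul (c := Real.exp (B s))
    (hr.meas_param s).aestronglyMeasurable ?_
  filter_upwards [hr.ae_le_exp v s] with θ hθ
  rwa [Real.norm_of_nonneg (hr.nonneg _ _)]

/-- The likelihood at nearby points is close in `L²` of every posterior. -/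
theorem integral_sq_sub_le (hr : RegularModel lam π f B) {s t : Y} {ε : ℝ}
    (hε : ∀ n, ∀ v : Fin (n + 1) → Y, |predictive π f v s - predictive π f v t| ≤ ε)
    {n : ℕ} (v : Fin (n + 1) → Y) :
    ∫ θ, (f θ s - f θ t) ^ 2 ∂(chainPosterior π f v) ≤
      ε * (predictive π f v s + predictive π f v t) := by
  -- The expanded square pairs into two increments between `s` and `t` of predictive densities, one
  -- for the data enlarged by `s` and one for the data enlarged by `t`.
  have h1 : ∫ θ, (f θ s - f θ t) ^ 2 ∂(chainPosterior π f v) =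
      predictive π f v s * predictive π f (Fin.cons s v : Fin (n + 2) → Y) s -
      predictive π f v s * predictive π f (Fin.cons s v : Fin (n + 2) → Y) t +
      (predictive π f v t * predictive π f (Fin.cons t v : Fin (n + 2) → Y) t -
      predictive π f v t * predictive π f (Fin.cons t v : Fin (n + 2) → Y) s) := by
    simp only [hr.predictive_mul_predictive_cons]
    have i1 := hr.integrable_likelihood_mul v s s
    have i2 := hr.integrable_likelihood_mul v s t
    have i3 := hr.integrable_likelihood_mul v t t
    have i4 := hr.integrable_likelihood_mul v t s
    rw [← integral_sub i1 i2, ← integral_sub i3 i4]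
    refine Eq.trans ?_ (integral_add (i1.sub i2) (i3.sub i4))
    refine integral_congr_ae (ae_of_all _ fun θ => ?_)
    simp only [Pi.sub_apply]
    ring
  have h2 := (abs_le.mp (hε (n + 1) (Fin.cons s v))).2
  have h3 := (abs_le.mp (hε (n + 1) (Fin.cons t v))).1
  have h4 := hr.pos n v s
  have h5 := hr.pos n v t
  rw [h1]
  nlinarith

/-- The inequality `|x| ≤ η + x ^ 2 / η` turns the mean square bound into a bound in mean. -/
theorem integral_abs_sub_le (hr : RegularModel lam π f B) {s t : Y} {ε η : ℝ} (hη : 0 < η)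
    (hε : ∀ n, ∀ v : Fin (n + 1) → Y, |predictive π f v s - predictive π f v t| ≤ ε)
    {n : ℕ} (v : Fin (n + 1) → Y) :
    ∫ θ, |f θ s - f θ t| ∂(chainPosterior π f v) ≤
      η + ε * (predictive π f v s + predictive π f v t) / η := by
  have := hr.proper n v
  have i0 : Integrable (fun θ => (f θ s - f θ t) ^ 2) (chainPosterior π f v) := by
    have := ((hr.integrable_likelihood_mul v s s).sub
      ((hr.integrable_likelihood_mul v s t).const_mul 2)).add (hr.integrable_likelihood_mul v t t)
    refine this.congr (ae_of_all _ fun θ => ?_)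
    simp only [Pi.add_apply, Pi.sub_apply]
    ring
  have i1 : Integrable (fun θ => η + (f θ s - f θ t) ^ 2 / η) (chainPosterior π f v) :=
    (integrable_const _).add (i0.div_const _)
  calc ∫ θ, |f θ s - f θ t| ∂(chainPosterior π f v)
      ≤ ∫ θ, (η + (f θ s - f θ t) ^ 2 / η) ∂(chainPosterior π f v) := by
        refine integral_mono
          ((hr.integrable_likelihood v s).sub (hr.integrable_likelihood v t)).abs i1 fun θ => ?_
        simp only
        rw [← sq_abs, ← sub_nonneg]
        have : η + |f θ s - f θ t| ^ 2 / η - |f θ s - f θ t| =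
            ((|f θ s - f θ t| - η) ^ 2 + |f θ s - f θ t| * η) / η := by
          field_simp; ring
        rw [this]
        positivity
    _ = η + (∫ θ, (f θ s - f θ t) ^ 2 ∂(chainPosterior π f v)) / η := by
        rw [integral_add (integrable_const _) (i0.div_const _), integral_div]
        simp
    _ ≤ _ := by
        gcongr
        exact hr.integral_sq_sub_le hε v

theorem exists_predictive_close (hr : RegularModel lam π f B) {ε : ℝ} (hε : 0 < ε) :
    ∃ δ > 0, ∀ s t, dist s t < δ → ∀ n, ∀ v : Fin (n + 1) → Y,
      |predictive π f v s - predictive π f v t| ≤ ε := by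
  obtain ⟨δ, hδ, h⟩ := Metric.uniformEquicontinuous_iff.mp hr.equi ε hε
  exact ⟨δ, hδ, fun s t hst n v => (h s t hst ⟨n, v⟩).le⟩

/-- The defects of posterior probabilities from their supremum have total mass equal to the
defect at the current data set. -/
theorem lintegral_defect_add [SFinite lam] [SigmaFinite π] (hr : RegularModel lam π f B)
    {A : Set Θ} (hA : MeasurableSet A) {n : ℕ} (v : Fin (n + 1) → Y) :
    ∫⁻ s, ENNReal.ofReal (supMass π f A * predictive π f v s -
        ∫ θ in A, f θ s ∂(chainPosterior π f v)) ∂lam + chainPosterior π f v A =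
      ENNReal.ofReal (supMass π f A) := by
  have := hr.proper n v
  have hα : 0 ≤ supMass π f A := measureReal_nonneg.trans (hr.le_supMass v A)
  -- By Tonelli, since each likelihood integrates to one over the next observation. This is the
  -- martingale property of posterior probabilities; it is used for `A` and for the whole parameter
  -- space.
  have hswap : ∀ C : Set Θ, MeasurableSet C →
      ∫⁻ s, ENNReal.ofReal (∫ θ in C, f θ s ∂(chainPosterior π f v)) ∂lam =
        chainPosterior π f v C := fun C hC => by
    have h1 : ∀ s, ENNReal.ofReal (∫ θ in C, f θ s ∂(chainPosterior π f v)) =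
        ∫⁻ θ in C, ENNReal.ofReal (f θ s) ∂(chainPosterior π f v) := fun s =>
      ofReal_integral_eq_lintegral_ofReal (hr.integrable_likelihood v s).integrableOn
        (ae_of_all _ fun θ => hr.nonneg θ s)
    simp_rw [h1]
    rw [lintegral_lintegral_swap]
    · simp_rw [hr.density]
      simp
    · exact (hr.meas.comp measurable_swap).ennreal_ofReal.aemeasurable
  have hm : Measurable fun s => ENNReal.ofReal (∫ θ in A, f θ s ∂(chainPosterior π f v)) := by
    have h1 : StronglyMeasurable fun s => ∫ θ in A, f θ s ∂(chainPosterior π f v) :=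
      StronglyMeasurable.integral_prod_right'
        (f := fun z : Y × Θ => f z.2 z.1) (hr.meas.comp measurable_swap).stronglyMeasurable
    exact h1.measurable.ennreal_ofReal
  rw [← hswap A hA, ← lintegral_add_right _ hm]
  have h2 : ∀ s, ENNReal.ofReal (supMass π f A * predictive π f v s -
        ∫ θ in A, f θ s ∂(chainPosterior π f v)) +
        ENNReal.ofReal (∫ θ in A, f θ s ∂(chainPosterior π f v)) =
      ENNReal.ofReal (supMass π f A) *
        ENNReal.ofReal (∫ θ in Set.univ, f θ s ∂(chainPosterior π f v)) := fun s => by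
    rw [← ENNReal.ofReal_add (sub_nonneg.mpr (hr.setIntegral_le_supMass v s hA))
      (integral_nonneg fun θ => hr.nonneg θ s), sub_add_cancel, ENNReal.ofReal_mul hα,
      setIntegral_univ]
    rfl
  simp_rw [h2]
  rw [lintegral_const_mul', hswap _ MeasurableSet.univ, measure_univ, mul_one]
  exact ENNReal.ofReal_ne_top

/-- Under a posterior that nearly maximizes the probability of `A`, the likelihood at `t` is nearly
uncorrelated with `A`. -/
theorem exists_uncorrelated [SFinite lam] [BorelSpace Y] [lam.IsOpenPosMeasure] [SigmaFinite π]
    (hr : RegularModel lam π f B) {A : Set Θ} (hA : MeasurableSet A) (t : Y) {η : ℝ}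
    (hη : 0 < η) :
    ∃ κ > 0, ∀ n, ∀ v : Fin (n + 1) → Y,
      supMass π f A - κ ≤ (chainPosterior π f v).real A →
      |∫ θ in A, f θ t ∂(chainPosterior π f v) -
        (chainPosterior π f v).real A * predictive π f v t| ≤ η := by
  set U := Real.exp (B t) with hU
  have hU0 : 0 < U := Real.exp_pos _
  -- Error budget: two shares for moving from `s` to `t` under the integral, one for doing so in the
  -- predictive density, and one for either the defect at `s` or the distance of the probability of
  -- `A` from its supremum.
  set η₁ := η / 5 with hη₁
  have hη₁0 : 0 < η₁ := by positivity
  set ε := min (min 1 η₁) (η₁ ^ 2 / (2 * U + 1)) with hεdef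
  have hε0 : 0 < ε := by positivity
  have hε1 : ε ≤ 1 := (min_le_left _ _).trans (min_le_left _ _)
  have hε2 : ε ≤ η₁ := (min_le_left _ _).trans (min_le_right _ _)
  have hε3 : ε * (2 * U + 1) ≤ η₁ ^ 2 := by
    rw [← le_div_iff₀ (by positivity)]
    exact min_le_right _ _
  obtain ⟨δ, hδ, hclose⟩ := hr.exists_predictive_close hε0
  have hball : 0 < lam (Metric.ball t δ) := Metric.measure_ball_pos lam t hδ
  -- The ball may have infinite measure; the minimum with `1` provides a positive real lower bound.
  set l := (min (lam (Metric.ball t δ)) 1).toReal with hl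
  have hlt : min (lam (Metric.ball t δ)) 1 ≠ ∞ := ne_top_of_le_ne_top ENNReal.one_ne_top
    (min_le_right _ _)
  have hl0 : 0 < l := ENNReal.toReal_pos (lt_min hball one_pos).ne' hlt
  refine ⟨min (η₁ * l / 2) (η₁ / (U + 1)), by positivity, fun n v hv => ?_⟩
  have := hr.proper n v
  set Q := chainPosterior π f v with hQ
  have hexists : ∃ s ∈ Metric.ball t δ,
      supMass π f A * predictive π f v s - ∫ θ in A, f θ s ∂Q ≤ η₁ := by
    -- A defect above `η₁` on the whole ball would have mass at least `η₁ * l`, but the total defect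
    -- is at most `κ ≤ η₁ * l / 2`.
    by_contra! hcon
    have h1 := hr.lintegral_defect_add hA v
    have h2 : ENNReal.ofReal η₁ * lam (Metric.ball t δ) ≤ ∫⁻ s, ENNReal.ofReal
        (supMass π f A * predictive π f v s - ∫ θ in A, f θ s ∂Q) ∂lam := by
      rw [← setLIntegral_const]
      refine le_trans (setLIntegral_mono' ?_ fun s hs => ?_) (setLIntegral_le_lintegral _ _)
      · exact Metric.isOpen_ball.measurableSet
      · exact ENNReal.ofReal_le_ofReal (hcon s hs).le
    have h3 : ENNReal.ofReal η₁ * ENNReal.ofReal l + ENNReal.ofReal (Q.real A) ≤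
        ENNReal.ofReal (supMass π f A) := by
      rw [← h1, ofReal_measureReal]
      refine add_le_add (le_trans (mul_le_mul_right ?_ _) h2) le_rfl
      rw [hl, ENNReal.ofReal_toReal hlt]
      exact min_le_left _ _
    rw [← ENNReal.ofReal_mul hη₁0.le, ← ENNReal.ofReal_add (by positivity) measureReal_nonneg,
      ENNReal.ofReal_le_ofReal_iff (measureReal_nonneg.trans (hr.le_supMass v A))] at h3
    have h4 := min_le_left (η₁ * l / 2) (η₁ / (U + 1))
    have h5 : 0 < η₁ * l := by positivity
    linarith
  obtain ⟨s, hs, hdef⟩ := hexists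
  have hst := hclose s t hs
  have hps := hst n v
  have hpt : predictive π f v t ≤ U := hr.predictive_le v t
  have hps' := abs_le.mp hps
  have hl1 : ∫ θ, |f θ s - f θ t| ∂Q ≤ 2 * η₁ := by
    refine (hr.integral_abs_sub_le hη₁0 hst v).trans ?_
    have : ε * (predictive π f v s + predictive π f v t) / η₁ ≤ η₁ := by
      rw [div_le_iff₀ hη₁0, ← sq]
      refine le_trans (mul_le_mul_of_nonneg_left ?_ hε0.le) hε3
      linarith
    linarith
  have ha : |∫ θ in A, f θ s ∂Q - ∫ θ in A, f θ t ∂Q| ≤ 2 * η₁ := by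
    have i := (hr.integrable_likelihood v s).sub (hr.integrable_likelihood v t)
    rw [← integral_sub (hr.integrable_likelihood v s).integrableOn
      (hr.integrable_likelihood v t).integrableOn]
    refine (abs_integral_le_integral_abs).trans (le_trans ?_ hl1)
    exact setIntegral_le_integral i.abs (ae_of_all _ fun θ => abs_nonneg _)
  have hb := hr.setIntegral_le_supMass v s hA
  have hAle := hr.le_supMass v A
  have hA1 : Q.real A ≤ 1 := measureReal_le_one
  have hA0 : 0 ≤ Q.real A := measureReal_nonneg
  have hκ := min_le_right (η₁ * l / 2) (η₁ / (U + 1))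
  have hc : (supMass π f A - Q.real A) * predictive π f v s ≤ η₁ := by
    have h1 : supMass π f A - Q.real A ≤ η₁ / (U + 1) := by linarith
    have h2 : predictive π f v s ≤ U + 1 := by linarith
    calc (supMass π f A - Q.real A) * predictive π f v s
        ≤ η₁ / (U + 1) * (U + 1) := by
          refine mul_le_mul h1 h2 (hr.pos _ _ _).le (by positivity)
      _ = η₁ := by field_simp
  have hc0 : 0 ≤ (supMass π f A - Q.real A) * predictive π f v s :=
    mul_nonneg (by linarith) (hr.pos _ _ _).le
  have hd : |Q.real A * (predictive π f v s - predictive π f v t)| ≤ η₁ := by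
    rw [abs_mul, abs_of_nonneg hA0]
    calc Q.real A * |predictive π f v s - predictive π f v t| ≤ 1 * ε :=
          mul_le_mul hA1 hps (abs_nonneg _) zero_le_one
      _ ≤ η₁ := by linarith
  rw [abs_le] at ha hd ⊢
  constructor <;> nlinarith

/-- A data set close enough to the supremum serves both points. There the probability of `A` is at
least half the supremum, so the absolute error becomes a relative one. -/
theorem exists_uncorrelated_pair [SFinite lam] [BorelSpace Y] [lam.IsOpenPosMeasure] [SigmaFinite π]
    (hr : RegularModel lam π f B) {A : Set Θ} (hA : MeasurableSet A) (hpos : 0 < supMass π f A)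
    (s t : Y) {η : ℝ} (hη : 0 < η) :
    ∃ n, ∃ v : Fin (n + 1) → Y, 0 < (chainPosterior π f v).real A ∧
      |∫ θ in A, f θ s ∂(chainPosterior π f v) -
        (chainPosterior π f v).real A * predictive π f v s| ≤
          η * (chainPosterior π f v).real A ∧
      |∫ θ in A, f θ t ∂(chainPosterior π f v) -
        (chainPosterior π f v).real A * predictive π f v t| ≤
          η * (chainPosterior π f v).real A := by
  have : Nonempty (Σ n : ℕ, (Fin (n + 1) → Y)) := ⟨⟨0, fun _ => s⟩⟩
  obtain ⟨κ, hκ, h⟩ := hr.exists_uncorrelated hA s (mul_pos hη (half_pos hpos))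
  obtain ⟨κ', hκ', h'⟩ := hr.exists_uncorrelated hA t (mul_pos hη (half_pos hpos))
  have hlt : supMass π f A - min (min κ κ') (supMass π f A / 2) < supMass π f A :=
    sub_lt_self _ (lt_min (lt_min hκ hκ') (half_pos hpos))
  obtain ⟨⟨n, v⟩, hv⟩ := exists_lt_of_lt_ciSup hlt
  simp only at hv
  have h1 := min_le_left (min κ κ') (supMass π f A / 2)
  have h2 := min_le_right (min κ κ') (supMass π f A / 2)
  have h3 := min_le_left κ κ'
  have h4 := min_le_right κ κ'
  have h5 : supMass π f A / 2 ≤ (chainPosterior π f v).real A := by linarith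
  have h6 := mul_le_mul_of_nonneg_left h5 hη.le
  exact ⟨n, v, by linarith, (h n v (by linarith)).trans h6, (h' n v (by linarith)).trans h6⟩

/-- The likelihood inherits a uniform lower bound of the predictive densities. -/
theorem ae_ge_of_le_predictive [SFinite lam] [BorelSpace Y] [lam.IsOpenPosMeasure] [SigmaFinite π]
    (hr : RegularModel lam π f B) {t : Y} {l : ℝ}
    (hl : ∀ n, ∀ v : Fin (n + 1) → Y, l ≤ predictive π f v t) {n : ℕ} (v : Fin (n + 1) → Y) :
    ∀ᵐ θ ∂(chainPosterior π f v), l ≤ f θ t := by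
  have key : ∀ c, c < l → ∀ᵐ θ ∂(chainPosterior π f v), c < f θ t := fun c hcl => by
    have hA : MeasurableSet {θ | f θ t ≤ c} := measurableSet_le (hr.meas_param t) measurable_const
    have hle : supMass π f {θ | f θ t ≤ c} ≤ 0 := by
      -- Otherwise, for some data set, the mean of the likelihood over `A` is within `(l - c) / 2`
      -- of a predictive density, hence at least `(l + c) / 2 > c`, although the likelihood is at
      -- most `c` on `A`.
      by_contra! hpos
      obtain ⟨m, u, hu, h1, -⟩ := hr.exists_uncorrelated_pair hA hpos t t
        (half_pos (sub_pos.mpr hcl))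
      have := hr.proper m u
      have h2 : ∫ θ in {θ | f θ t ≤ c}, f θ t ∂(chainPosterior π f u) ≤
          c * (chainPosterior π f u).real {θ | f θ t ≤ c} := by
        rw [mul_comm, ← smul_eq_mul, ← setIntegral_const]
        exact setIntegral_mono_on (hr.integrable_likelihood _ _).integrableOn
          (integrable_const _).integrableOn hA fun θ hθ => hθ
      have h3 := (abs_le.mp h1).1
      have h4 := mul_le_mul_of_nonneg_left (hl m u) hu.le
      nlinarith
    have h0 := hr.real_eq_zero_of_supMass_le hle v
    rw [ae_iff]
    simpa using h0
  have h2 : ∀ᵐ θ ∂(chainPosterior π f v), ∀ m : ℕ, l - 1 / ((m : ℝ) + 1) < f θ t :=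
    ae_all_iff.mpr fun m => key _ (sub_lt_self _ Nat.one_div_pos_of_nat)
  filter_upwards [h2] with θ hθ
  refine le_of_forall_pos_lt_add fun ε hε => ?_
  obtain ⟨m, hm⟩ := exists_nat_one_div_lt hε
  linarith [hθ m]

/-- The likelihood inherits the modulus of continuity of the predictive densities. -/
theorem ae_sub_le_of_predictive_sub_le [SFinite lam] [BorelSpace Y] [lam.IsOpenPosMeasure] [SigmaFinite π]
    (hr : RegularModel lam π f B) {s t : Y} {ε : ℝ}
    (hε : ∀ n, ∀ v : Fin (n + 1) → Y, predictive π f v s - predictive π f v t ≤ ε)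
    {n : ℕ} (v : Fin (n + 1) → Y) :
    ∀ᵐ θ ∂(chainPosterior π f v), f θ s - f θ t ≤ ε := by
  have key : ∀ c, ε < c → ∀ᵐ θ ∂(chainPosterior π f v), f θ s - f θ t < c := fun c hcε => by
    have hA : MeasurableSet {θ | c ≤ f θ s - f θ t} :=
      measurableSet_le measurable_const ((hr.meas_param s).sub (hr.meas_param t))
    have hle : supMass π f {θ | c ≤ f θ s - f θ t} ≤ 0 := by
      by_contra! hpos
      -- With an error `(c - ε) / 4` at each of the two points, the mean of `f θ s - f θ t` over the
      -- set is at most `ε + (c - ε) / 2 < c`.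
      obtain ⟨m, u, hu, h1, h1'⟩ := hr.exists_uncorrelated_pair hA hpos s t
        (η := (c - ε) / 4) (by linarith)
      have := hr.proper m u
      have h2 : c * (chainPosterior π f u).real {θ | c ≤ f θ s - f θ t} ≤
          ∫ θ in {θ | c ≤ f θ s - f θ t}, (f θ s - f θ t) ∂(chainPosterior π f u) := by
        rw [mul_comm, ← smul_eq_mul, ← setIntegral_const]
        exact setIntegral_mono_on (integrable_const _).integrableOn
          ((hr.integrable_likelihood _ _).sub (hr.integrable_likelihood _ _)).integrableOn
          hA fun θ hθ => hθ
      rw [integral_sub (hr.integrable_likelihood _ _).integrableOn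
        (hr.integrable_likelihood _ _).integrableOn] at h2
      have h3 := (abs_le.mp h1).2
      have h3' := (abs_le.mp h1').1
      have h4 := mul_le_mul_of_nonneg_left (hε m u) hu.le
      nlinarith
    have h0 := hr.real_eq_zero_of_supMass_le hle v
    rw [ae_iff]
    simpa using h0
  have h2 : ∀ᵐ θ ∂(chainPosterior π f v), ∀ m : ℕ, f θ s - f θ t < ε + 1 / ((m : ℝ) + 1) :=
    ae_all_iff.mpr fun m => key _ (lt_add_of_pos_right _ Nat.one_div_pos_of_nat)
  filter_upwards [h2] with θ hθ
  refine le_of_forall_pos_lt_add fun ε hε => ?_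
  obtain ⟨m, hm⟩ := exists_nat_one_div_lt hε
  linarith [hθ m]

theorem ae_mem_Icc [SFinite lam] [BorelSpace Y] [lam.IsOpenPosMeasure] [SigmaFinite π]
    (hr : RegularModel lam π f B) {n : ℕ} (v : Fin (n + 1) → Y) (t : Y) :
    ∀ᵐ θ ∂(chainPosterior π f v), f θ t ∈ Set.Icc (Real.exp (-B t)) (Real.exp (B t)) := by
  filter_upwards [hr.ae_le_exp v t, hr.ae_ge_of_le_predictive (fun _ v => hr.le_predictive v t) v]
    with θ h1 h2 using ⟨h2, h1⟩

end RegularModel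

/-- The assumptions keep `x` above `m / 2`, where the logarithm has Lipschitz constant `2 / m`. -/
theorem abs_log_sub_log_le {x a m ε : ℝ} (hm : 0 < m) (ha : m ≤ a) (hx : |x - a| ≤ m / 2 * ε)
    (hε : ε ≤ 1) : |Real.log x - Real.log a| ≤ ε := by
  have h1 := abs_le.mp hx
  have ha0 : 0 < a := hm.trans_le ha
  have hε0 : 0 ≤ ε := by
    by_contra! h
    have := abs_nonneg (x - a)
    nlinarith
  have hx0 : m / 2 ≤ x := by nlinarith
  have hx1 : 0 < x := by linarith
  rw [← Real.log_div hx1.ne' ha0.ne', abs_le]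
  constructor
  · rw [← neg_neg (Real.log (x / a)), ← Real.log_inv, inv_div]
    have h2 := Real.log_le_sub_one_of_pos (div_pos ha0 hx1)
    have h3 : a / x - 1 ≤ ε := by
      rw [div_sub_one hx1.ne', div_le_iff₀ hx1]
      nlinarith
    linarith
  · have h2 := Real.log_le_sub_one_of_pos (div_pos hx1 ha0)
    have h3 : x / a - 1 ≤ ε := by
      rw [div_sub_one ha0.ne', div_le_iff₀ ha0]
      nlinarith
    linarith

/-- The smallest envelope of the log predictive densities. -/
def logEnvelope (π : Measure Θ) (f : Θ → Y → ℝ) (t : Y) : ℝ :=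
  ⨆ d : Σ n : ℕ, (Fin (n + 1) → Y), |Real.log (predictive π f d.2 t)|

namespace RegularModel

variable {B : Y → ℝ}

/-- Pointwise equicontinuity of the log predictive densities and of the log likelihood. -/
theorem exists_log_close [SFinite lam] [BorelSpace Y] [lam.IsOpenPosMeasure] [SigmaFinite π]
    (hr : RegularModel lam π f B) (t : Y) {ε : ℝ} (hε : 0 < ε) :
    ∃ δ > 0, ∀ s, dist s t < δ → ∀ n, ∀ v : Fin (n + 1) → Y,
      |Real.log (predictive π f v s) - Real.log (predictive π f v t)| ≤ ε ∧
      ∀ᵐ θ ∂(chainPosterior π f v), |Real.log (f θ s) - Real.log (f θ t)| ≤ ε := by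
  have hm : 0 < Real.exp (-B t) := Real.exp_pos _
  have h1 : min ε 1 ≤ 1 := min_le_right _ _
  have h2 : min ε 1 ≤ ε := min_le_left _ _
  obtain ⟨δ, hδ, h⟩ := hr.exists_predictive_close
    (ε := Real.exp (-B t) / 2 * min ε 1) (by positivity)
  refine ⟨δ, hδ, fun s hs n v => ⟨?_, ?_⟩⟩
  · exact (abs_log_sub_log_le hm (hr.le_predictive v t) (h s t hs n v) h1).trans h2
  · have h3 := hr.ae_sub_le_of_predictive_sub_le (fun n v => (abs_le.mp (h s t hs n v)).2) v
    have h4 := hr.ae_sub_le_of_predictive_sub_le (s := t) (t := s)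
      (ε := Real.exp (-B t) / 2 * min ε 1)
      (fun n v => by linarith [(abs_le.mp (h s t hs n v)).1]) v
    filter_upwards [h3, h4, hr.ae_mem_Icc v t] with θ h3 h4 h5
    exact (abs_log_sub_log_le hm h5.1 (abs_le.mpr ⟨by linarith, h3⟩) h1).trans h2

theorem le_logEnvelope (hr : RegularModel lam π f B) {n : ℕ} (v : Fin (n + 1) → Y) (t : Y) :
    |Real.log (predictive π f v t)| ≤ logEnvelope π f t := by
  refine le_ciSup (f := fun d : Σ n : ℕ, (Fin (n + 1) → Y) => |Real.log (predictive π f d.2 t)|)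
    ⟨B t, ?_⟩ ⟨n, v⟩
  rintro _ ⟨d, rfl⟩
  exact hr.bound _ _ _

theorem logEnvelope_le (hr : RegularModel lam π f B) (t : Y) : logEnvelope π f t ≤ B t := by
  have : Nonempty (Σ n : ℕ, (Fin (n + 1) → Y)) := ⟨⟨0, fun _ => t⟩⟩
  exact ciSup_le fun d => hr.bound _ _ _

theorem logEnvelope_nonneg (hr : RegularModel lam π f B) (t : Y) : 0 ≤ logEnvelope π f t :=
  (abs_nonneg _).trans (hr.le_logEnvelope (fun _ : Fin 1 => t) t)

/-- The given envelope need not be measurable. The smallest one is even continuous, by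
equicontinuity of the log predictive densities, and replaces it from here on. -/
theorem withLogEnvelope (hr : RegularModel lam π f B) :
    RegularModel lam π f (logEnvelope π f) :=
  { hr with bound := fun _ v t => hr.le_logEnvelope v t }

theorem continuous_logEnvelope [SFinite lam] [BorelSpace Y] [lam.IsOpenPosMeasure] [SigmaFinite π]
    (hr : RegularModel lam π f B) : Continuous (logEnvelope π f) := by
  refine Metric.continuous_iff.mpr fun t ε hε => ?_
  have : Nonempty (Σ n : ℕ, (Fin (n + 1) → Y)) := ⟨⟨0, fun _ => t⟩⟩
  obtain ⟨δ, hδ, h⟩ := hr.exists_log_close t (half_pos hε)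
  refine ⟨δ, hδ, fun s hs => ?_⟩
  have h1 : logEnvelope π f s ≤ logEnvelope π f t + ε / 2 := by
    refine ciSup_le fun d => ?_
    have h2 := (h s hs d.1 d.2).1
    have h3 := abs_sub_abs_le_abs_sub (Real.log (predictive π f d.2 s))
      (Real.log (predictive π f d.2 t))
    linarith [hr.le_logEnvelope d.2 t]
  have h1' : logEnvelope π f t ≤ logEnvelope π f s + ε / 2 := by
    refine ciSup_le fun d => ?_
    have h2 := (h s hs d.1 d.2).1
    rw [abs_sub_comm] at h2
    have h3 := abs_sub_abs_le_abs_sub (Real.log (predictive π f d.2 t))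
      (Real.log (predictive π f d.2 s))
    linarith [hr.le_logEnvelope d.2 s]
  rw [Real.dist_eq, abs_lt]
  constructor <;> linarith

end RegularModel

end Regularity

/-! ### A uniform law of large numbers -/

section UniformLaw

/-- Lindelöf: countably many of the interiors cover the space, and they are made disjoint. -/
theorem exists_measurable_partition {Y : Type*} [TopologicalSpace Y] [SecondCountableTopology Y]
    [MeasurableSpace Y] [OpensMeasurableSpace Y] [Nonempty Y] {N : Y → Set Y}
    (hN : ∀ t, N t ∈ 𝓝 t) :
    ∃ (z : ℕ → Y) (A : ℕ → Set Y), (∀ j, MeasurableSet (A j)) ∧ (∀ j, A j ⊆ N (z j)) ∧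
      Pairwise (fun i j => Disjoint (A i) (A j)) ∧ ∀ t, ∃ j, t ∈ A j := by
  obtain ⟨s, hs, hcover⟩ := TopologicalSpace.countable_cover_nhds
    (f := fun t => interior (N t)) fun t => interior_mem_nhds.mpr (hN t)
  have hne : s.Nonempty := by
    by_contra h
    rw [Set.not_nonempty_iff_eq_empty] at h
    simp [h] at hcover
    exact (Set.univ_nonempty (α := Y)).ne_empty hcover.symm
  obtain ⟨z, hz⟩ := hs.exists_eq_range hne
  refine ⟨z, disjointed fun j => interior (N (z j)), ?_, fun j => ?_, disjoint_disjointed _,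
    fun t => ?_⟩
  · exact fun j => MeasurableSet.disjointed (fun i => isOpen_interior.measurableSet) j
  · exact (disjointed_subset _ j).trans interior_subset
  · rw [← Set.mem_iUnion, iUnion_disjointed]
    have ht : t ∈ ⋃ x ∈ s, interior (N x) := hcover ▸ Set.mem_univ t
    rw [hz, Set.biUnion_range] at ht
    exact ht

variable {Y : Type*} [MeasurableSpace Y] (P : Measure Y) [IsProbabilityMeasure P]

theorem integral_sum_div_eq {n : ℕ} (hn : n ≠ 0) {g : Y → ℝ} (hg : Integrable g P) :
    ∫ v : Fin n → Y, (∑ i, g (v i)) / n ∂(Measure.pi fun _ => P) = ∫ t, g t ∂P := by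
  have h : ∀ i : Fin n, ∫ v : Fin n → Y, g (v i) ∂(Measure.pi fun _ => P) = ∫ t, g t ∂P :=
    fun i => integral_comp_eval (μ := fun _ : Fin n => P) hg.1
  rw [integral_div, integral_finsetSum _ fun i _ => integrable_comp_eval (μ := fun _ : Fin n => P) hg]
  simp_rw [h]
  have : (n : ℝ) ≠ 0 := Nat.cast_ne_zero.mpr hn
  simp [this]

theorem integrable_sum_div (n : ℕ) {g : Y → ℝ} (hg : Integrable g P) :
    Integrable (fun v : Fin n → Y => (∑ i, g (v i)) / n) (Measure.pi fun _ => P) :=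
  (integrable_finsetSum _ fun _ _ =>
    integrable_comp_eval (μ := fun _ : Fin n => P) hg).div_const _

theorem memLp_two_comp_eval {n : ℕ} (i : Fin n) {g : Y → ℝ} (hg : MemLp g 2 P) :
    MemLp (fun v : Fin n → Y => g (v i)) 2 (Measure.pi fun _ => P) :=
  hg.comp_measurePreserving (measurePreserving_eval (fun _ : Fin n => P) i)

theorem memLp_two_sum_div (n : ℕ) {g : Y → ℝ} (hg : MemLp g 2 P) :
    MemLp (fun v : Fin n → Y => (∑ i, g (v i)) / n) 2 (Measure.pi fun _ => P) := by
  have h := (memLp_finsetSum Finset.univ fun (i : Fin n) _ =>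
    memLp_two_comp_eval P i hg).const_mul ((n : ℝ)⁻¹)
  simpa only [div_eq_inv_mul] using h

theorem memLp_two_indicator_one {A : Set Y} (hA : MeasurableSet A) :
    MemLp (A.indicator (1 : Y → ℝ)) 2 P :=
  memLp_indicator_const 2 hA 1 (Or.inr (by simp))

theorem memLp_two_frequency_sub (n : ℕ) {A : Set Y} (hA : MeasurableSet A) :
    MemLp (fun v : Fin n → Y => (∑ i, A.indicator (1 : Y → ℝ) (v i)) / n - P.real A) 2
      (Measure.pi fun _ => P) :=
  (memLp_two_sum_div P n (memLp_two_indicator_one P hA)).sub (memLp_const _)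

/-- The variance of an empirical frequency. -/
theorem integral_sq_frequency_sub_le {n : ℕ} (hn : n ≠ 0) {A : Set Y} (hA : MeasurableSet A) :
    ∫ v : Fin n → Y, ((∑ i, A.indicator (1 : Y → ℝ) (v i)) / n - P.real A) ^ 2
      ∂(Measure.pi fun _ => P) ≤ 1 / n := by
  have hn0 : (0 : ℝ) < n := Nat.cast_pos.mpr (Nat.pos_of_ne_zero hn)
  have hm := memLp_two_indicator_one P hA
  have h1 := variance_sum_pi (μ := fun _ : Fin n => P) (X := fun _ => A.indicator (1 : Y → ℝ))
    fun _ => hm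
  have h2 : Var[A.indicator (1 : Y → ℝ); P] ≤ 1 := by
    refine (variance_le_expectation_sq hm.1).trans ?_
    have : (A.indicator (1 : Y → ℝ)) ^ 2 = A.indicator 1 := by
      ext t; by_cases ht : t ∈ A <;> simp [ht]
    rw [this, integral_indicator_one hA]
    exact measureReal_le_one
  have h3 : ∫ v : Fin n → Y, (∑ i, A.indicator (1 : Y → ℝ) (v i)) ∂(Measure.pi fun _ => P) =
      n * P.real A := by
    have := integral_sum_div_eq P hn (hm.integrable (by norm_num))
    rw [integral_div, integral_indicator_one hA, div_eq_iff hn0.ne'] at this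
    rw [this, mul_comm]
  have h4 : (∑ i : Fin n, fun ω : Fin n → Y => A.indicator (1 : Y → ℝ) (ω i)) =
      fun v => ∑ i, A.indicator (1 : Y → ℝ) (v i) := by
    ext v; simp
  have h6 : Measurable fun v : Fin n → Y => ∑ i, A.indicator (1 : Y → ℝ) (v i) :=
    Finset.measurable_sum _ fun i _ => (measurable_one.indicator hA).comp (measurable_pi_apply i)
  rw [h4, variance_eq_integral h6.aemeasurable, h3] at h1
  have h5 : ∀ v : Fin n → Y, ((∑ i, A.indicator (1 : Y → ℝ) (v i)) / n - P.real A) ^ 2 =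
      (∑ i, A.indicator (1 : Y → ℝ) (v i) - n * P.real A) ^ 2 / n ^ 2 := fun v => by
    field_simp
  simp_rw [h5]
  rw [integral_div, h1, div_le_div_iff₀ (by positivity) hn0]
  have h6 : ∑ _i : Fin n, Var[A.indicator (1 : Y → ℝ); P] ≤ n := by
    refine (Finset.sum_le_sum fun _ _ => h2).trans ?_
    simp
  nlinarith

theorem sum_div_sq_le {n : ℕ} (a : Fin n → ℝ) : ((∑ i, a i) / n) ^ 2 ≤ (∑ i, a i ^ 2) / n := by
  rcases Nat.eq_zero_or_pos n with rfl | hn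
  · simp
  have hn0 : (0 : ℝ) < n := Nat.cast_pos.mpr hn
  have h := sq_sum_le_card_mul_sum_sq (s := Finset.univ) (f := a)
  rw [Finset.card_univ, Fintype.card_fin] at h
  rw [div_pow, div_le_div_iff₀ (by positivity) hn0]
  nlinarith

/-- The error bound of the uniform law of large numbers, for a finite partition `A j`, `j < J`,
with base points `z j`, of a part of the space on whose complement the envelope `H` is used. -/
def empiricalErrorBound (H : Y → ℝ) (z : ℕ → Y) (A : ℕ → Set Y) (J : ℕ) (ε : ℝ) {n : ℕ}
    (v : Fin n → Y) : ℝ :=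
  2 * ε + (∑ i, (⋃ j < J, A j)ᶜ.indicator H (v i)) / n + ∫ t, (⋃ j < J, A j)ᶜ.indicator H t ∂P +
    ∑ j ∈ Finset.range J, H (z j) * |(∑ i, (A j).indicator (1 : Y → ℝ) (v i)) / n - P.real (A j)|

variable {P}

/-- `F` is replaced by the step function with value `F (z j)` on `A j` and zero elsewhere, at a cost
of `ε` plus a tail of `H` under both the empirical measure and `P`. The step function involves `F`
only through finitely many values bounded by `H`, so the right side is free of `F`, which may depend
on the data. -/
theorem abs_sum_div_sub_integral_le {H : Y → ℝ} {z : ℕ → Y} {A : ℕ → Set Y} {J : ℕ} {ε : ℝ}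
    (hε : 0 ≤ ε) (hH : Integrable H P) (hA : ∀ j, MeasurableSet (A j))
    (hdisj : Pairwise fun i j => Disjoint (A i) (A j)) {n : ℕ} (hn : n ≠ 0) (v : Fin n → Y)
    {F : Y → ℝ} (hF : AEStronglyMeasurable F P) (hFz : ∀ j < J, |F (z j)| ≤ H (z j))
    (hFv : ∀ i, |F (v i)| ≤ H (v i)) (hFP : ∀ᵐ t ∂P, |F t| ≤ H t)
    (hcv : ∀ j < J, ∀ i, v i ∈ A j → |F (v i) - F (z j)| ≤ ε)
    (hcP : ∀ᵐ t ∂P, ∀ j < J, t ∈ A j → |F t - F (z j)| ≤ ε) :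
    |(∑ i, F (v i)) / n - ∫ t, F t ∂P| ≤ empiricalErrorBound P H z A J ε v := by
  have hn0 : (0 : ℝ) < n := Nat.cast_pos.mpr (Nat.pos_of_ne_zero hn)
  have hrest : MeasurableSet (⋃ j < J, A j)ᶜ :=
    (MeasurableSet.iUnion fun j => MeasurableSet.iUnion fun _ => hA j).compl
  set h : Y → ℝ := (⋃ j < J, A j)ᶜ.indicator H with hh
  have hhi : Integrable h P := hH.indicator hrest
  set G : Y → ℝ := fun t => ∑ j ∈ Finset.range J, F (z j) * (A j).indicator (1 : Y → ℝ) t with hG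
  have hindi : ∀ j, Integrable ((A j).indicator (1 : Y → ℝ)) P := fun j =>
    (integrable_const (1 : ℝ)).indicator (hA j)
  have hGi : Integrable G P := integrable_finsetSum _ fun j _ => (hindi j).const_mul _
  have hFi : Integrable F P := hH.mono' hF hFP
  have hpt : ∀ t, |F t| ≤ H t → (∀ j < J, t ∈ A j → |F t - F (z j)| ≤ ε) →
      |F t - G t| ≤ ε + h t := fun t h1 h2 => by
    by_cases ht : ∃ j < J, t ∈ A j
    · obtain ⟨j, hj, htj⟩ := ht
      have hGt : G t = F (z j) := by
        rw [hG]
        simp only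
        rw [Finset.sum_eq_single_of_mem j (Finset.mem_range.mpr hj)]
        · simp [htj]
        · intro i _ hij
          have : t ∉ A i := fun hti => Set.disjoint_left.mp (hdisj hij) hti htj
          simp [this]
      have hht : h t = 0 := Set.indicator_of_notMem (by simpa using ⟨j, hj, htj⟩) _
      rw [hGt, hht, add_zero]
      exact h2 j hj htj
    · have hGt : G t = 0 := by
        refine Finset.sum_eq_zero fun j hj => ?_
        have : t ∉ A j := fun htj => ht ⟨j, Finset.mem_range.mp hj, htj⟩
        simp [this]
      have hht : h t = H t := Set.indicator_of_mem (by simpa using ht) _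
      rw [hGt, hht, sub_zero]
      linarith
  have hvpart : |(∑ i, F (v i)) / n - (∑ i, G (v i)) / n| ≤ ε + (∑ i, h (v i)) / n := by
    rw [← sub_div, ← Finset.sum_sub_distrib, abs_div, abs_of_pos hn0, div_le_iff₀ hn0, add_mul,
      div_mul_cancel₀ _ hn0.ne']
    refine (Finset.abs_sum_le_sum_abs _ _).trans ?_
    refine (Finset.sum_le_sum fun i _ => hpt (v i) (hFv i) fun j hj => hcv j hj i).trans ?_
    rw [Finset.sum_add_distrib]
    simp [mul_comm]
  have hPpart : |∫ t, F t ∂P - ∫ t, G t ∂P| ≤ ε + ∫ t, h t ∂P := by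
    rw [← integral_sub hFi hGi]
    refine abs_integral_le_integral_abs.trans ?_
    refine (integral_mono_ae (hFi.sub hGi).abs ((integrable_const ε).add hhi) ?_).trans ?_
    · filter_upwards [hFP, hcP] with t h1 h2 using hpt t h1 h2
    · refine (integral_add (integrable_const ε) hhi).le.trans ?_
      simp
  have hGpart : |(∑ i, G (v i)) / n - ∫ t, G t ∂P| ≤
      ∑ j ∈ Finset.range J,
        H (z j) * |(∑ i, (A j).indicator (1 : Y → ℝ) (v i)) / n - P.real (A j)| := by
    have e1 : ∫ t, G t ∂P = ∑ j ∈ Finset.range J, F (z j) * P.real (A j) := by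
      rw [hG, integral_finsetSum _ fun j _ => (hindi j).const_mul _]
      refine Finset.sum_congr rfl fun j _ => ?_
      rw [integral_const_mul, integral_indicator_one (hA j)]
    have e2 : (∑ i, G (v i)) / n = ∑ j ∈ Finset.range J,
        F (z j) * ((∑ i, (A j).indicator (1 : Y → ℝ) (v i)) / n) := by
      rw [hG, Finset.sum_comm, Finset.sum_div]
      refine Finset.sum_congr rfl fun j _ => ?_
      rw [← Finset.mul_sum, mul_div_assoc]
    rw [e1, e2, ← Finset.sum_sub_distrib]
    refine (Finset.abs_sum_le_sum_abs _ _).trans (Finset.sum_le_sum fun j hj => ?_)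
    rw [← mul_sub, abs_mul]
    exact mul_le_mul_of_nonneg_right (hFz j (Finset.mem_range.mp hj)) (abs_nonneg _)
  unfold empiricalErrorBound
  rw [abs_le] at *
  constructor <;> linarith [hvpart.1, hvpart.2, hPpart.1, hPpart.2, hGpart.1, hGpart.2]

theorem measurable_empiricalErrorBound {H : Y → ℝ} {z : ℕ → Y} {A : ℕ → Set Y} {J : ℕ} {ε : ℝ}
    (hHm : Measurable H) (hA : ∀ j, MeasurableSet (A j)) (n : ℕ) :
    Measurable fun v : Fin n → Y => empiricalErrorBound P H z A J ε v := by
  have h1 : Measurable ((⋃ j < J, A j)ᶜ.indicator H) := hHm.indicator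
    (MeasurableSet.iUnion fun j => MeasurableSet.iUnion fun _ => hA j).compl
  have h2 : ∀ j, Measurable ((A j).indicator (1 : Y → ℝ)) := fun j =>
    measurable_one.indicator (hA j)
  unfold empiricalErrorBound
  fun_prop

theorem empiricalErrorBound_nonneg {H : Y → ℝ} {z : ℕ → Y} {A : ℕ → Set Y} {J : ℕ} {ε : ℝ}
    (hε : 0 ≤ ε) (hH0 : ∀ t, 0 ≤ H t) {n : ℕ} (v : Fin n → Y) :
    0 ≤ empiricalErrorBound P H z A J ε v := by
  have h0 : ∀ t, 0 ≤ (⋃ j < J, A j)ᶜ.indicator H t := fun t =>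
    Set.indicator_nonneg (fun t _ => hH0 t) t
  have h1 := integral_nonneg (μ := P) (f := (⋃ j < J, A j)ᶜ.indicator H) h0
  have h2 : 0 ≤ (∑ i, (⋃ j < J, A j)ᶜ.indicator H (v i)) / n :=
    div_nonneg (Finset.sum_nonneg fun i _ => h0 _) (Nat.cast_nonneg _)
  have h3 : 0 ≤ ∑ j ∈ Finset.range J,
      H (z j) * |(∑ i, (A j).indicator (1 : Y → ℝ) (v i)) / n - P.real (A j)| :=
    Finset.sum_nonneg fun j _ => mul_nonneg (hH0 _) (abs_nonneg _)
  unfold empiricalErrorBound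
  linarith

theorem memLp_empiricalErrorBound {H : Y → ℝ} {z : ℕ → Y} {A : ℕ → Set Y} {J : ℕ} {ε : ℝ}
    (hHm : Measurable H) (hH2 : MemLp H 2 P) (hA : ∀ j, MeasurableSet (A j)) (n : ℕ) :
    MemLp (fun v : Fin n → Y => empiricalErrorBound P H z A J ε v) 2
      (Measure.pi fun _ => P) := by
  have hrest : MeasurableSet (⋃ j < J, A j)ᶜ :=
    (MeasurableSet.iUnion fun j => MeasurableSet.iUnion fun _ => hA j).compl
  have h1 := memLp_two_sum_div P n (hH2.indicator hrest)
  have h2 : MemLp (fun v : Fin n → Y => ∑ j ∈ Finset.range J,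
      H (z j) * |(∑ i, (A j).indicator (1 : Y → ℝ) (v i)) / n - P.real (A j)|) 2
      (Measure.pi fun _ => P) :=
    memLp_finsetSum _ fun j _ => (memLp_two_frequency_sub P n (hA j)).abs.const_mul _
  have h3 : MemLp (fun v : Fin n → Y => 2 * ε + (∑ i, (⋃ j < J, A j)ᶜ.indicator H (v i)) / n) 2
      (Measure.pi fun _ => P) := (memLp_const (2 * ε)).add h1
  have h4 : MemLp (fun v : Fin n → Y => 2 * ε + (∑ i, (⋃ j < J, A j)ᶜ.indicator H (v i)) / n +
      ∫ t, (⋃ j < J, A j)ᶜ.indicator H t ∂P) 2 (Measure.pi fun _ => P) := h3.add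
      (memLp_const (∫ t, (⋃ j < J, A j)ᶜ.indicator H t ∂P))
  refine (h4.add h2).congr_norm (measurable_empiricalErrorBound hHm hA n).aestronglyMeasurable
    (ae_of_all _ fun v => ?_)
  rw [Pi.add_apply, empiricalErrorBound]

theorem integral_sq_empiricalErrorBound_le {H : Y → ℝ} {z : ℕ → Y} {A : ℕ → Set Y} {J : ℕ}
    {ε : ℝ} (hHm : Measurable H) (hH2 : MemLp H 2 P)
    (hA : ∀ j, MeasurableSet (A j)) {n : ℕ} (hn : n ≠ 0) :
    ∫ v : Fin n → Y, empiricalErrorBound P H z A J ε v ^ 2 ∂(Measure.pi fun _ => P) ≤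
      16 * ε ^ 2 + 8 * ∫ t, (⋃ j < J, A j)ᶜ.indicator H t ^ 2 ∂P +
        4 * (J * ∑ j ∈ Finset.range J, H (z j) ^ 2) / n := by
  have hrest : MeasurableSet (⋃ j < J, A j)ᶜ :=
    (MeasurableSet.iUnion fun j => MeasurableSet.iUnion fun _ => hA j).compl
  set h : Y → ℝ := (⋃ j < J, A j)ᶜ.indicator H with hh
  have hh2 : MemLp h 2 P := hH2.indicator hrest
  have hhsq : Integrable (fun t => h t ^ 2) P := hh2.integrable_sq
  set Δ : ℕ → (Fin n → Y) → ℝ := fun j v =>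
    (∑ i, (A j).indicator (1 : Y → ℝ) (v i)) / n - P.real (A j) with hΔ
  have hΔ2 : ∀ j, Integrable (fun v => Δ j v ^ 2) (Measure.pi fun _ : Fin n => P) := fun j =>
    (memLp_two_frequency_sub P n (hA j)).integrable_sq
  have hmean : (∫ t, h t ∂P) ^ 2 ≤ ∫ t, h t ^ 2 ∂P := by
    have h1 := variance_nonneg h P
    rw [variance_eq_sub hh2] at h1
    have h2 : ∫ t, (h ^ 2) t ∂P = ∫ t, h t ^ 2 ∂P := rfl
    linarith
  have hpt : ∀ v : Fin n → Y, empiricalErrorBound P H z A J ε v ^ 2 ≤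
      (16 * ε ^ 2 + 4 * (∫ t, h t ∂P) ^ 2) + 4 * ((∑ i, h (v i) ^ 2) / n) +
        4 * (J * ∑ j ∈ Finset.range J, H (z j) ^ 2 * Δ j v ^ 2) := fun v => by
    have h1 := sum_div_sq_le fun i => h (v i)
    have h2 : (∑ j ∈ Finset.range J, H (z j) * |Δ j v|) ^ 2 ≤
        J * ∑ j ∈ Finset.range J, H (z j) ^ 2 * Δ j v ^ 2 := by
      have := sq_sum_le_card_mul_sum_sq (s := Finset.range J) (f := fun j => H (z j) * |Δ j v|)
      simpa only [mul_pow, sq_abs, Finset.card_range] using this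
    -- Cauchy–Schwarz with four terms. The empirical tail and the expected tail each contribute `4 ∫
    -- h ^ 2`, whence the `8`.
    have h3 : ∀ a b c d : ℝ, (2 * a + b + c + d) ^ 2 ≤
        16 * a ^ 2 + 4 * c ^ 2 + 4 * b ^ 2 + 4 * d ^ 2 := fun a b c d => by
      nlinarith [sq_nonneg (2 * a - b), sq_nonneg (2 * a - c), sq_nonneg (2 * a - d),
        sq_nonneg (b - c), sq_nonneg (b - d), sq_nonneg (c - d)]
    have h4 := h3 ε ((∑ i, h (v i)) / n) (∫ t, h t ∂P) (∑ j ∈ Finset.range J, H (z j) * |Δ j v|)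
    unfold empiricalErrorBound
    linarith
  have i1 := integrable_sum_div P n hhsq
  have i2 : Integrable (fun v => ∑ j ∈ Finset.range J, H (z j) ^ 2 * Δ j v ^ 2)
      (Measure.pi fun _ : Fin n => P) :=
    integrable_finsetSum _ fun j _ => (hΔ2 j).const_mul _
  have i3 : Integrable (fun v : Fin n → Y => (16 * ε ^ 2 + 4 * (∫ t, h t ∂P) ^ 2) +
      4 * ((∑ i, h (v i) ^ 2) / n)) (Measure.pi fun _ : Fin n => P) :=
    (integrable_const _).add (i1.const_mul 4)
  have i4 := (i2.const_mul (J : ℝ)).const_mul 4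
  refine (integral_mono (memLp_empiricalErrorBound hHm hH2 hA n).integrable_sq
    (i3.add i4) hpt).trans ?_
  refine (integral_add i3 i4).le.trans ?_
  rw [integral_add (integrable_const _) (i1.const_mul 4), integral_const_mul, integral_const_mul,
    integral_const_mul, integral_sum_div_eq P hn hhsq,
    integral_finsetSum _ fun j _ => (hΔ2 j).const_mul _]
  simp_rw [integral_const_mul]
  have h5 : ∑ j ∈ Finset.range J, H (z j) ^ 2 * ∫ v, Δ j v ^ 2 ∂(Measure.pi fun _ : Fin n => P) ≤
      (∑ j ∈ Finset.range J, H (z j) ^ 2) / n := by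
    rw [Finset.sum_div]
    refine Finset.sum_le_sum fun j _ => ?_
    rw [div_eq_mul_one_div]
    exact mul_le_mul_of_nonneg_left (integral_sq_frequency_sub_le P hn (hA j)) (sq_nonneg _)
  have h6 := mul_le_mul_of_nonneg_left h5 (Nat.cast_nonneg (α := ℝ) J)
  have h7 : 4 * (J * ∑ j ∈ Finset.range J, H (z j) ^ 2) / n =
      4 * (J * ((∑ j ∈ Finset.range J, H (z j) ^ 2) / n)) := by ring
  rw [h7]
  simp only [integral_const, probReal_univ, one_smul]
  linarith

/-- A uniform law of large numbers for functions with a square integrable envelope `H` and the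
modulus of continuity `ε` on the neighbourhoods `N t` of finitely many points `t`. -/
theorem exists_uniform_law [TopologicalSpace Y] [SecondCountableTopology Y]
    [OpensMeasurableSpace Y] {H : Y → ℝ} (hHm : Measurable H) (hH0 : ∀ t, 0 ≤ H t)
    (hH2 : MemLp H 2 P) {ε : ℝ} (hε : 0 < ε) {N : Y → Set Y} (hN : ∀ t, N t ∈ 𝓝 t) :
    ∃ (Z : Finset Y) (R : ∀ n, (Fin n → Y) → ℝ), (∀ n v, 0 ≤ R n v) ∧ (∀ n, Measurable (R n)) ∧
      (∀ n, MemLp (R n) 2 (Measure.pi fun _ => P)) ∧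
      (∀ᶠ n in atTop, ∫ v, R n v ^ 2 ∂(Measure.pi fun _ => P) ≤ 18 * ε ^ 2) ∧
      ∀ n ≠ 0, ∀ (v : Fin n → Y) (F : Y → ℝ), AEStronglyMeasurable F P →
        (∀ z ∈ Z, |F z| ≤ H z) → (∀ i, |F (v i)| ≤ H (v i)) → (∀ᵐ t ∂P, |F t| ≤ H t) →
        (∀ z ∈ Z, ∀ i, v i ∈ N z → |F (v i) - F z| ≤ ε) →
        (∀ᵐ t ∂P, ∀ z ∈ Z, t ∈ N z → |F t - F z| ≤ ε) →
        |(∑ i, F (v i)) / n - ∫ t, F t ∂P| ≤ R n v := by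
  classical
  have hne : Nonempty Y := nonempty_of_isProbabilityMeasure P
  obtain ⟨z, A, hA, hAN, hdisj, hcov⟩ := exists_measurable_partition hN
  have hrest : ∀ J : ℕ, MeasurableSet (⋃ j < J, A j)ᶜ := fun J =>
    (MeasurableSet.iUnion fun j => MeasurableSet.iUnion fun _ => hA j).compl
  have htend : Tendsto (fun J : ℕ => ∫ t, (⋃ j < J, A j)ᶜ.indicator H t ^ 2 ∂P) atTop (𝓝 0) := by
    have h0 : (0 : ℝ) = ∫ _t : Y, (0 : ℝ) ∂P := by simp
    rw [h0]
    refine tendsto_integral_of_dominated_convergence (fun t => H t ^ 2)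
      (fun J => ((hHm.indicator (hrest J)).pow_const 2).aestronglyMeasurable) hH2.integrable_sq
      (fun J => ae_of_all _ fun t => ?_) (ae_of_all _ fun t => ?_)
    · rw [Real.norm_of_nonneg (sq_nonneg _)]
      by_cases ht : t ∈ (⋃ j < J, A j)ᶜ
      · rw [Set.indicator_of_mem ht]
      · rw [Set.indicator_of_notMem ht]
        simpa using sq_nonneg (H t)
    · obtain ⟨j, hj⟩ := hcov t
      refine tendsto_const_nhds.congr' ?_
      filter_upwards [eventually_gt_atTop j] with J hJ
      rw [Set.indicator_of_notMem (by simpa using ⟨j, hJ, hj⟩)]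
      simp
  -- The number of cells is fixed before `n` grows: the tail then costs `8 * (ε ^ 2 / 8)` and the
  -- frequencies at most `ε ^ 2` eventually, which with `16 * ε ^ 2` makes `18 * ε ^ 2`.
  obtain ⟨J, hJ⟩ := (htend.eventually (eventually_le_nhds (b := ε ^ 2 / 8) (by positivity))).exists
  refine ⟨(Finset.range J).image z, fun n v => empiricalErrorBound P H z A J ε v,
    fun n v => empiricalErrorBound_nonneg hε.le hH0 v,
    fun n => measurable_empiricalErrorBound hHm hA n,
    fun n => memLp_empiricalErrorBound hHm hH2 hA n, ?_, ?_⟩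
  · have hC : Tendsto (fun n : ℕ => 4 * (J * ∑ j ∈ Finset.range J, H (z j) ^ 2) / (n : ℝ)) atTop
        (𝓝 0) := tendsto_const_div_atTop_nhds_zero_nat _
    filter_upwards [hC.eventually (eventually_le_nhds (b := ε ^ 2) (by positivity)),
      eventually_ne_atTop 0] with n hn hn0
    have := integral_sq_empiricalErrorBound_le (z := z) (J := J) (ε := ε) hHm hH2 hA hn0
    linarith
  · intro n hn v F hF hFz hFv hFP hcv hcP
    have hZ : ∀ j < J, z j ∈ (Finset.range J).image z := fun j hj =>
      Finset.mem_image_of_mem _ (Finset.mem_range.mpr hj)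
    refine abs_sum_div_sub_integral_le hε.le (hH2.integrable (by norm_num)) hA hdisj hn v hF
      (fun j hj => hFz _ (hZ j hj)) hFv hFP (fun j hj i hi => hcv _ (hZ j hj) i (hAN j hi)) ?_
    filter_upwards [hcP] with t ht j hj htj using ht _ (hZ j hj) (hAN j htj)

end UniformLaw

/-! ### Concentration of the posterior -/

section Concentration

theorem pos_and_abs_log_le_of_mem_Icc {x b : ℝ} (h : x ∈ Set.Icc (Real.exp (-b)) (Real.exp b)) :
    0 < x ∧ |Real.log x| ≤ b := by
  have h0 : 0 < x := (Real.exp_pos _).trans_le h.1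
  exact ⟨h0, abs_le.mpr ⟨(Real.le_log_iff_exp_le h0).mpr h.1, (Real.log_le_iff_le_exp h0).mpr h.2⟩⟩

theorem exists_essential_supremum {α : Type*} [MeasurableSpace α] {ν : Measure α}
    [IsProbabilityMeasure ν] {g : α → ℝ} {b : ℝ} (hb : ∀ᵐ x ∂ν, |g x| ≤ b) :
    ∃ l, (∀ᵐ x ∂ν, g x ≤ l) ∧ ∀ η > 0, ν {x | l - η < g x} ≠ 0 := by
  have h1 : IsBoundedUnder (· ≤ ·) (ae ν) g :=
    isBoundedUnder_of_eventually_le (a := b) (hb.mono fun x hx => (abs_le.mp hx).2)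
  have h2 : IsBoundedUnder (· ≥ ·) (ae ν) g :=
    isBoundedUnder_of_eventually_ge (a := -b) (hb.mono fun x hx => (abs_le.mp hx).1)
  refine ⟨essSup g ν, ae_le_essSup h1, fun η hη h0 => ?_⟩
  have h3 : g ≤ᵐ[ν] fun _ => essSup g ν - η := by
    have : ∀ᵐ x ∂ν, ¬ (essSup g ν - η < g x) := by rw [ae_iff]; simpa using h0
    filter_upwards [this] with x hx using not_lt.mp hx
  have h4 := essSup_le_of_ae_le _ h3 h2.isCoboundedUnder_le
  linarith

variable {Θ Y : Type*} [MeasurableSpace Θ] [MetricSpace Y] [MeasurableSpace Y]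

/-- The mean log likelihood of a parameter. -/
def meanLogLik (P : Measure Y) (f : Θ → Y → ℝ) (θ : Θ) : ℝ := ∫ t, Real.log (f θ t) ∂P

namespace RegularModel

variable {lam : Measure Y} {π : Measure Θ} {f : Θ → Y → ℝ} {B : Y → ℝ}

theorem envelope_nonneg (hr : RegularModel lam π f B) (t : Y) : 0 ≤ B t :=
  (abs_nonneg _).trans (hr.bound 0 (fun _ => t) t)

theorem measurable_log_param (hr : RegularModel lam π f B) (t : Y) :
    Measurable fun θ => Real.log (f θ t) := (hr.meas_param t).log

theorem measurable_log_point (hr : RegularModel lam π f B) (θ : Θ) :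
    Measurable fun t => Real.log (f θ t) :=
  (hr.meas.comp (measurable_const.prodMk measurable_id)).log

theorem measurable_meanLogLik {P : Measure Y} [IsProbabilityMeasure P]
    (hr : RegularModel lam π f B) :
    Measurable (meanLogLik P f) :=
  (StronglyMeasurable.integral_prod_right' (f := fun z : Θ × Y => Real.log (f z.1 z.2))
    hr.meas.log.stronglyMeasurable).measurable

variable [SFinite lam] [BorelSpace Y] [lam.IsOpenPosMeasure] [SigmaFinite π]

theorem ae_pos_and_abs_log_le (hr : RegularModel lam π f B) {n : ℕ} (v : Fin (n + 1) → Y)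
    (t : Y) : ∀ᵐ θ ∂(chainPosterior π f v), 0 < f θ t ∧ |Real.log (f θ t)| ≤ B t := by
  filter_upwards [hr.ae_mem_Icc v t] with θ h using pos_and_abs_log_le_of_mem_Icc h

theorem integrable_log (hr : RegularModel lam π f B) {n : ℕ} (v : Fin (n + 1) → Y) (t : Y) :
    Integrable (fun θ => Real.log (f θ t)) (chainPosterior π f v) := by
  have := hr.proper n v
  refine (integrable_const (B t)).mono' (hr.measurable_log_param t).aestronglyMeasurable ?_
  filter_upwards [hr.ae_pos_and_abs_log_le v t] with θ h using h.2

/-- Jensen's inequality for the log predictive density. -/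
theorem integral_log_le (hr : RegularModel lam π f B) {n : ℕ} (v : Fin (n + 1) → Y) (t : Y) :
    ∫ θ, Real.log (f θ t) ∂(chainPosterior π f v) ≤ Real.log (predictive π f v t) := by
  have := hr.proper n v
  have hp := hr.pos n v t
  have h1 : ∫ θ, Real.log (f θ t) ∂(chainPosterior π f v) ≤
      ∫ θ, (Real.log (predictive π f v t) - 1 + f θ t / predictive π f v t)
        ∂(chainPosterior π f v) := by
    refine integral_mono_ae (hr.integrable_log v t)
      ((integrable_const _).add ((hr.integrable_likelihood v t).div_const _)) ?_
    filter_upwards [hr.ae_pos_and_abs_log_le v t] with θ h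
    have := Real.log_le_sub_one_of_pos (div_pos h.1 hp)
    rw [Real.log_div h.1.ne' hp.ne'] at this
    linarith
  rw [integral_add (integrable_const _) ((hr.integrable_likelihood v t).div_const _),
    integral_div] at h1
  have h2 : ∫ θ, f θ t ∂(chainPosterior π f v) = predictive π f v t := rfl
  rw [h2, div_self hp.ne'] at h1
  simpa using h1

variable {P : Measure Y} [IsProbabilityMeasure P]

/-- The exceptional set of parameters depends on the point `t`; Fubini exchanges the two
quantifiers. -/
theorem ae_ae_abs_log_le (hr : RegularModel lam π f B) (hB : Measurable B) {n : ℕ}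
    (v : Fin (n + 1) → Y) :
    ∀ᵐ θ ∂(chainPosterior π f v), ∀ᵐ t ∂P, |Real.log (f θ t)| ≤ B t := by
  have := hr.proper n v
  rw [Measure.ae_ae_comm]
  · exact ae_of_all _ fun t => by
      filter_upwards [hr.ae_pos_and_abs_log_le v t] with θ h using h.2
  · have h1 : Measurable fun z : Θ × Y => |Real.log (f z.1 z.2)| := hr.meas.log.abs
    exact measurableSet_le h1 (hB.comp measurable_snd)

theorem ae_abs_meanLogLik_le (hr : RegularModel lam π f B) (hB : Measurable B)
    (hBP : Integrable B P) {n : ℕ} (v : Fin (n + 1) → Y) :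
    ∀ᵐ θ ∂(chainPosterior π f v), |meanLogLik P f θ| ≤ ∫ t, B t ∂P := by
  filter_upwards [hr.ae_ae_abs_log_le (P := P) hB v] with θ h
  exact norm_integral_le_of_norm_le (f := fun t => Real.log (f θ t)) hBP h

theorem integrable_meanLogLik (hr : RegularModel lam π f B) (hB : Measurable B)
    (hBP : Integrable B P) {n : ℕ} (v : Fin (n + 1) → Y) :
    Integrable (meanLogLik P f) (chainPosterior π f v) := by
  have := hr.proper n v
  exact (integrable_const (∫ t, B t ∂P)).mono' hr.measurable_meanLogLik.aestronglyMeasurable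
    (hr.ae_abs_meanLogLik_le hB hBP v)

theorem integral_meanLogLik (hr : RegularModel lam π f B) (hB : Measurable B)
    (hBP : Integrable B P) {n : ℕ} (v : Fin (n + 1) → Y) :
    ∫ θ, meanLogLik P f θ ∂(chainPosterior π f v) =
      ∫ t, ∫ θ, Real.log (f θ t) ∂(chainPosterior π f v) ∂P := by
  have := hr.proper n v
  refine integral_integral_swap (f := fun θ t => Real.log (f θ t)) ?_
  have h1 : Measurable fun z : Θ × Y => |Real.log (f z.1 z.2)| := hr.meas.log.abs
  refine (hBP.comp_snd (chainPosterior π f v)).mono' hr.meas.log.aestronglyMeasurable ?_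
  exact (Measure.ae_prod_iff_ae_ae (p := fun z : Θ × Y => |Real.log (f z.1 z.2)| ≤ B z.2)
    (measurableSet_le h1 (hB.comp measurable_snd))).mpr (hr.ae_ae_abs_log_le hB v)

/-- The uniform law of large numbers for the log likelihood. -/
theorem exists_uniform_law_log [SecondCountableTopology Y] (hr : RegularModel lam π f B)
    (hB : Measurable B) (hB2 : MemLp B 2 P) {ε : ℝ} (hε : 0 < ε) :
    ∃ R : ∀ n, (Fin n → Y) → ℝ, (∀ n v, 0 ≤ R n v) ∧ (∀ n, Measurable (R n)) ∧
      (∀ n, MemLp (R n) 2 (Measure.pi fun _ => P)) ∧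
      (∀ᶠ n in atTop, ∫ v, R n v ^ 2 ∂(Measure.pi fun _ => P) ≤ 18 * ε ^ 2) ∧
      ∀ n ≠ 0, ∀ (v : Fin n → Y) (m : ℕ) (u : Fin (m + 1) → Y),
        ∀ᵐ θ ∂(chainPosterior π f u),
          |(∑ i, Real.log (f θ (v i))) / n - meanLogLik P f θ| ≤ R n v := by
  choose δ hδ h using fun t => hr.exists_log_close t hε
  obtain ⟨Z, R, hR0, hRm, hR2, hRe, hR⟩ := exists_uniform_law (P := P) (H := B) hB
    hr.envelope_nonneg hB2 hε (N := fun t => Metric.ball t (δ t))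
    fun t => Metric.ball_mem_nhds t (hδ t)
  refine ⟨R, hR0, hRm, hR2, hRe, fun n hn v m u => ?_⟩
  have := hr.proper m u
  have h1 : ∀ᵐ θ ∂(chainPosterior π f u), ∀ z ∈ Z, |Real.log (f θ z)| ≤ B z :=
    (Finset.eventually_all Z).mpr fun z _ => by
      filter_upwards [hr.ae_pos_and_abs_log_le u z] with θ h using h.2
  have h2 : ∀ᵐ θ ∂(chainPosterior π f u), ∀ i, |Real.log (f θ (v i))| ≤ B (v i) :=
    ae_all_iff.mpr fun i => by
      filter_upwards [hr.ae_pos_and_abs_log_le u (v i)] with θ h using h.2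
  have h3 : ∀ᵐ θ ∂(chainPosterior π f u), ∀ z ∈ Z, ∀ i, v i ∈ Metric.ball z (δ z) →
      |Real.log (f θ (v i)) - Real.log (f θ z)| ≤ ε :=
    (Finset.eventually_all Z).mpr fun z _ => ae_all_iff.mpr fun i => by
      by_cases hi : v i ∈ Metric.ball z (δ z)
      · filter_upwards [(h z (v i) hi m u).2] with θ h _ using h
      · exact ae_of_all _ fun θ h' => absurd h' hi
  have h4 : ∀ᵐ θ ∂(chainPosterior π f u), ∀ᵐ t ∂P, ∀ z ∈ Z, t ∈ Metric.ball z (δ z) →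
      |Real.log (f θ t) - Real.log (f θ z)| ≤ ε := by
    have : ∀ᵐ θ ∂(chainPosterior π f u), ∀ z ∈ Z, ∀ᵐ t ∂P, t ∈ Metric.ball z (δ z) →
        |Real.log (f θ t) - Real.log (f θ z)| ≤ ε := by
      refine (Finset.eventually_all Z).mpr fun z _ => ?_
      rw [Measure.ae_ae_comm (p := fun θ t => t ∈ Metric.ball z (δ z) →
        |Real.log (f θ t) - Real.log (f θ z)| ≤ ε)]
      · refine ae_of_all _ fun t => ?_
        by_cases ht : t ∈ Metric.ball z (δ z)
        · filter_upwards [(h z t ht m u).2] with θ h _ using h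
        · exact ae_of_all _ fun θ h' => absurd h' ht
      · have m1 : Measurable fun x : Θ × Y => |Real.log (f x.1 x.2) - Real.log (f x.1 z)| :=
          (hr.meas.log.sub ((hr.measurable_log_param z).comp measurable_fst)).abs
        have e : {x : Θ × Y | x.2 ∈ Metric.ball z (δ z) →
            |Real.log (f x.1 x.2) - Real.log (f x.1 z)| ≤ ε} =
            (Prod.snd ⁻¹' Metric.ball z (δ z))ᶜ ∪
              {x : Θ × Y | |Real.log (f x.1 x.2) - Real.log (f x.1 z)| ≤ ε} := by
          ext x
          simp only [Set.mem_ofPred_eq, Set.mem_union, Set.mem_compl_iff, Set.mem_preimage,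
            imp_iff_not_or]
        rw [e]
        exact (measurable_snd Metric.isOpen_ball.measurableSet).compl.union
          (measurableSet_le m1 measurable_const)
    filter_upwards [this] with θ hθ
    exact (Finset.eventually_all Z).mpr hθ
  filter_upwards [h1, h2, h3, h4, hr.ae_ae_abs_log_le (P := P) hB u] with θ g1 g2 g3 g4 g5
  exact hR n hn v (fun t => Real.log (f θ t)) (hr.measurable_log_point θ).aestronglyMeasurable
    g1 g2 g5 g3 g4

/-- Posterior probabilities in terms of the posterior given a single observation `t₀`. -/
theorem posterior_mul_lintegral (hr : RegularModel lam π f B) (t₀ : Y) {n : ℕ}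
    (v : Fin (n + 1) → Y) {C : Set Θ} (hC : MeasurableSet C) :
    chainPosterior π f v C *
        ∫⁻ θ, ENNReal.ofReal ((∏ i, f θ (v i)) / f θ t₀)
          ∂(chainPosterior π f fun _ : Fin 1 => t₀) =
      ∫⁻ θ in C, ENNReal.ofReal ((∏ i, f θ (v i)) / f θ t₀)
        ∂(chainPosterior π f fun _ : Fin 1 => t₀) := by
  set G : Θ → ℝ≥0∞ := fun θ => ENNReal.ofReal (∏ i, f θ (v i)) with hG
  have hGm : Measurable G := (Finset.measurable_prod _ fun i _ => hr.meas_param _).ennreal_ofReal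
  have hfm : Measurable fun θ => ENNReal.ofReal (f θ t₀) := (hr.meas_param t₀).ennreal_ofReal
  have hWm : Measurable fun θ => ENNReal.ofReal ((∏ i, f θ (v i)) / f θ t₀) :=
    ((Finset.measurable_prod _ fun i _ => hr.meas_param _).div (hr.meas_param t₀)).ennreal_ofReal
  obtain ⟨hZ0, hZt⟩ := ne_zero_top_of_isProbabilityMeasure_inv_smul
    (ν := π.withDensity G) (hr.proper n v)
  set Z := (π.withDensity G) Set.univ with hZ
  have hQ : chainPosterior π f v = Z⁻¹ • π.withDensity G := rfl
  set c := ((π.withDensity fun θ => ENNReal.ofReal (∏ _i : Fin 1, f θ t₀)) Set.univ)⁻¹ with hc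
  have hQ0 : chainPosterior π f (fun _ : Fin 1 => t₀) =
      c • π.withDensity fun θ => ENNReal.ofReal (f θ t₀) := by
    rw [chainPosterior, ← hc]
    simp
  -- Division by `f θ t₀` is harmless: the posterior given `v` does not charge the zeros of `f θ
  -- t₀`, so the product of likelihoods vanishes almost everywhere there.
  have hnull : ∀ᵐ θ ∂π, G θ = ENNReal.ofReal (f θ t₀) *
      ENNReal.ofReal ((∏ i, f θ (v i)) / f θ t₀) := by
    have h1 : ∀ᵐ θ ∂(π.withDensity G), 0 < f θ t₀ := by
      have h2 := hr.ae_pos_and_abs_log_le v t₀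
      rw [hQ, ae_iff, Measure.smul_apply, smul_eq_mul, mul_eq_zero,
        or_iff_right (ENNReal.inv_ne_zero.mpr hZt)] at h2
      filter_upwards [ae_iff.mpr h2] with θ h using h.1
    rw [ae_withDensity_iff hGm] at h1
    filter_upwards [h1] with θ h
    rcases eq_or_lt_of_le (hr.nonneg θ t₀) with h0 | h0
    · have : G θ = 0 := by
        by_contra hne
        exact (h hne).ne h0
      rw [this, ← h0]
      simp
    · rw [← ENNReal.ofReal_mul h0.le]
      exact congrArg ENNReal.ofReal (mul_div_cancel₀ _ h0.ne').symm
  have key : ∀ D : Set Θ, MeasurableSet D →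
      ∫⁻ θ in D, ENNReal.ofReal ((∏ i, f θ (v i)) / f θ t₀)
        ∂(chainPosterior π f fun _ : Fin 1 => t₀) = c * π.withDensity G D := fun D hD => by
    rw [hQ0, Measure.restrict_smul, lintegral_smul_measure, restrict_withDensity hD,
      lintegral_withDensity_eq_lintegral_mul _ hfm hWm, withDensity_apply _ hD, smul_eq_mul]
    congr 1
    refine lintegral_congr_ae ?_
    filter_upwards [ae_restrict_of_ae hnull] with θ h using h.symm
  rw [key C hC, ← setLIntegral_univ, key _ MeasurableSet.univ, hQ, Measure.smul_apply,
    smul_eq_mul, ← hZ, mul_comm c Z, ← mul_assoc, mul_right_comm Z⁻¹,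
    ENNReal.inv_mul_cancel hZ0 hZt, one_mul, mul_comm]

end RegularModel

end Concentration

/-! ### The posterior mean of the mean log likelihood. -/

section PosteriorMean

variable {Θ Y : Type*} [MeasurableSpace Θ] [MeasurableSpace Y]

namespace BayesModel

theorem measurable_integral_posterior {lam : Measure Y} {π : Measure Θ} {f : Θ → Y → ℝ}
    [SigmaFinite π] (hc : BayesModel lam π f) {n : ℕ} {g : (Fin (n + 1) → Y) × Θ → ℝ}
    (hg : Measurable g) : Measurable fun v => ∫ θ, g (v, θ) ∂(chainPosterior π f v) :=
  (StronglyMeasurable.integral_kernel_prod_right' (κ := hc.kernel n)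
    hg.stronglyMeasurable).measurable

end BayesModel

variable [MetricSpace Y]

namespace RegularModel

variable {lam : Measure Y} {π : Measure Θ} {f : Θ → Y → ℝ} {B : Y → ℝ}
  [SFinite lam] [BorelSpace Y] [lam.IsOpenPosMeasure] [SigmaFinite π]
  {P : Measure Y} [IsProbabilityMeasure P]

/-- Exponential concentration of the posterior on parameters with large mean log likelihood, for
data with a small uniform error. -/
theorem exists_real_le_exp (hr : RegularModel lam π f B) (t₀ : Y) {l η : ℝ}
    (hl : (chainPosterior π f fun _ : Fin 1 => t₀) {θ | l - η < meanLogLik P f θ} ≠ 0) :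
    ∃ K ≥ 0, ∀ (n : ℕ) (v : Fin (n + 1) → Y) (R : ℝ),
      (∀ᵐ θ ∂(chainPosterior π f fun _ : Fin 1 => t₀),
        |(∑ i, Real.log (f θ (v i))) / (n + 1 : ℕ) - meanLogLik P f θ| ≤ R) → R ≤ η →
      (chainPosterior π f v).real {θ | meanLogLik P f θ ≤ l - 4 * η} ≤
        K * Real.exp (-((n + 1 : ℕ) * η)) := by
  have := hr.proper 0 fun _ => t₀
  set Q₀ := chainPosterior π f fun _ : Fin 1 => t₀ with hQ₀
  set D := {θ | l - η < meanLogLik P f θ} with hD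
  set C := {θ | meanLogLik P f θ ≤ l - 4 * η} with hC
  have hDm : MeasurableSet D := measurableSet_lt measurable_const hr.measurable_meanLogLik
  have hCm : MeasurableSet C := measurableSet_le hr.measurable_meanLogLik measurable_const
  have hκ : 0 < Q₀.real D := ENNReal.toReal_pos hl (measure_ne_top _ _)
  -- The factor `1 / f θ t₀` costs `exp (B t₀)` in the numerator and again in the denominator, and
  -- the denominator is restricted to the near maximizers `D`. The remaining exponent is `N * (2 * R
  -- - 3 * η) ≤ -N * η`.
  refine ⟨Real.exp (2 * B t₀) / Q₀.real D, by positivity, fun n v R hR hRη => ?_⟩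
  have := hr.proper n v
  set N : ℝ := ((n + 1 : ℕ) : ℝ) with hN
  have hN0 : 0 < N := by rw [hN]; positivity
  have hW : ∀ᵐ θ ∂Q₀,
      Real.exp (N * (meanLogLik P f θ - R) - B t₀) ≤ (∏ i, f θ (v i)) / f θ t₀ ∧
      (∏ i, f θ (v i)) / f θ t₀ ≤ Real.exp (N * (meanLogLik P f θ + R) + B t₀) := by
    have h1 : ∀ᵐ θ ∂Q₀, ∀ i, 0 < f θ (v i) := ae_all_iff.mpr fun i => by
      filter_upwards [hr.ae_pos_and_abs_log_le (fun _ : Fin 1 => t₀) (v i)] with θ h using h.1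
    filter_upwards [h1, hR, hr.ae_pos_and_abs_log_le (fun _ : Fin 1 => t₀) t₀] with θ h1 h2 h3
    have h4 : (∏ i, f θ (v i)) / f θ t₀ =
        Real.exp (∑ i, Real.log (f θ (v i)) - Real.log (f θ t₀)) := by
      rw [Real.exp_sub, Real.exp_sum, Real.exp_log h3.1]
      congr 1
      exact Finset.prod_congr rfl fun i _ => (Real.exp_log (h1 i)).symm
    rw [h4, Real.exp_le_exp, Real.exp_le_exp]
    have h5 := abs_le.mp h2
    have h6 := abs_le.mp h3.2
    have h7 : (∑ i, Real.log (f θ (v i))) = N * ((∑ i, Real.log (f θ (v i))) / N) := by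
      field_simp
    rw [h7]
    constructor <;> nlinarith
  have hup : ∫⁻ θ in C, ENNReal.ofReal ((∏ i, f θ (v i)) / f θ t₀) ∂Q₀ ≤
      ENNReal.ofReal (Real.exp (N * (l - 4 * η + R) + B t₀)) := by
    calc ∫⁻ θ in C, ENNReal.ofReal ((∏ i, f θ (v i)) / f θ t₀) ∂Q₀
        ≤ ∫⁻ _ in C, ENNReal.ofReal (Real.exp (N * (l - 4 * η + R) + B t₀)) ∂Q₀ := by
          refine lintegral_mono_ae ?_
          filter_upwards [ae_restrict_of_ae hW, ae_restrict_mem hCm] with θ h1 h2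
          refine ENNReal.ofReal_le_ofReal (h1.2.trans (Real.exp_le_exp.mpr ?_))
          have : meanLogLik P f θ ≤ l - 4 * η := h2
          nlinarith
      _ ≤ _ := by
          rw [setLIntegral_const]
          exact mul_le_of_le_one_right' prob_le_one
  have hlow : ENNReal.ofReal (Real.exp (N * (l - η - R) - B t₀)) * Q₀ D ≤
      ∫⁻ θ, ENNReal.ofReal ((∏ i, f θ (v i)) / f θ t₀) ∂Q₀ := by
    rw [← setLIntegral_const]
    refine (lintegral_mono_ae ?_).trans (setLIntegral_le_lintegral D _)
    filter_upwards [ae_restrict_of_ae hW, ae_restrict_mem hDm] with θ h1 h2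
    refine ENNReal.ofReal_le_ofReal (le_trans (Real.exp_le_exp.mpr ?_) h1.1)
    have : l - η < meanLogLik P f θ := h2
    nlinarith
  have hmain : chainPosterior π f v C * (ENNReal.ofReal (Real.exp (N * (l - η - R) - B t₀)) * Q₀ D)
      ≤ ENNReal.ofReal (Real.exp (N * (l - 4 * η + R) + B t₀)) :=
    (mul_le_mul_right hlow _).trans ((hr.posterior_mul_lintegral t₀ v hCm).le.trans hup)
  have hreal : (chainPosterior π f v).real C * (Real.exp (N * (l - η - R) - B t₀) * Q₀.real D) ≤
      Real.exp (N * (l - 4 * η + R) + B t₀) := by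
    have := ENNReal.toReal_mono ENNReal.ofReal_ne_top hmain
    rwa [ENNReal.toReal_mul, ENNReal.toReal_mul, ENNReal.toReal_ofReal (Real.exp_pos _).le,
      ENNReal.toReal_ofReal (Real.exp_pos _).le] at this
  rw [← le_div_iff₀ (by positivity)] at hreal
  refine hreal.trans ?_
  rw [← div_div, ← Real.exp_sub, div_mul_eq_mul_div, ← Real.exp_add]
  refine div_le_div_of_nonneg_right (Real.exp_le_exp.mpr ?_) hκ.le
  nlinarith

/-- The unnormalized density `∏ f θ (v i) / f θ t₀` is positive almost everywhere, so its integral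
cannot vanish. An essential supremum under the posterior given `t₀` is thereby an upper bound under
every posterior. -/
theorem posterior_absolutelyContinuous (hr : RegularModel lam π f B) (t₀ : Y) {n : ℕ}
    (v : Fin (n + 1) → Y) :
    chainPosterior π f v ≪ chainPosterior π f fun _ : Fin 1 => t₀ := by
  have := hr.proper 0 fun _ => t₀
  refine Measure.AbsolutelyContinuous.mk fun C hC h0 => ?_
  have h1 := hr.posterior_mul_lintegral t₀ v hC
  rw [setLIntegral_measure_zero _ _ h0, mul_eq_zero] at h1
  refine h1.resolve_right fun h2 => ?_
  have hm : Measurable fun θ => ENNReal.ofReal ((∏ i, f θ (v i)) / f θ t₀) :=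
    ((Finset.measurable_prod _ fun i _ => hr.meas_param _).div (hr.meas_param t₀)).ennreal_ofReal
  rw [lintegral_eq_zero_iff hm] at h2
  have h3 : ∀ᵐ θ ∂(chainPosterior π f fun _ : Fin 1 => t₀), ∀ i, 0 < f θ (v i) :=
    ae_all_iff.mpr fun i => by
      filter_upwards [hr.ae_pos_and_abs_log_le (fun _ : Fin 1 => t₀) (v i)] with θ h using h.1
  have h4 : ∀ᵐ _ ∂(chainPosterior π f fun _ : Fin 1 => t₀), False := by
    filter_upwards [h2, h3, hr.ae_pos_and_abs_log_le (fun _ : Fin 1 => t₀) t₀] with θ g2 g3 g4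
    have h5 : 0 < (∏ i, f θ (v i)) / f θ t₀ := div_pos (Finset.prod_pos fun i _ => g3 i) g4.1
    exact absurd g2 (ENNReal.ofReal_pos.mpr h5).ne'
  exact (ae_iff.not.mpr (by simp)) h4

theorem abs_integral_meanLogLik_le (hr : RegularModel lam π f B) (hB : Measurable B)
    (hBP : Integrable B P) {n : ℕ} (v : Fin (n + 1) → Y) :
    |∫ θ, meanLogLik P f θ ∂(chainPosterior π f v)| ≤ ∫ t, B t ∂P := by
  have := hr.proper n v
  have := norm_integral_le_of_norm_le_const (f := meanLogLik P f) (hr.ae_abs_meanLogLik_le hB hBP v)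
  simpa using this

theorem integrable_integral_meanLogLik (hr : RegularModel lam π f B) (hB : Measurable B)
    (hBP : Integrable B P) (n : ℕ) :
    Integrable (fun v : Fin (n + 1) → Y => ∫ θ, meanLogLik P f θ ∂(chainPosterior π f v))
      (Measure.pi fun _ => P) := by
  refine (integrable_const (∫ t, B t ∂P)).mono' ?_
    (ae_of_all _ fun v => hr.abs_integral_meanLogLik_le hB hBP v)
  exact (hr.measurable_integral_posterior (g := fun z => meanLogLik P f z.2)
    (hr.measurable_meanLogLik.comp measurable_snd)).aestronglyMeasurable

/-- The posterior mean of the mean log likelihood converges to its essential supremum. -/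
theorem exists_tendsto_integral_meanLogLik [SecondCountableTopology Y]
    (hr : RegularModel lam π f B) (hB : Measurable B) (hB2 : MemLp B 2 P) :
    ∃ l, (∀ n, ∀ v : Fin (n + 1) → Y, ∀ᵐ θ ∂(chainPosterior π f v), meanLogLik P f θ ≤ l) ∧
      Tendsto (fun n : ℕ => ∫ v : Fin (n + 1) → Y,
        ∫ θ, meanLogLik P f θ ∂(chainPosterior π f v) ∂(Measure.pi fun _ => P)) atTop (𝓝 l) := by
  have hBP : Integrable B P := hB2.integrable (by norm_num)
  obtain ⟨t₀⟩ := nonempty_of_isProbabilityMeasure P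
  have := hr.proper 0 fun _ => t₀
  set b := ∫ t, B t ∂P with hb
  have hb0 : 0 ≤ b := integral_nonneg hr.envelope_nonneg
  have habs := hr.ae_abs_meanLogLik_le hB hBP (fun _ : Fin 1 => t₀)
  obtain ⟨l, hle, hne⟩ := exists_essential_supremum habs
  have hlev : ∀ n, ∀ v : Fin (n + 1) → Y, ∀ᵐ θ ∂(chainPosterior π f v), meanLogLik P f θ ≤ l :=
    fun n v => (hr.posterior_absolutelyContinuous t₀ v).ae_le hle
  refine ⟨l, hlev, ?_⟩
  have hupper : ∀ n : ℕ, ∫ v : Fin (n + 1) → Y,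
      ∫ θ, meanLogLik P f θ ∂(chainPosterior π f v) ∂(Measure.pi fun _ => P) ≤ l := fun n => by
    refine (integral_mono (hr.integrable_integral_meanLogLik hB hBP n) (integrable_const l)
      fun v => ?_).trans (by simp)
    have := hr.proper n v
    refine (integral_mono_ae (hr.integrable_meanLogLik hB hBP v) (integrable_const l)
      (hlev n v)).trans (by simp)
  have hlb : ∀ η > 0, l < b + η := fun η hη => by
    by_contra! hcon
    refine hne η hη ?_
    have : ∀ᵐ θ ∂(chainPosterior π f fun _ : Fin 1 => t₀), ¬ (l - η < meanLogLik P f θ) := by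
      filter_upwards [habs] with θ h
      linarith [(abs_le.mp h).2]
    simpa using ae_iff.mp this
  refine tendsto_order.mpr ⟨fun a ha => ?_, fun a ha =>
    Eventually.of_forall fun n => (hupper n).trans_lt ha⟩
  set τ := l - a with hτ
  have hτ0 : 0 < τ := sub_pos.mpr ha
  -- The loss is `4 * η` for the level, `2 * b * 18 * η` for data with a large uniform error, and an
  -- exponential term below `τ / 2`. The uniform law is taken with `ε = η ^ 2`, so that its mean
  -- square, divided by `η ^ 2`, is at most `18 * η ^ 2 ≤ 18 * η`.
  set η := min 1 (τ / (2 * (4 + 36 * b))) with hη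
  have hη0 : 0 < η := by positivity
  have hη1 : η ≤ 1 := min_le_left _ _
  have hη2 : (4 + 36 * b) * η ≤ τ / 2 := by
    have h1 : η ≤ τ / (2 * (4 + 36 * b)) := min_le_right _ _
    rw [le_div_iff₀ (by positivity)] at h1
    linarith
  obtain ⟨R, hR0, hRm, hR2, hRe, hR⟩ := hr.exists_uniform_law_log (P := P) hB hB2
    (ε := η ^ 2) (by positivity)
  obtain ⟨K, hK0, hK⟩ := hr.exists_real_le_exp (P := P) t₀ (hne η hη0)
  have hexp : Tendsto (fun n : ℕ => 2 * b * (K * Real.exp (-((n + 1 : ℕ) * η)))) atTop (𝓝 0) := by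
    have h1 : Tendsto (fun n : ℕ => ((n + 1 : ℕ) : ℝ) * η) atTop atTop :=
      (tendsto_natCast_atTop_atTop.comp (tendsto_add_atTop_nat 1)).atTop_mul_const hη0
    have h2 := (Real.tendsto_exp_neg_atTop_nhds_zero.comp h1).const_mul K |>.const_mul (2 * b)
    simpa using h2
  filter_upwards [(tendsto_add_atTop_nat 1).eventually hRe,
    hexp.eventually (eventually_lt_nhds (b := τ / 2) (by positivity))] with n hn1 hn2
  -- Chebyshev's inequality in pointwise form: if the uniform error exceeds `η`, the first summand
  -- is already at least `1`.
  have hC : ∀ v : Fin (n + 1) → Y,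
      (chainPosterior π f v).real {θ | meanLogLik P f θ ≤ l - 4 * η} ≤
        R (n + 1) v ^ 2 / η ^ 2 + K * Real.exp (-((n + 1 : ℕ) * η)) := fun v => by
    have := hr.proper n v
    by_cases h : R (n + 1) v ≤ η
    · refine (hK n v (R (n + 1) v) (hR (n + 1) n.succ_ne_zero v 0 _) h).trans ?_
      exact le_add_of_nonneg_left (by positivity)
    · have h1 : 1 ≤ R (n + 1) v ^ 2 / η ^ 2 := by
        rw [one_le_div (by positivity)]
        have : η < R (n + 1) v := not_le.mp h
        gcongr
      refine (measureReal_le_one).trans (h1.trans ?_)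
      exact le_add_of_nonneg_right (by positivity)
  -- On the exceptional set the mean log likelihood is at least `-b`, while `l < b + η`; so `2 * b`
  -- covers the shortfall from `l - 4 * η`.
  have hpt : ∀ v : Fin (n + 1) → Y,
      l - 4 * η - 2 * b * (R (n + 1) v ^ 2 / η ^ 2 + K * Real.exp (-((n + 1 : ℕ) * η))) ≤
        ∫ θ, meanLogLik P f θ ∂(chainPosterior π f v) := fun v => by
    have := hr.proper n v
    set C := {θ | meanLogLik P f θ ≤ l - 4 * η} with hCdef
    have hCm : MeasurableSet C := measurableSet_le hr.measurable_meanLogLik measurable_const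
    have hCi : Integrable (C.indicator (1 : Θ → ℝ)) (chainPosterior π f v) :=
      (integrable_const (1 : ℝ)).indicator hCm
    have h1 : ∫ θ, (l - 4 * η - 2 * b * C.indicator (1 : Θ → ℝ) θ) ∂(chainPosterior π f v) ≤
        ∫ θ, meanLogLik P f θ ∂(chainPosterior π f v) := by
      refine integral_mono_ae ((integrable_const _).sub (hCi.const_mul _))
        (hr.integrable_meanLogLik hB hBP v) ?_
      filter_upwards [hr.ae_abs_meanLogLik_le (P := P) hB hBP v] with θ h
      by_cases hθ : θ ∈ C
      · rw [Set.indicator_of_mem hθ, Pi.one_apply, mul_one]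
        linarith [(abs_le.mp h).1, hlb η hη0]
      · rw [Set.indicator_of_notMem hθ, mul_zero, sub_zero]
        exact (not_le.mp hθ).le
    rw [integral_sub (integrable_const _) (hCi.const_mul _), integral_const_mul,
      integral_indicator_one hCm] at h1
    simp only [integral_const, probReal_univ, one_smul] at h1
    have h2 := mul_le_mul_of_nonneg_left (hC v) (by positivity : (0 : ℝ) ≤ 2 * b)
    linarith
  have hi1 : Integrable (fun v : Fin (n + 1) → Y => R (n + 1) v ^ 2 / η ^ 2)
      (Measure.pi fun _ => P) := (hR2 (n + 1)).integrable_sq.div_const _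
  have hi2 : Integrable (fun v : Fin (n + 1) → Y =>
      R (n + 1) v ^ 2 / η ^ 2 + K * Real.exp (-((n + 1 : ℕ) * η))) (Measure.pi fun _ => P) :=
    hi1.add (integrable_const _)
  have hint := integral_mono ((integrable_const (l - 4 * η)).sub (hi2.const_mul (2 * b)))
    (hr.integrable_integral_meanLogLik hB hBP n) hpt
  refine lt_of_lt_of_le ?_ hint
  have e1 : ∫ v : Fin (n + 1) → Y, (l - 4 * η - 2 * b *
      (R (n + 1) v ^ 2 / η ^ 2 + K * Real.exp (-((n + 1 : ℕ) * η)))) ∂(Measure.pi fun _ => P) =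
      l - 4 * η - 2 * b * ((∫ v, R (n + 1) v ^ 2 ∂(Measure.pi fun _ => P)) / η ^ 2 +
        K * Real.exp (-((n + 1 : ℕ) * η))) := by
    rw [integral_sub (integrable_const _) (hi2.const_mul (2 * b)), integral_const_mul,
      integral_add hi1 (integrable_const _), integral_div]
    simp
  refine lt_of_lt_of_eq ?_ e1.symm
  have h3 : (∫ v, R (n + 1) v ^ 2 ∂(Measure.pi fun _ => P)) / η ^ 2 ≤ 18 * η := by
    rw [div_le_iff₀ (by positivity)]
    refine hn1.trans ?_
    have : η ^ 4 ≤ η ^ 3 := pow_le_pow_of_le_one hη0.le hη1 (by norm_num)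
    nlinarith
  have h4 := mul_le_mul_of_nonneg_left h3 (by positivity : (0 : ℝ) ≤ 2 * b)
  have h5 : a = l - τ := by rw [hτ]; ring
  rw [h5]
  nlinarith

end RegularModel

end PosteriorMean

/-! ### The likelihood of the data is close to their predictive density -/

section Gap

theorem abs_exp_sub_one_le_mul (x : ℝ) : |Real.exp x - 1| ≤ |x| * Real.exp |x| := by
  rcases le_total 0 x with h | h
  · rw [abs_of_nonneg h, abs_of_nonneg (sub_nonneg.mpr (Real.one_le_exp h))]
    have h1 := Real.add_one_le_exp (-x)
    have h2 : Real.exp (-x) * Real.exp x = 1 := by rw [← Real.exp_add]; simp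
    nlinarith [Real.exp_pos x]
  · rw [abs_of_nonpos h, abs_of_nonpos (sub_nonpos.mpr (Real.exp_le_one_iff.mpr h))]
    have h1 := Real.add_one_le_exp x
    have h2 := Real.one_le_exp (neg_nonneg.mpr h)
    nlinarith

/-- With `y = exp (-x / 2)`, the inequality `y ≥ 1 - x / 2` gives `(y - 1) ^ 2 ≤ x + y ^ 2 - 1`, and
`|x / 2| ≤ exp |x / 2| * |y - 1|`. -/
theorem sq_le_mul_add_exp_neg_sub_one (x : ℝ) :
    x ^ 2 ≤ 4 * Real.exp |x| * (x + Real.exp (-x) - 1) := by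
  set y := Real.exp (-(x / 2)) with hy
  have hy0 : 0 < y := Real.exp_pos _
  have h1 : Real.exp (-x) = y ^ 2 := by rw [hy, ← Real.exp_nat_mul]; congr 1; push_cast; ring
  have h2 : -(x / 2) + 1 ≤ y := Real.add_one_le_exp _
  have h3 : (y - 1) ^ 2 ≤ x + Real.exp (-x) - 1 := by rw [h1]; nlinarith
  have h4 : |x / 2| ≤ Real.exp |x / 2| * |y - 1| := by
    have h5 : 1 - Real.exp (x / 2) = Real.exp (x / 2) * (y - 1) := by
      rw [mul_sub, hy, ← Real.exp_add]; simp
    rcases le_total 0 x with h | h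
    · have h6 : x / 2 + 1 ≤ Real.exp (x / 2) := Real.add_one_le_exp _
      have h7 : |1 - Real.exp (x / 2)| = Real.exp (x / 2) * |y - 1| := by
        rw [h5, abs_mul, abs_of_pos (Real.exp_pos _)]
      rw [abs_of_nonneg (by linarith : 0 ≤ x / 2), ← h7, abs_of_nonpos (by linarith)]
      linarith
    · have h8 : 1 ≤ Real.exp |x / 2| := Real.one_le_exp (abs_nonneg _)
      have h9 : |x / 2| ≤ |y - 1| := by
        rw [abs_of_nonpos (by linarith : x / 2 ≤ 0), abs_of_nonneg (by linarith)]
        linarith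
      nlinarith [abs_nonneg (y - 1)]
  have h10 : Real.exp |x| = Real.exp |x / 2| ^ 2 := by
    rw [← Real.exp_nat_mul, abs_div, abs_two]; congr 1; push_cast; ring
  have h11 : x ^ 2 = 4 * |x / 2| ^ 2 := by rw [sq_abs]; ring
  have h12 : |x / 2| ^ 2 ≤ (Real.exp |x / 2| * |y - 1|) ^ 2 :=
    pow_le_pow_left₀ (abs_nonneg _) h4 2
  rw [mul_pow, sq_abs (y - 1), ← h10] at h12
  have h13 := mul_le_mul_of_nonneg_left h3 (Real.exp_pos |x|).le
  linarith

theorem sq_integral_le_integral_sq {α : Type*} [MeasurableSpace α] {ν : Measure α}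
    [IsProbabilityMeasure ν] {g : α → ℝ} (hg : MemLp g 2 ν) :
    (∫ x, g x ∂ν) ^ 2 ≤ ∫ x, g x ^ 2 ∂ν := by
  have h1 := variance_nonneg g ν
  rw [variance_eq_sub hg] at h1
  have h2 : ∫ x, (g ^ 2) x ∂ν = ∫ x, g x ^ 2 ∂ν := rfl
  linarith

theorem tendsto_integral_indicator_sq {Y : Type*} [MeasurableSpace Y] {P : Measure Y} {B : Y → ℝ}
    (hB : Measurable B) (hB2 : MemLp B 2 P) :
    Tendsto (fun b : ℕ => ∫ t, {t | (b : ℝ) < B t}.indicator (fun t => B t ^ 2) t ∂P) atTop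
      (𝓝 0) := by
  have h0 : (0 : ℝ) = ∫ _t : Y, (0 : ℝ) ∂P := by simp
  rw [h0]
  refine tendsto_integral_of_dominated_convergence (fun t => B t ^ 2)
    (fun b => ((hB.pow_const 2).indicator
      (measurableSet_lt measurable_const hB)).aestronglyMeasurable) hB2.integrable_sq
    (fun b => ae_of_all _ fun t => ?_) (ae_of_all _ fun t => ?_)
  · exact (norm_indicator_le_norm_self _ _).trans (Real.norm_of_nonneg (sq_nonneg _)).le
  · refine tendsto_const_nhds.congr' ?_
    filter_upwards [eventually_ge_atTop ⌈B t⌉₊] with b hb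
    rw [Set.indicator_of_notMem]
    simpa using (Nat.le_ceil _).trans (Nat.cast_le.mpr hb)

variable {Θ Y : Type*} [MeasurableSpace Θ] [MetricSpace Y] [MeasurableSpace Y]

/-- The difference of the posterior mean of the log likelihood of an observation and its
leave-one-out log predictive density. -/
def looGap (π : Measure Θ) (f : Θ → Y → ℝ) {n : ℕ} (v : Fin (n + 2) → Y) (i : Fin (n + 2)) : ℝ :=
  ∫ θ, Real.log (f θ (v i)) ∂(chainPosterior π f v) -
    Real.log (predictive π f (i.removeNth v) (v i))

namespace RegularModel

variable {lam : Measure Y} {π : Measure Θ} {f : Θ → Y → ℝ} {B : Y → ℝ}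
  [SigmaFinite π]

theorem integrable_log_loo {P : Measure Y} [IsProbabilityMeasure P]
    (hr : RegularModel lam π f B) (hBP : Integrable B P) {n : ℕ} (i : Fin (n + 2)) :
    Integrable (fun v : Fin (n + 2) → Y => Real.log (predictive π f (i.removeNth v) (v i)))
      (Measure.pi fun _ => P) := by
  refine (integrable_comp_eval (μ := fun _ : Fin (n + 2) => P) (i := i) hBP).mono' ?_
    (ae_of_all _ fun v => hr.bound n (i.removeNth v) (v i))
  have h1 : Measurable fun v : Fin (n + 2) → Y => (i.removeNth v, v i) :=
    (measurable_pi_iff.mpr fun j => measurable_pi_apply _).prodMk (measurable_pi_apply i)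
  exact ((hr.measurable_predictive n).comp h1).log.aestronglyMeasurable

variable [SFinite lam] [BorelSpace Y] [lam.IsOpenPosMeasure]

/-- The importance sampling identity: the reciprocal likelihood of an observation undoes its
contribution to the posterior. -/
theorem integral_exp_neg_eq_one (hr : RegularModel lam π f B) {n : ℕ} (v : Fin (n + 2) → Y)
    (i : Fin (n + 2)) :
    ∫ θ, predictive π f (i.removeNth v) (v i) / f θ (v i) ∂(chainPosterior π f v) = 1 := by
  have := hr.proper n (i.removeNth v)
  have hp := hr.pos n (i.removeNth v) (v i)
  rw [hr.integral_posterior v i, div_eq_one_iff_eq hp.ne']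
  have h : ∀ᵐ θ ∂(chainPosterior π f (i.removeNth v)),
      f θ (v i) * (predictive π f (i.removeNth v) (v i) / f θ (v i)) =
        predictive π f (i.removeNth v) (v i) := by
    filter_upwards [hr.ae_pos_and_abs_log_le (i.removeNth v) (v i)] with θ h
    exact mul_div_cancel₀ _ h.1.ne'
  rw [integral_congr_ae h]
  simp

theorem integrable_inv (hr : RegularModel lam π f B) {n : ℕ} (v : Fin (n + 1) → Y) (t : Y)
    (c : ℝ) : Integrable (fun θ => c / f θ t) (chainPosterior π f v) := by
  have := hr.proper n v
  refine (integrable_const (|c| / Real.exp (-B t))).mono'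
    (measurable_const.div (hr.meas_param t)).aestronglyMeasurable ?_
  filter_upwards [hr.ae_mem_Icc v t] with θ h
  rw [Real.norm_eq_abs, abs_div, abs_of_nonneg (hr.nonneg θ t)]
  exact div_le_div_of_nonneg_left (abs_nonneg _) (Real.exp_pos _) h.1

theorem memLp_two_log_sub (hr : RegularModel lam π f B) {n : ℕ} (v : Fin (n + 1) → Y) (t : Y)
    (c : ℝ) : MemLp (fun θ => Real.log (f θ t) - c) 2 (chainPosterior π f v) := by
  have := hr.proper n v
  refine MemLp.of_bound ((hr.measurable_log_param t).sub_const c).aestronglyMeasurable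
    (B t + |c|) ?_
  filter_upwards [hr.ae_pos_and_abs_log_le v t] with θ h
  exact (abs_sub _ _).trans (by linarith [h.2])

/-- For `x`, the log ratio of likelihood and leave-one-out density, `exp (-x)` has posterior mean
one. Adding `exp (-x) - 1` thus leaves the mean of `x` unchanged and makes the integrand nonnegative
and comparable to `x ^ 2`. -/
theorem looGap_eq (hr : RegularModel lam π f B) {n : ℕ} (v : Fin (n + 2) → Y)
    (i : Fin (n + 2)) :
    ∫ θ, ((Real.log (f θ (v i)) - Real.log (predictive π f (i.removeNth v) (v i))) +
      predictive π f (i.removeNth v) (v i) / f θ (v i) - 1) ∂(chainPosterior π f v) =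
        looGap π f v i := by
  have := hr.proper (n + 1) v
  have i1 : Integrable (fun θ => Real.log (f θ (v i)) -
      Real.log (predictive π f (i.removeNth v) (v i))) (chainPosterior π f v) :=
    (hr.integrable_log v (v i)).sub (integrable_const _)
  have i2 := hr.integrable_inv v (v i) (predictive π f (i.removeNth v) (v i))
  have i3 : Integrable (fun θ => Real.log (f θ (v i)) -
      Real.log (predictive π f (i.removeNth v) (v i)) +
      predictive π f (i.removeNth v) (v i) / f θ (v i)) (chainPosterior π f v) := i1.add i2
  rw [integral_sub i3 (integrable_const _), integral_add i1 i2,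
    hr.integral_exp_neg_eq_one v i, integral_sub (hr.integrable_log v (v i)) (integrable_const _)]
  simp [looGap]

theorem log_div_loo_bound (hr : RegularModel lam π f B) {n : ℕ} (v : Fin (n + 2) → Y)
    (i : Fin (n + 2)) : ∀ᵐ θ ∂(chainPosterior π f v), ∃ x : ℝ,
      x = Real.log (f θ (v i)) - Real.log (predictive π f (i.removeNth v) (v i)) ∧
      |x| ≤ 2 * B (v i) ∧ Real.exp x = f θ (v i) / predictive π f (i.removeNth v) (v i) ∧
      Real.exp (-x) = predictive π f (i.removeNth v) (v i) / f θ (v i) := by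
  have hp := hr.pos n (i.removeNth v) (v i)
  filter_upwards [hr.ae_pos_and_abs_log_le v (v i)] with θ h
  refine ⟨_, rfl, ?_, ?_, ?_⟩
  · refine (abs_sub _ _).trans ?_
    linarith [h.2, hr.bound n (i.removeNth v) (v i)]
  · rw [Real.exp_sub, Real.exp_log h.1, Real.exp_log hp]
  · rw [neg_sub, Real.exp_sub, Real.exp_log h.1, Real.exp_log hp]

theorem integral_sq_log_sub_loo_le (hr : RegularModel lam π f B) {n : ℕ} (v : Fin (n + 2) → Y)
    (i : Fin (n + 2)) :
    ∫ θ, (Real.log (f θ (v i)) - Real.log (predictive π f (i.removeNth v) (v i))) ^ 2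
      ∂(chainPosterior π f v) ≤ 4 * Real.exp (2 * B (v i)) * looGap π f v i := by
  have := hr.proper (n + 1) v
  rw [← hr.looGap_eq v i, ← integral_const_mul]
  have i1 := (hr.integrable_log v (v i)).sub
    (integrable_const (Real.log (predictive π f (i.removeNth v) (v i))))
  have i2 := hr.integrable_inv v (v i) (predictive π f (i.removeNth v) (v i))
  refine integral_mono_ae (hr.memLp_two_log_sub v (v i) _).integrable_sq
    (((i1.add i2).sub (integrable_const 1)).const_mul _) ?_
  filter_upwards [hr.log_div_loo_bound v i] with θ ⟨x, hx, hxb, _, hexp⟩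
  rw [← hx, ← hexp]
  refine (sq_le_mul_add_exp_neg_sub_one x).trans ?_
  have h1 : 0 ≤ x + Real.exp (-x) - 1 := by linarith [Real.add_one_le_exp (-x)]
  have h2 := Real.exp_le_exp.mpr hxb
  nlinarith

theorem looGap_nonneg (hr : RegularModel lam π f B) {n : ℕ} (v : Fin (n + 2) → Y)
    (i : Fin (n + 2)) : 0 ≤ looGap π f v i := by
  have h1 := hr.integral_sq_log_sub_loo_le v i
  have h2 : 0 ≤ ∫ θ, (Real.log (f θ (v i)) -
      Real.log (predictive π f (i.removeNth v) (v i))) ^ 2 ∂(chainPosterior π f v) :=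
    integral_nonneg fun θ => sq_nonneg _
  have h3 : 0 < 4 * Real.exp (2 * B (v i)) := by positivity
  exact nonneg_of_mul_nonneg_right (h2.trans h1) h3

/-- It allows the leave-one-out density to be replaced by the predictive density given all data. The
lower bound is Jensen's inequality, the upper one comes from `log z ≤ z - 1` and `|exp x - 1| ≤ |x|
* exp |x|`; both are in terms of the first absolute moment. -/
theorem sq_log_predictive_sub_loo_le (hr : RegularModel lam π f B) {n : ℕ} (v : Fin (n + 2) → Y)
    (i : Fin (n + 2)) :
    (Real.log (predictive π f v (v i)) -
        Real.log (predictive π f (i.removeNth v) (v i))) ^ 2 ≤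
      Real.exp (2 * B (v i)) ^ 2 *
        ∫ θ, (Real.log (f θ (v i)) - Real.log (predictive π f (i.removeNth v) (v i))) ^ 2
          ∂(chainPosterior π f v) := by
  have := hr.proper (n + 1) v
  have hp := hr.pos n (i.removeNth v) (v i)
  have hq := hr.pos (n + 1) v (v i)
  set c := Real.log (predictive π f (i.removeNth v) (v i)) with hc
  have hL2 := hr.memLp_two_log_sub v (v i) c
  have hi1 : Integrable (fun θ => |Real.log (f θ (v i)) - c|) (chainPosterior π f v) :=
    (hL2.integrable (by norm_num)).abs
  have hE : 1 ≤ Real.exp (2 * B (v i)) :=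
    Real.one_le_exp (by linarith [hr.envelope_nonneg (v i)])
  set I := ∫ θ, |Real.log (f θ (v i)) - c| ∂(chainPosterior π f v) with hI
  have hI0 : 0 ≤ I := integral_nonneg fun θ => abs_nonneg _
  have hlow : -I ≤ Real.log (predictive π f v (v i)) - c := by
    have h1 := hr.integral_log_le v (v i)
    have h2 : ∫ θ, (Real.log (f θ (v i)) - c) ∂(chainPosterior π f v) =
        ∫ θ, Real.log (f θ (v i)) ∂(chainPosterior π f v) - c := by
      rw [integral_sub (hr.integrable_log v (v i)) (integrable_const _)]
      simp
    have h3 : |∫ θ, (Real.log (f θ (v i)) - c) ∂(chainPosterior π f v)| ≤ I :=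
      abs_integral_le_integral_abs
    rw [h2] at h3
    linarith [(abs_le.mp h3).1]
  have hup : Real.log (predictive π f v (v i)) - c ≤ Real.exp (2 * B (v i)) * I := by
    rw [hc, ← Real.log_div hq.ne' hp.ne']
    refine (Real.log_le_sub_one_of_pos (div_pos hq hp)).trans ?_
    have h1 : predictive π f v (v i) / predictive π f (i.removeNth v) (v i) - 1 =
        ∫ θ, (f θ (v i) / predictive π f (i.removeNth v) (v i) - 1) ∂(chainPosterior π f v) := by
      rw [integral_sub ((hr.integrable_likelihood v (v i)).div_const _) (integrable_const _),
        integral_div]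
      simp [predictive]
    rw [h1, hI, ← integral_const_mul]
    refine integral_mono_ae (((hr.integrable_likelihood v (v i)).div_const _).sub
      (integrable_const _)) (hi1.const_mul _) ?_
    filter_upwards [hr.log_div_loo_bound v i] with θ ⟨x, hx, hxb, hexp, _⟩
    rw [← hx, ← hexp, mul_comm]
    refine (le_abs_self _).trans ((abs_exp_sub_one_le_mul x).trans ?_)
    exact mul_le_mul_of_nonneg_left (Real.exp_le_exp.mpr hxb) (abs_nonneg _)
  have habs : |Real.log (predictive π f v (v i)) - c| ≤ Real.exp (2 * B (v i)) * I :=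
    abs_le.mpr ⟨by nlinarith, hup⟩
  have hJ : I ^ 2 ≤ ∫ θ, (Real.log (f θ (v i)) - c) ^ 2 ∂(chainPosterior π f v) := by
    refine (sq_integral_le_integral_sq hL2.abs).trans (le_of_eq ?_)
    exact integral_congr_ae (ae_of_all _ fun θ => sq_abs _)
  rw [← sq_abs]
  refine (pow_le_pow_left₀ (abs_nonneg _) habs 2).trans ?_
  rw [mul_pow]
  exact mul_le_mul_of_nonneg_left hJ (sq_nonneg _)

/-- The posterior mean square deviation of the log likelihood of an observation from its log
predictive density. -/
theorem integral_sq_log_sub_predictive_le (hr : RegularModel lam π f B) {n : ℕ}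
    (v : Fin (n + 2) → Y) (i : Fin (n + 2)) (b : ℝ) :
    ∫ θ, (Real.log (f θ (v i)) - Real.log (predictive π f v (v i))) ^ 2 ∂(chainPosterior π f v) ≤
      8 * Real.exp (2 * b) * (1 + Real.exp (2 * b) ^ 2) * looGap π f v i +
        4 * {t | b < B t}.indicator (fun t => B t ^ 2) (v i) := by
  have := hr.proper (n + 1) v
  have hgap := hr.looGap_nonneg v i
  -- Constants exponential in the envelope are affordable only where it is at most `b`; elsewhere
  -- the trivial bound `2 * B` of the difference of logs is used.
  by_cases hb : b < B (v i)
  · rw [Set.indicator_of_mem (show v i ∈ {t | b < B t} from hb)]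
    have h1 : ∫ θ, (Real.log (f θ (v i)) - Real.log (predictive π f v (v i))) ^ 2
        ∂(chainPosterior π f v) ≤ ∫ _θ, 4 * B (v i) ^ 2 ∂(chainPosterior π f v) := by
      refine integral_mono_ae (hr.memLp_two_log_sub v (v i) _).integrable_sq
        (integrable_const _) ?_
      filter_upwards [hr.ae_pos_and_abs_log_le v (v i)] with θ h
      have h2 := (abs_sub (Real.log (f θ (v i))) (Real.log (predictive π f v (v i)))).trans
        (add_le_add h.2 (hr.bound (n + 1) v (v i)))
      have h3 := pow_le_pow_left₀ (abs_nonneg _) h2 2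
      rw [sq_abs] at h3
      refine h3.trans (le_of_eq ?_)
      ring
    rw [integral_const, probReal_univ, one_smul] at h1
    exact h1.trans (le_add_of_nonneg_left (by positivity))
  · rw [Set.indicator_of_notMem (show v i ∉ {t | b < B t} from hb), mul_zero, add_zero]
    have hE : Real.exp (2 * B (v i)) ≤ Real.exp (2 * b) :=
      Real.exp_le_exp.mpr (by linarith [not_lt.mp hb])
    set c := Real.log (predictive π f (i.removeNth v) (v i)) with hc
    set q := Real.log (predictive π f v (v i)) with hq
    have i1 := (hr.memLp_two_log_sub v (v i) c).integrable_sq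
    have h1 : ∫ θ, (Real.log (f θ (v i)) - q) ^ 2 ∂(chainPosterior π f v) ≤
        ∫ θ, (2 * (Real.log (f θ (v i)) - c) ^ 2 + 2 * (q - c) ^ 2) ∂(chainPosterior π f v) := by
      refine integral_mono (hr.memLp_two_log_sub v (v i) q).integrable_sq
        ((i1.const_mul 2).add (integrable_const _)) fun θ => ?_
      nlinarith [sq_nonneg ((Real.log (f θ (v i)) - c) + (q - c))]
    rw [integral_add (i1.const_mul 2) (integrable_const _), integral_const_mul, integral_const,
      probReal_univ, one_smul] at h1
    have h2 := hr.sq_log_predictive_sub_loo_le v i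
    have h3 := hr.integral_sq_log_sub_loo_le v i
    rw [← hc] at h2 h3
    rw [← hq] at h2
    set I := ∫ θ, (Real.log (f θ (v i)) - c) ^ 2 ∂(chainPosterior π f v) with hI
    have hI0 : 0 ≤ I := integral_nonneg fun θ => sq_nonneg _
    have h4 : I ≤ 4 * Real.exp (2 * b) * looGap π f v i :=
      h3.trans (mul_le_mul_of_nonneg_right (by linarith) hgap)
    have h5 : Real.exp (2 * B (v i)) ^ 2 ≤ Real.exp (2 * b) ^ 2 :=
      pow_le_pow_left₀ (Real.exp_pos _).le hE 2
    have h6 := mul_le_mul_of_nonneg_right h5 hI0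
    calc _ ≤ 2 * (1 + Real.exp (2 * b) ^ 2) * I := by linarith
      _ ≤ 2 * (1 + Real.exp (2 * b) ^ 2) * (4 * Real.exp (2 * b) * looGap π f v i) :=
          mul_le_mul_of_nonneg_left h4 (by positivity)
      _ = _ := by ring

variable {P : Measure Y} [IsProbabilityMeasure P]

theorem integrable_integral_log (hr : RegularModel lam π f B) (hBP : Integrable B P) {n : ℕ}
    (i : Fin (n + 1)) :
    Integrable (fun v : Fin (n + 1) → Y => ∫ θ, Real.log (f θ (v i)) ∂(chainPosterior π f v))
      (Measure.pi fun _ => P) := by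
  refine (integrable_comp_eval (μ := fun _ : Fin (n + 1) => P) (i := i) hBP).mono' ?_
    (ae_of_all _ fun v => ?_)
  · exact (hr.measurable_integral_posterior (g := fun z => Real.log (f z.2 (z.1 i)))
      (hr.meas.comp (measurable_snd.prodMk
        ((measurable_pi_apply i).comp measurable_fst))).log).aestronglyMeasurable
  · have := hr.proper n v
    have h1 : ∀ᵐ θ ∂(chainPosterior π f v), ‖Real.log (f θ (v i))‖ ≤ B (v i) := by
      filter_upwards [hr.ae_pos_and_abs_log_le v (v i)] with θ h using h.2
    simpa using norm_integral_le_of_norm_le_const h1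

/-- The observation left out is independent of the others, so its average can be taken first;
Jensen's inequality at each point and Fubini conclude. -/
theorem integral_meanLogLik_le_log_loo (hr : RegularModel lam π f B) (hB : Measurable B)
    (hBP : Integrable B P) {n : ℕ} (i : Fin (n + 2)) :
    ∫ v : Fin (n + 1) → Y, ∫ θ, meanLogLik P f θ ∂(chainPosterior π f v) ∂(Measure.pi fun _ => P) ≤
      ∫ v : Fin (n + 2) → Y, Real.log (predictive π f (i.removeNth v) (v i))
        ∂(Measure.pi fun _ => P) := by
  have hmp := measurePreserving_piFinSuccAbove (fun _ : Fin (n + 2) => P) i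
  have hm : Measurable fun z : Y × (Fin (n + 1) → Y) => Real.log (predictive π f z.2 z.1) :=
    ((hr.measurable_predictive n).comp measurable_swap).log
  have hi : Integrable (fun z : Y × (Fin (n + 1) → Y) => Real.log (predictive π f z.2 z.1))
      (P.prod (Measure.pi fun _ => P)) :=
    (hBP.comp_fst (Measure.pi fun _ : Fin (n + 1) => P)).mono' hm.aestronglyMeasurable
      (ae_of_all _ fun z => hr.bound n z.2 z.1)
  have h1 : ∫ v : Fin (n + 2) → Y, Real.log (predictive π f (i.removeNth v) (v i))
      ∂(Measure.pi fun _ => P) = ∫ v : Fin (n + 1) → Y, ∫ t, Real.log (predictive π f v t) ∂P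
        ∂(Measure.pi fun _ => P) := by
    rw [← integral_prod_symm _ hi]
    exact hmp.integral_comp' fun z : Y × (Fin (n + 1) → Y) => Real.log (predictive π f z.2 z.1)
  rw [h1]
  refine integral_mono (hr.integrable_integral_meanLogLik hB hBP n) hi.integral_prod_right
    fun v => ?_
  simp only
  have := hr.proper n v
  rw [hr.integral_meanLogLik hB hBP v]
  refine integral_mono ?_ ?_ fun t => hr.integral_log_le v t
  · refine hBP.mono' ?_ (ae_of_all _ fun t => ?_)
    · exact (StronglyMeasurable.integral_prod_right' (f := fun z : Y × Θ => Real.log (f z.2 z.1))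
        (hr.meas.comp measurable_swap).log.stronglyMeasurable).aestronglyMeasurable
    · have h1 : ∀ᵐ θ ∂(chainPosterior π f v), ‖Real.log (f θ t)‖ ≤ B t := by
        filter_upwards [hr.ae_pos_and_abs_log_le v t] with θ h using h.2
      simpa using norm_integral_le_of_norm_le_const h1
  · exact hBP.mono' ((hr.measurable_predictive n).comp
      (measurable_const.prodMk measurable_id)).log.aestronglyMeasurable
      (ae_of_all _ fun t => hr.bound n v t)

theorem integrable_looGap (hr : RegularModel lam π f B) (hBP : Integrable B P) {n : ℕ}
    (i : Fin (n + 2)) :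
    Integrable (fun v : Fin (n + 2) → Y => looGap π f v i) (Measure.pi fun _ => P) :=
  (hr.integrable_integral_log hBP i).sub (hr.integrable_log_loo hBP i)

/-- Both terms of the gap are squeezed at `l`: for almost every parameter the mean log likelihood
over the data is at most `l` plus the uniform error, and the expected leave-one-out term is at least
a quantity that tends to `l`. -/
theorem eventually_integral_looGap_le [SecondCountableTopology Y] (hr : RegularModel lam π f B)
    (hB : Measurable B) (hB2 : MemLp B 2 P) {τ : ℝ} (hτ : 0 < τ) :
    ∀ᶠ n : ℕ in atTop, ∫ v : Fin (n + 2) → Y, (∑ i, looGap π f v i) / (n + 2 : ℕ)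
      ∂(Measure.pi fun _ => P) ≤ τ := by
  have hBP : Integrable B P := hB2.integrable (by norm_num)
  obtain ⟨l, hle, htend⟩ := hr.exists_tendsto_integral_meanLogLik (P := P) hB hB2
  obtain ⟨R, hR0, hRm, hR2, hRe, hR⟩ := hr.exists_uniform_law_log (P := P) hB hB2
    (ε := τ / 20) (by positivity)
  filter_upwards [htend.eventually (eventually_gt_nhds (show l - τ / 2 < l by linarith)),
    (tendsto_add_atTop_nat 2).eventually hRe] with n hn1 hn2
  have hN : (0 : ℝ) < (n + 2 : ℕ) := by positivity
  have hRi : Integrable (R (n + 2)) (Measure.pi fun _ => P) := (hR2 (n + 2)).integrable (by norm_num)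
  -- From `R ≤ R ^ 2 * (10 / τ) + τ / 40` and the mean square bound `18 * (τ / 20) ^ 2`, the mean is
  -- at most `9 * τ / 20 + τ / 40`.
  have hRint : ∫ v, R (n + 2) v ∂(Measure.pi fun _ => P) ≤ τ / 2 := by
    have h1 : ∫ v, R (n + 2) v ∂(Measure.pi fun _ => P) ≤
        ∫ v, (R (n + 2) v ^ 2 * (10 / τ) + τ / 40) ∂(Measure.pi fun _ => P) := by
      refine integral_mono hRi (((hR2 (n + 2)).integrable_sq.mul_const _).add
        (integrable_const _)) fun v => ?_
      simp only
      rw [← sub_nonneg]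
      have : R (n + 2) v ^ 2 * (10 / τ) + τ / 40 - R (n + 2) v =
          (10 / τ) * (R (n + 2) v - τ / 20) ^ 2 := by field_simp; ring
      rw [this]
      positivity
    rw [integral_add ((hR2 (n + 2)).integrable_sq.mul_const _) (integrable_const _),
      integral_mul_const] at h1
    simp only [integral_const, probReal_univ, one_smul] at h1
    have h2 := mul_le_mul_of_nonneg_right hn2 (by positivity : (0 : ℝ) ≤ 10 / τ)
    have h3 : 18 * (τ / 20) ^ 2 * (10 / τ) = 9 / 20 * τ := by field_simp; ring
    linarith
  have hA : ∀ v : Fin (n + 2) → Y,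
      (∑ i, ∫ θ, Real.log (f θ (v i)) ∂(chainPosterior π f v)) / (n + 2 : ℕ) ≤
        l + R (n + 2) v := fun v => by
    have := hr.proper (n + 1) v
    rw [← integral_finsetSum _ fun i _ => hr.integrable_log v (v i), ← integral_div]
    refine (integral_mono_ae ((integrable_finsetSum _ fun i _ =>
      hr.integrable_log v (v i)).div_const _) (integrable_const (l + R (n + 2) v)) ?_).trans
      (by simp)
    filter_upwards [hle (n + 1) v, hR (n + 2) (by omega) v (n + 1) v] with θ h1 h2
    linarith [(abs_le.mp h2).2]
  have hsplit : ∫ v : Fin (n + 2) → Y, (∑ i, looGap π f v i) / (n + 2 : ℕ)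
      ∂(Measure.pi fun _ => P) =
      ∫ v : Fin (n + 2) → Y, (∑ i, ∫ θ, Real.log (f θ (v i)) ∂(chainPosterior π f v)) /
        (n + 2 : ℕ) ∂(Measure.pi fun _ => P) -
      (∑ i, ∫ v : Fin (n + 2) → Y, Real.log (predictive π f (i.removeNth v) (v i))
        ∂(Measure.pi fun _ => P)) / (n + 2 : ℕ) := by
    rw [integral_div, integral_div, integral_finsetSum _ fun i _ => hr.integrable_looGap hBP i,
      integral_finsetSum _ fun i _ => hr.integrable_integral_log hBP i, ← sub_div,
      ← Finset.sum_sub_distrib]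
    congr 1
    exact Finset.sum_congr rfl fun i _ =>
      integral_sub (hr.integrable_integral_log hBP i) (hr.integrable_log_loo hBP i)
  rw [hsplit]
  have h1 : ∫ v : Fin (n + 2) → Y, (∑ i, ∫ θ, Real.log (f θ (v i)) ∂(chainPosterior π f v)) /
        (n + 2 : ℕ) ∂(Measure.pi fun _ => P) ≤ l + τ / 2 := by
    refine (integral_mono ((integrable_finsetSum _ fun i _ =>
      hr.integrable_integral_log hBP i).div_const _) ((integrable_const l).add hRi) hA).trans ?_
    refine (integral_add (integrable_const l) hRi).le.trans ?_
    simpa using hRint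
  have h2 : l - τ / 2 ≤ (∑ i, ∫ v : Fin (n + 2) → Y,
      Real.log (predictive π f (i.removeNth v) (v i)) ∂(Measure.pi fun _ => P)) / (n + 2 : ℕ) := by
    rw [le_div_iff₀ hN]
    have h3 := Finset.sum_le_sum fun (i : Fin (n + 2)) (_ : i ∈ Finset.univ) =>
      hn1.le.trans (hr.integral_meanLogLik_le_log_loo (P := P) hB hBP i)
    rw [Finset.sum_const, Finset.card_univ, Fintype.card_fin, nsmul_eq_mul] at h3
    linarith
  linarith

theorem integrable_integral_sq_log_sub_predictive (hr : RegularModel lam π f B)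
    (hB2 : MemLp B 2 P) {n : ℕ} (i : Fin (n + 1)) :
    Integrable (fun v : Fin (n + 1) → Y => ∫ θ, (Real.log (f θ (v i)) -
      Real.log (predictive π f v (v i))) ^ 2 ∂(chainPosterior π f v)) (Measure.pi fun _ => P) := by
  refine ((integrable_comp_eval (μ := fun _ : Fin (n + 1) => P) (i := i)
    hB2.integrable_sq).const_mul 4).mono' ?_ (ae_of_all _ fun v => ?_)
  · have m1 : Measurable fun z : (Fin (n + 1) → Y) × Θ => Real.log (f z.2 (z.1 i)) :=
      (hr.meas.comp (measurable_snd.prodMk ((measurable_pi_apply i).comp measurable_fst))).log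
    have m2 : Measurable fun z : (Fin (n + 1) → Y) × Θ =>
        Real.log (predictive π f z.1 (z.1 i)) :=
      ((hr.measurable_predictive n).comp (measurable_fst.prodMk
        ((measurable_pi_apply i).comp measurable_fst))).log
    exact (hr.measurable_integral_posterior ((m1.sub m2).pow_const 2)).aestronglyMeasurable
  · have := hr.proper n v
    have h1 : ∀ᵐ θ ∂(chainPosterior π f v), ‖(Real.log (f θ (v i)) -
        Real.log (predictive π f v (v i))) ^ 2‖ ≤ 4 * B (v i) ^ 2 := by
      filter_upwards [hr.ae_pos_and_abs_log_le v (v i)] with θ h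
      have h2 := (abs_sub (Real.log (f θ (v i))) (Real.log (predictive π f v (v i)))).trans
        (add_le_add h.2 (hr.bound n v (v i)))
      have h3 := pow_le_pow_left₀ (abs_nonneg _) h2 2
      rw [Real.norm_of_nonneg (sq_nonneg _), ← sq_abs]
      refine h3.trans (le_of_eq ?_)
      ring
    simpa using norm_integral_le_of_norm_le_const h1

/-- At the observations, the log likelihood under the posterior tends in mean square to the log
predictive density. -/
theorem tendsto_integral_sq_log_sub_predictive [SecondCountableTopology Y]
    (hr : RegularModel lam π f B) (hB : Measurable B) (hB2 : MemLp B 2 P) :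
    Tendsto (fun n : ℕ => ∫ v : Fin (n + 1) → Y, (∑ i, ∫ θ, (Real.log (f θ (v i)) -
      Real.log (predictive π f v (v i))) ^ 2 ∂(chainPosterior π f v)) / (n + 1 : ℕ)
        ∂(Measure.pi fun _ => P)) atTop (𝓝 0) := by
  have hBP : Integrable B P := hB2.integrable (by norm_num)
  -- Leaving one observation out must leave at least one behind, so the number of observations is
  -- written as `n + 2`.
  rw [← tendsto_add_atTop_iff_nat 1]
  refine tendsto_order.mpr ⟨fun a ha => Eventually.of_forall fun n => ha.trans_le ?_,
    fun a ha => ?_⟩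
  · exact integral_nonneg fun v => div_nonneg (Finset.sum_nonneg fun i _ =>
      integral_nonneg fun θ => sq_nonneg _) (Nat.cast_nonneg _)
  obtain ⟨b, hb⟩ := ((tendsto_integral_indicator_sq (P := P) hB hB2).eventually
    (eventually_lt_nhds (show (0 : ℝ) < a / 8 by positivity))).exists
  set h : Y → ℝ := {t | (b : ℝ) < B t}.indicator fun t => B t ^ 2 with hh
  have hhi : Integrable h P :=
    hB2.integrable_sq.indicator (measurableSet_lt measurable_const hB)
  set c := 8 * Real.exp (2 * b) * (1 + Real.exp (2 * b) ^ 2) with hc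
  have hc0 : 0 < c := by positivity
  -- The gap contributes `c * (a / (4 * c)) = a / 4` and the truncated envelope less than `4 * (a /
  -- 8)`.
  filter_upwards [hr.eventually_integral_looGap_le (P := P) hB hB2
    (τ := a / (4 * c)) (by positivity)] with n hn
  have i1 : Integrable (fun v : Fin (n + 2) → Y => (∑ i, looGap π f v i) / (n + 2 : ℕ))
      (Measure.pi fun _ => P) :=
    (integrable_finsetSum _ fun i _ => hr.integrable_looGap hBP i).div_const _
  have i2 := integrable_sum_div P (n + 2) hhi
  have key := integral_mono ((integrable_finsetSum Finset.univ fun (i : Fin (n + 2)) _ =>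
      hr.integrable_integral_sq_log_sub_predictive hB2 i).div_const ((n + 2 : ℕ) : ℝ))
    ((i1.const_mul c).add (i2.const_mul 4)) fun v => by
      simp only [Pi.add_apply]
      rw [mul_div_assoc', mul_div_assoc', ← add_div]
      refine div_le_div_of_nonneg_right ?_ (Nat.cast_nonneg _)
      rw [Finset.mul_sum, Finset.mul_sum, ← Finset.sum_add_distrib]
      exact Finset.sum_le_sum fun i _ => hr.integral_sq_log_sub_predictive_le v i b
  refine key.trans_lt ?_
  refine (integral_add (i1.const_mul c) (i2.const_mul 4)).trans_lt ?_
  rw [integral_const_mul, integral_const_mul, integral_sum_div_eq P (by omega) hhi]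
  have h1 := mul_le_mul_of_nonneg_left hn hc0.le
  have h2 : c * (a / (4 * c)) = a / 4 := by field_simp
  linarith

end RegularModel

end Gap

/-! ### Weighted means and mixtures -/

section Mixture

theorem sum_mul_div_sum_mem_Icc {S : ℕ} [NeZero S] {a ρ : Fin S → ℝ} {lo hi : ℝ}
    (ha : ∀ s, a s ∈ Set.Icc lo hi) (hρ : ∀ s, 0 < ρ s) :
    (∑ s, a s * ρ s) / ∑ s, ρ s ∈ Set.Icc lo hi := by
  have h0 : 0 < ∑ s, ρ s := Finset.sum_pos (fun s _ => hρ s) Finset.univ_nonempty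
  constructor
  · rw [le_div_iff₀ h0, Finset.mul_sum]
    exact Finset.sum_le_sum fun s _ => mul_le_mul_of_nonneg_right (ha s).1 (hρ s).le
  · rw [div_le_iff₀ h0, Finset.mul_sum]
    exact Finset.sum_le_sum fun s _ => mul_le_mul_of_nonneg_right (ha s).2 (hρ s).le

/-- The log of a weighted mean with weights of bounded ratio is close to a constant if the logs of
the averaged numbers are. -/
theorem sq_log_weighted_mean_sub_le {S : ℕ} [NeZero S] {a ρ : Fin S → ℝ} {p b : ℝ}
    (ha : ∀ s, a s ∈ Set.Icc (Real.exp (-b)) (Real.exp b))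
    (hρ : ∀ s, ρ s ∈ Set.Icc (Real.exp (-b)) (Real.exp b))
    (hp : p ∈ Set.Icc (Real.exp (-b)) (Real.exp b)) :
    (Real.log ((∑ s, a s * ρ s) / ∑ s, ρ s) - Real.log p) ^ 2 ≤
      Real.exp (2 * b) ^ 6 * ((∑ s, (Real.log (a s) - Real.log p) ^ 2) / S) := by
  have hS : (0 : ℝ) < S := Nat.cast_pos.mpr (NeZero.pos S)
  have hp' := pos_and_abs_log_le_of_mem_Icc hp
  have hρ0 : ∀ s, 0 < ρ s := fun s => (Real.exp_pos _).trans_le (hρ s).1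
  have hsum : 0 < ∑ s, ρ s := Finset.sum_pos (fun s _ => hρ0 s) Finset.univ_nonempty
  set E := Real.exp (2 * b) with hE
  have hE0 : 0 < E := Real.exp_pos _
  have hmean := sum_mul_div_sum_mem_Icc ha hρ0
  set m := (∑ s, a s * ρ s) / ∑ s, ρ s with hm
  have hm0 : 0 < m := (Real.exp_pos _).trans_le hmean.1
  have hpt : ∀ s, |a s / p - 1| ≤ E * |Real.log (a s) - Real.log p| := fun s => by
    have h1 := pos_and_abs_log_le_of_mem_Icc (ha s)
    have h2 : a s / p = Real.exp (Real.log (a s) - Real.log p) := by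
      rw [Real.exp_sub, Real.exp_log h1.1, Real.exp_log hp'.1]
    rw [h2, mul_comm]
    refine (abs_exp_sub_one_le_mul _).trans (mul_le_mul_of_nonneg_left ?_ (abs_nonneg _))
    refine Real.exp_le_exp.mpr ((abs_sub _ _).trans ?_)
    linarith [h1.2, hp'.2]
  have hdiff : |m / p - 1| ≤ E ^ 2 * ((∑ s, |Real.log (a s) - Real.log p|) / S) := by
    have h1 : m / p - 1 = (∑ s, (a s / p - 1) * ρ s) / ∑ s, ρ s := by
      simp_rw [sub_mul, one_mul, Finset.sum_sub_distrib]
      rw [sub_div, div_self hsum.ne', hm]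
      congr 1
      simp_rw [div_mul_eq_mul_div]
      rw [← Finset.sum_div, div_div, div_div, mul_comm]
    have h2 : (S : ℝ) * Real.exp (-b) ≤ ∑ s, ρ s := by
      have := Finset.sum_le_sum fun s (_ : s ∈ Finset.univ) => (hρ s).1
      simpa using this
    have h3 : |∑ s, (a s / p - 1) * ρ s| ≤
        ∑ s, E * |Real.log (a s) - Real.log p| * Real.exp b := by
      refine (Finset.abs_sum_le_sum_abs _ _).trans (Finset.sum_le_sum fun s _ => ?_)
      rw [abs_mul, abs_of_pos (hρ0 s)]
      exact mul_le_mul (hpt s) (hρ s).2 (hρ0 s).le (by positivity)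
    rw [h1, abs_div, abs_of_pos hsum, div_le_iff₀ hsum]
    refine h3.trans ?_
    rw [← Finset.sum_mul, ← Finset.mul_sum]
    have h4 : Real.exp b = E * Real.exp (-b) := by rw [hE, ← Real.exp_add]; congr 1; ring
    have hA : 0 ≤ ∑ s, |Real.log (a s) - Real.log p| := Finset.sum_nonneg fun s _ => abs_nonneg _
    calc E * (∑ s, |Real.log (a s) - Real.log p|) * Real.exp b
        = E ^ 2 * ((∑ s, |Real.log (a s) - Real.log p|) / S) * (S * Real.exp (-b)) := by
          rw [h4]; field_simp
      _ ≤ _ := mul_le_mul_of_nonneg_left h2 (by positivity)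
  have hu : 1 / E ≤ m / p := by
    rw [div_le_div_iff₀ hE0 hp'.1]
    have h5 : Real.exp b = E * Real.exp (-b) := by rw [hE, ← Real.exp_add]; congr 1; ring
    nlinarith [hp.2, hmean.1]
  have hu0 : 0 < m / p := div_pos hm0 hp'.1
  have hE1 : 1 ≤ E := by
    have : -b ≤ b := Real.exp_le_exp.mp (hp.1.trans hp.2)
    exact Real.one_le_exp (by linarith)
  have hlog : |Real.log m - Real.log p| ≤ E * |m / p - 1| := by
    rw [← Real.log_div hm0.ne' hp'.1.ne']
    have h6 := Real.log_le_sub_one_of_pos hu0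
    have h7 := Real.log_le_sub_one_of_pos (inv_pos.mpr hu0)
    rw [Real.log_inv] at h7
    have h8 : (m / p)⁻¹ - 1 ≤ E * |m / p - 1| := by
      have h9 : (m / p)⁻¹ - 1 = (m / p)⁻¹ * (1 - m / p) := by
        rw [mul_sub, inv_mul_cancel₀ hu0.ne', mul_one]
      have h10 : (m / p)⁻¹ ≤ E := by
        rw [inv_le_comm₀ hu0 hE0, inv_eq_one_div]
        exact hu
      rw [h9]
      calc (m / p)⁻¹ * (1 - m / p) ≤ (m / p)⁻¹ * |m / p - 1| := by
            refine mul_le_mul_of_nonneg_left ?_ (inv_pos.mpr hu0).le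
            rw [abs_sub_comm]
            exact le_abs_self _
        _ ≤ _ := mul_le_mul_of_nonneg_right h10 (abs_nonneg _)
    have h11 : m / p - 1 ≤ E * |m / p - 1| := by
      nlinarith [le_abs_self (m / p - 1), abs_nonneg (m / p - 1)]
    rw [abs_le]
    constructor <;> linarith
  have hfin : |Real.log m - Real.log p| ≤
      E ^ 3 * ((∑ s, |Real.log (a s) - Real.log p|) / S) := by
    refine hlog.trans ((mul_le_mul_of_nonneg_left hdiff hE0.le).trans (le_of_eq ?_))
    ring
  rw [← sq_abs]
  refine (pow_le_pow_left₀ (abs_nonneg _) hfin 2).trans ?_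
  rw [mul_pow, ← pow_mul]
  refine mul_le_mul_of_nonneg_left ((sum_div_sq_le _).trans (le_of_eq ?_)) (by positivity)
  simp_rw [sq_abs]

variable {Θ Y : Type*} {f : Θ → Y → ℝ} {S : ℕ}

theorem psisLoo_mem_Icc [NeZero S] {θ : Fin S → Θ} {t : Y} {b : ℝ}
    (h : ∀ s, f (θ s) t ∈ Set.Icc (Real.exp (-b)) (Real.exp b)) :
    psisLoo f θ t ∈ Set.Icc (Real.exp (-b)) (Real.exp b) := by
  obtain ⟨ρ, hρ, he⟩ := psisLoo_eq_weighted_mean h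
  rw [he]
  exact sum_mul_div_sum_mem_Icc h fun s => (Real.exp_pos _).trans_le (hρ s).1

/-- The error of the approximate leave-one-out density, for an observation `t` with a bounded
envelope `B t ≤ b`, and the trivial bound otherwise. -/
theorem sq_log_psisLoo_sub_le [NeZero S] {B : Y → ℝ} {θ : Fin S → Θ} {t : Y} {p : ℝ} (b : ℝ)
    (h : ∀ s, f (θ s) t ∈ Set.Icc (Real.exp (-B t)) (Real.exp (B t)))
    (hp : p ∈ Set.Icc (Real.exp (-B t)) (Real.exp (B t))) :
    (Real.log (psisLoo f θ t) - Real.log p) ^ 2 ≤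
      Real.exp (2 * b) ^ 6 * ((∑ s, (Real.log (f (θ s) t) - Real.log p) ^ 2) / S) +
        4 * {t | b < B t}.indicator (fun t => B t ^ 2) t := by
  have hsum : 0 ≤ (∑ s, (Real.log (f (θ s) t) - Real.log p) ^ 2) / S :=
    div_nonneg (Finset.sum_nonneg fun s _ => sq_nonneg _) (Nat.cast_nonneg _)
  by_cases hb : b < B t
  · rw [Set.indicator_of_mem (show t ∈ {t | b < B t} from hb)]
    have h1 := pos_and_abs_log_le_of_mem_Icc (psisLoo_mem_Icc h)
    have h2 := pos_and_abs_log_le_of_mem_Icc hp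
    have h3 := (abs_sub (Real.log (psisLoo f θ t)) (Real.log p)).trans (add_le_add h1.2 h2.2)
    have h4 := pow_le_pow_left₀ (abs_nonneg _) h3 2
    rw [sq_abs] at h4
    have h5 : 0 ≤ Real.exp (2 * b) ^ 6 *
        ((∑ s, (Real.log (f (θ s) t) - Real.log p) ^ 2) / S) := by positivity
    linarith [show (B t + B t) ^ 2 = 4 * B t ^ 2 by ring]
  · rw [Set.indicator_of_notMem (show t ∉ {t | b < B t} from hb), mul_zero, add_zero]
    obtain ⟨ρ, hρ, he⟩ := psisLoo_eq_weighted_mean h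
    rw [he]
    refine (sq_log_weighted_mean_sub_le h hρ hp).trans (mul_le_mul_of_nonneg_right ?_ hsum)
    refine pow_le_pow_left₀ (Real.exp_pos _).le (Real.exp_le_exp.mpr ?_) 6
    linarith [not_lt.mp hb]

variable {K : ℕ}

/-- The log of a mixture depends on the logs of its components in a Lipschitz manner. -/
theorem abs_log_sum_sub_log_sum_le {w a c : Fin K → ℝ} (hw : w ∈ stdSimplex ℝ (Fin K))
    (ha : ∀ k, 0 < w k → 0 < a k) (hc : ∀ k, 0 < w k → 0 < c k) :
    |Real.log (∑ k, w k * a k) - Real.log (∑ k, w k * c k)| ≤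
      ∑ k with 0 < w k, |Real.log (a k) - Real.log (c k)| := by
  have hpos : ∀ a : Fin K → ℝ, (∀ k, 0 < w k → 0 < a k) → 0 < ∑ k, w k * a k := fun a ha => by
    obtain ⟨k, -, hk⟩ : ∃ k ∈ Finset.univ, 0 < w k := by
      by_contra! hcon
      have := Finset.sum_nonpos hcon
      linarith [hw.2]
    refine Finset.sum_pos' (fun j _ => ?_) ⟨k, Finset.mem_univ k, mul_pos hk (ha k hk)⟩
    rcases eq_or_lt_of_le (hw.1 j) with h | h
    · simp [← h]
    · exact (mul_pos h (ha j h)).le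
  have key : ∀ a c : Fin K → ℝ, (∀ k, 0 < w k → 0 < a k) → (∀ k, 0 < w k → 0 < c k) →
      Real.log (∑ k, w k * a k) - Real.log (∑ k, w k * c k) ≤
        ∑ k with 0 < w k, |Real.log (a k) - Real.log (c k)| := fun a c ha hc => by
    set d := ∑ k with 0 < w k, |Real.log (a k) - Real.log (c k)| with hd
    have h1 : ∑ k, w k * a k ≤ Real.exp d * ∑ k, w k * c k := by
      rw [Finset.mul_sum]
      refine Finset.sum_le_sum fun k _ => ?_
      rcases eq_or_lt_of_le (hw.1 k) with h | h
      · simp [← h]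
      · have h2 : Real.log (a k) - Real.log (c k) ≤ d :=
          (le_abs_self _).trans (Finset.single_le_sum
            (f := fun k => |Real.log (a k) - Real.log (c k)|) (fun _ _ => abs_nonneg _)
            (Finset.mem_filter.mpr ⟨Finset.mem_univ k, h⟩))
        have h3 : a k ≤ Real.exp d * c k := by
          rw [← Real.exp_log (ha k h), ← Real.exp_log (hc k h), ← Real.exp_add]
          refine Real.exp_le_exp.mpr ?_
          linarith
        nlinarith
    have h4 := Real.log_le_log (hpos a ha) h1
    rw [Real.log_mul (Real.exp_pos _).ne' (hpos c hc).ne', Real.log_exp] at h4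
    linarith
  rw [abs_le]
  have h1 := key a c ha hc
  have h2 := key c a hc ha
  simp_rw [abs_sub_comm (Real.log (c _))] at h2
  constructor <;> linarith

/-- Comparison with the mixture of ones, whose log is zero because the weights sum to one. -/
theorem abs_log_sum_le {w a : Fin K → ℝ} (hw : w ∈ stdSimplex ℝ (Fin K))
    (ha : ∀ k, 0 < w k → 0 < a k) :
    |Real.log (∑ k, w k * a k)| ≤ ∑ k with 0 < w k, |Real.log (a k)| := by
  have h := abs_log_sum_sub_log_sum_le (c := fun _ => 1) hw ha fun _ _ => one_pos
  simpa [hw.2] using h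

theorem sq_log_sum_sub_log_sum_le {w a c : Fin K → ℝ} (hw : w ∈ stdSimplex ℝ (Fin K))
    (ha : ∀ k, 0 < w k → 0 < a k) (hc : ∀ k, 0 < w k → 0 < c k) :
    (Real.log (∑ k, w k * a k) - Real.log (∑ k, w k * c k)) ^ 2 ≤
      K * ∑ k with 0 < w k, (Real.log (a k) - Real.log (c k)) ^ 2 := by
  have h1 := pow_le_pow_left₀ (abs_nonneg _) (abs_log_sum_sub_log_sum_le hw ha hc) 2
  rw [sq_abs] at h1
  refine h1.trans (sq_sum_le_card_mul_sum_sq.trans ?_)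
  simp_rw [sq_abs]
  refine mul_le_mul_of_nonneg_right ?_ (Finset.sum_nonneg fun k _ => sq_nonneg _)
  have := Finset.card_filter_le (Finset.univ : Finset (Fin K)) fun k => 0 < w k
  rw [Finset.card_univ, Fintype.card_fin] at this
  exact_mod_cast this

end Mixture

/-! ### The stacked predictive distribution -/

section StackedPredictive

variable {K : ℕ} {Θ Y : Type*} [MeasurableSpace Θ] [MetricSpace Y] [MeasurableSpace Y]
  [BorelSpace Y] {lam : Measure Y} [SFinite lam] [lam.IsOpenPosMeasure]
  {π : Fin K → Measure Θ} [∀ k, SigmaFinite (π k)] {f : Fin K → Θ → Y → ℝ} {w : Fin K → ℝ}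
  {P : Measure Y} [IsProbabilityMeasure P]

/-- A common envelope of the chains with positive weight. -/
def stackedEnvelope (π : Fin K → Measure Θ) (f : Fin K → Θ → Y → ℝ) (w : Fin K → ℝ) (t : Y) : ℝ :=
  ∑ k with 0 < w k, logEnvelope (π k) (f k) t

theorem continuous_stackedEnvelope
    (hr : ∀ k, RegularModel lam (π k) (f k) (logEnvelope (π k) (f k))) :
    Continuous (stackedEnvelope π f w) :=
  continuous_finsetSum _ fun k _ => (hr k).continuous_logEnvelope

theorem stackedEnvelope_nonneg
    (hr : ∀ k, RegularModel lam (π k) (f k) (logEnvelope (π k) (f k))) (t : Y) :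
    0 ≤ stackedEnvelope π f w t :=
  Finset.sum_nonneg fun k _ => (hr k).logEnvelope_nonneg t

/-- The moment condition on the mixture of the envelopes gives square integrable envelopes of the
chains with positive weight. -/
theorem memLp_two_logEnvelope {B : Fin K → Y → ℝ} (hw : w ∈ stdSimplex ℝ (Fin K))
    (hr : ∀ k, RegularModel lam (π k) (f k) (B k))
    (hg : Integrable (fun t => max ((Real.log (∑ k, w k * Real.exp (-B k t))) ^ 4)
      ((Real.log (∑ k, w k * Real.exp (B k t))) ^ 4)) P) {k : Fin K} (hk : 0 < w k) :
    MemLp (logEnvelope (π k) (f k)) 2 P := by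
  have hm := (hr k).continuous_logEnvelope.measurable
  rw [memLp_two_iff_integrable_sq hm.aestronglyMeasurable]
  refine ((((integrable_const (1 : ℝ)).add hg).const_mul 2).add
    (integrable_const (2 * Real.log (w k) ^ 2))).mono' (hm.pow_const 2).aestronglyMeasurable
    (ae_of_all _ fun t => ?_)
  rw [Real.norm_of_nonneg (sq_nonneg _)]
  set L := Real.log (∑ k, w k * Real.exp (B k t)) with hL
  -- A single summand bounds the mixture from below, which controls the envelope of a chain up to
  -- `log (w k)`. A chain of weight zero is not controlled, so only chains of positive weight enter
  -- the sums.
  have h1 : Real.log (w k) + B k t ≤ L := by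
    rw [← Real.log_exp (B k t), ← Real.log_mul hk.ne' (Real.exp_pos _).ne']
    refine Real.log_le_log (mul_pos hk (Real.exp_pos _)) ?_
    exact Finset.single_le_sum (f := fun k => w k * Real.exp (B k t))
      (fun j _ => mul_nonneg (hw.1 j) (Real.exp_pos _).le) (Finset.mem_univ k)
  have h2 : logEnvelope (π k) (f k) t ≤ L - Real.log (w k) :=
    ((hr k).logEnvelope_le t).trans (by linarith)
  have h3 := pow_le_pow_left₀ ((hr k).logEnvelope_nonneg t) h2 2
  have h4 : L ^ 4 ≤ max ((Real.log (∑ k, w k * Real.exp (-B k t))) ^ 4) (L ^ 4) := le_max_right _ _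
  have h5 : L ^ 2 ≤ 1 + L ^ 4 := by nlinarith [sq_nonneg (L ^ 2 - 1), sq_nonneg L]
  change logEnvelope (π k) (f k) t ^ 2 ≤
    2 * (1 + max ((Real.log (∑ k, w k * Real.exp (-B k t))) ^ 4) (L ^ 4)) + 2 * Real.log (w k) ^ 2
  nlinarith [sq_nonneg (L + Real.log (w k))]

theorem abs_stackedLogPredictive_le (hw : w ∈ stdSimplex ℝ (Fin K))
    (hr : ∀ k, RegularModel lam (π k) (f k) (logEnvelope (π k) (f k))) {n : ℕ}
    (v : Fin (n + 1) → Y) (t : Y) :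
    |stackedLogPredictive π f w v t| ≤ stackedEnvelope π f w t :=
  (abs_log_sum_le hw fun k _ => (hr k).pos n v t).trans
    (Finset.sum_le_sum fun k _ => (hr k).bound n v t)

theorem measurable_stackedLogPredictive
    (hr : ∀ k, RegularModel lam (π k) (f k) (logEnvelope (π k) (f k))) (n : ℕ) :
    Measurable fun z : (Fin (n + 1) → Y) × Y => stackedLogPredictive π f w z.1 z.2 :=
  (Finset.measurable_sum _ fun k _ => ((hr k).measurable_predictive n).const_mul (w k)).log

theorem measurable_stackedElpd
    (hr : ∀ k, RegularModel lam (π k) (f k) (logEnvelope (π k) (f k))) (n : ℕ) :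
    Measurable fun v : Fin (n + 1) → Y => stackedElpd P π f w v :=
  (StronglyMeasurable.integral_prod_right'
    (measurable_stackedLogPredictive hr n).stronglyMeasurable).measurable

theorem integrable_stackedLogPredictive (hw : w ∈ stdSimplex ℝ (Fin K))
    (hr : ∀ k, RegularModel lam (π k) (f k) (logEnvelope (π k) (f k)))
    (hH : Integrable (stackedEnvelope π f w) P) {n : ℕ} (v : Fin (n + 1) → Y) :
    Integrable (stackedLogPredictive π f w v) P :=
  hH.mono' ((measurable_stackedLogPredictive hr n).comp
    (measurable_const.prodMk measurable_id)).aestronglyMeasurable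
    (ae_of_all _ fun t => abs_stackedLogPredictive_le hw hr v t)

/-- The uniform law of large numbers for the stacked log predictive densities. -/
theorem exists_uniform_law_stacked [SecondCountableTopology Y] (hw : w ∈ stdSimplex ℝ (Fin K))
    (hr : ∀ k, RegularModel lam (π k) (f k) (logEnvelope (π k) (f k)))
    (hH : MemLp (stackedEnvelope π f w) 2 P) {ε : ℝ} (hε : 0 < ε) :
    ∃ R : ∀ n, (Fin n → Y) → ℝ, (∀ n v, 0 ≤ R n v) ∧ (∀ n, Measurable (R n)) ∧
      (∀ n, MemLp (R n) 2 (Measure.pi fun _ => P)) ∧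
      (∀ᶠ n in atTop, ∫ v, R n v ^ 2 ∂(Measure.pi fun _ => P) ≤ 18 * ε ^ 2) ∧
      ∀ n, ∀ v : Fin (n + 1) → Y,
        |(∑ i, stackedLogPredictive π f w v (v i)) / (n + 1 : ℕ) - stackedElpd P π f w v| ≤
          R (n + 1) v := by
  -- The errors of at most `K` chains add up in the log of the mixture; `K + 1` makes the
  -- denominator visibly positive.
  choose δ hδ h using fun k t => (hr k).exists_log_close t
    (show (0 : ℝ) < ε / (K + 1) by positivity)
  have hclose : ∀ z t, t ∈ ⋂ k, Metric.ball z (δ k z) → ∀ n, ∀ v : Fin (n + 1) → Y,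
      |stackedLogPredictive π f w v t - stackedLogPredictive π f w v z| ≤ ε :=
    fun z t ht n v => by
      refine (abs_log_sum_sub_log_sum_le hw (fun k _ => (hr k).pos n v t)
        fun k _ => (hr k).pos n v z).trans ?_
      have h1 : ∀ k ∈ Finset.univ.filter fun k => 0 < w k,
          |Real.log (predictive (π k) (f k) v t) - Real.log (predictive (π k) (f k) v z)| ≤
            ε / (K + 1) := fun k _ => (h k z t (Set.mem_iInter.mp ht k) n v).1
      refine (Finset.sum_le_card_nsmul _ _ _ h1).trans ?_
      have h2 := Finset.card_filter_le (Finset.univ : Finset (Fin K)) fun k => 0 < w k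
      rw [Finset.card_univ, Fintype.card_fin] at h2
      have h3 : ((Finset.univ.filter fun k => 0 < w k).card : ℝ) ≤ K := by exact_mod_cast h2
      rw [nsmul_eq_mul, mul_div_assoc', div_le_iff₀ (by positivity)]
      nlinarith
  obtain ⟨Z, R, hR0, hRm, hR2, hRe, hR⟩ := exists_uniform_law (P := P)
    (continuous_stackedEnvelope (w := w) hr).measurable (stackedEnvelope_nonneg hr) hH hε
    (N := fun z => ⋂ k, Metric.ball z (δ k z))
    fun z => Filter.iInter_mem.mpr fun k => Metric.ball_mem_nhds z (hδ k z)
  refine ⟨R, hR0, hRm, hR2, hRe, fun n v => ?_⟩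
  exact hR (n + 1) n.succ_ne_zero v _
    (integrable_stackedLogPredictive hw hr (hH.integrable (by norm_num)) v).1
    (fun z _ => abs_stackedLogPredictive_le hw hr v z)
    (fun i => abs_stackedLogPredictive_le hw hr v _)
    (ae_of_all _ fun t => abs_stackedLogPredictive_le hw hr v t)
    (fun z _ i hi => hclose z _ hi n v)
    (ae_of_all _ fun t z _ ht => hclose z t ht n v)

end StackedPredictive

/-! ### Posterior draws -/

section Draws

variable {Θ Y : Type*} [MeasurableSpace Θ] [MetricSpace Y] [MeasurableSpace Y]
  [BorelSpace Y] {lam : Measure Y} {P : Measure Y} [IsProbabilityMeasure P]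
  {Ω : Type*} [MeasurableSpace Ω] {μ : Measure Ω} [IsProbabilityMeasure μ]
  {n : ℕ} {V : Ω → Fin (n + 1) → Y}

namespace RegularModel

variable {π : Measure Θ} [SigmaFinite π] {f : Θ → Y → ℝ} {B : Y → ℝ} {ϑ : Ω → Θ}

/-- Rectangles determine the joint law of the data and a single draw. The joint law of several draws
never enters. -/
theorem map_prodMk_eq_compProd (hr : RegularModel lam π f B) (hV : Measurable V)
    (hϑ : Measurable ϑ)
    (hlaw : ∀ A : Set (Fin (n + 1) → Y), MeasurableSet A → ∀ C : Set Θ, MeasurableSet C →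
      μ {ω | V ω ∈ A ∧ ϑ ω ∈ C} =
        ∫⁻ v in A, chainPosterior π f v C ∂(Measure.pi fun _ : Fin (n + 1) => P)) :
    μ.map (fun ω => (V ω, ϑ ω)) = (Measure.pi fun _ => P) ⊗ₘ hr.kernel n := by
  have := Measure.isProbabilityMeasure_map (μ := μ) (hV.prodMk hϑ).aemeasurable
  refine Measure.ext_prod fun {A C} hA hC => ?_
  rw [Measure.compProd_apply_prod hA hC, Measure.map_apply (hV.prodMk hϑ) (hA.prod hC)]
  exact hlaw A hA C hC

variable [SFinite lam] [lam.IsOpenPosMeasure]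

theorem ae_draw_mem_Icc (hr : RegularModel lam π f B) (hB : Measurable B) (hV : Measurable V)
    (hϑ : Measurable ϑ)
    (hlaw : μ.map (fun ω => (V ω, ϑ ω)) = (Measure.pi fun _ => P) ⊗ₘ hr.kernel n)
    (i : Fin (n + 1)) :
    ∀ᵐ ω ∂μ, f (ϑ ω) (V ω i) ∈ Set.Icc (Real.exp (-B (V ω i))) (Real.exp (B (V ω i))) := by
  have hVi : Measurable fun z : (Fin (n + 1) → Y) × Θ => z.1 i :=
    (measurable_pi_apply i).comp measurable_fst
  have hm : Measurable fun z : (Fin (n + 1) → Y) × Θ => f z.2 (z.1 i) :=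
    hr.meas.comp (measurable_snd.prodMk hVi)
  have h : ∀ᵐ z ∂((Measure.pi fun _ => P) ⊗ₘ hr.kernel n),
      f z.2 (z.1 i) ∈ Set.Icc (Real.exp (-B (z.1 i))) (Real.exp (B (z.1 i))) := by
    rw [Measure.ae_compProd_iff]
    · exact ae_of_all _ fun v => hr.ae_mem_Icc v (v i)
    · exact (measurableSet_le (hB.comp hVi).neg.exp hm).inter
        (measurableSet_le hm (hB.comp hVi).exp)
  rw [← hlaw] at h
  exact ae_of_ae_map (hV.prodMk hϑ).aemeasurable h

theorem integrable_sq_log_draw_sub (hr : RegularModel lam π f B) (hB : Measurable B)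
    (hB2 : MemLp B 2 P) (hV : Measurable V) (hϑ : Measurable ϑ)
    (hVlaw : μ.map V = Measure.pi fun _ => P)
    (hlaw : μ.map (fun ω => (V ω, ϑ ω)) = (Measure.pi fun _ => P) ⊗ₘ hr.kernel n)
    (i : Fin (n + 1)) :
    Integrable (fun ω => (Real.log (f (ϑ ω) (V ω i)) -
      Real.log (predictive π f (V ω) (V ω i))) ^ 2) μ := by
  have hVi : Measurable fun ω => V ω i := (measurable_pi_apply i).comp hV
  have h1 : Integrable (fun v : Fin (n + 1) → Y => B (v i) ^ 2) (μ.map V) := by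
    rw [hVlaw]
    exact (memLp_two_comp_eval P i hB2).integrable_sq
  have hm1 : Measurable fun ω => Real.log (f (ϑ ω) (V ω i)) :=
    (hr.meas.comp (hϑ.prodMk hVi)).log
  have hm2 : Measurable fun ω => Real.log (predictive π f (V ω) (V ω i)) :=
    ((hr.measurable_predictive n).comp (hV.prodMk hVi)).log
  refine ((h1.comp_measurable hV).const_mul 4).mono'
    ((hm1.sub hm2).pow_const 2).aestronglyMeasurable ?_
  filter_upwards [hr.ae_draw_mem_Icc hB hV hϑ hlaw i] with ω h
  rw [Real.norm_of_nonneg (sq_nonneg _)]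
  have h2 := (abs_sub _ _).trans (add_le_add (pos_and_abs_log_le_of_mem_Icc h).2
    (hr.bound n (V ω) (V ω i)))
  have h3 := pow_le_pow_left₀ (abs_nonneg _) h2 2
  rw [sq_abs] at h3
  refine h3.trans (le_of_eq ?_)
  simp only [Function.comp]
  ring

theorem integral_sq_log_draw_sub (hr : RegularModel lam π f B) (hB : Measurable B)
    (hB2 : MemLp B 2 P) (hV : Measurable V) (hϑ : Measurable ϑ)
    (hVlaw : μ.map V = Measure.pi fun _ => P)
    (hlaw : μ.map (fun ω => (V ω, ϑ ω)) = (Measure.pi fun _ => P) ⊗ₘ hr.kernel n)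
    (i : Fin (n + 1)) :
    ∫ ω, (Real.log (f (ϑ ω) (V ω i)) - Real.log (predictive π f (V ω) (V ω i))) ^ 2 ∂μ =
      ∫ v, ∫ θ, (Real.log (f θ (v i)) - Real.log (predictive π f v (v i))) ^ 2
        ∂(chainPosterior π f v) ∂(Measure.pi fun _ => P) := by
  have hVi : Measurable fun z : (Fin (n + 1) → Y) × Θ => z.1 i :=
    (measurable_pi_apply i).comp measurable_fst
  have hm : Measurable fun z : (Fin (n + 1) → Y) × Θ =>
      (Real.log (f z.2 (z.1 i)) - Real.log (predictive π f z.1 (z.1 i))) ^ 2 :=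
    ((hr.meas.comp (measurable_snd.prodMk hVi)).log.sub
      ((hr.measurable_predictive n).comp (measurable_fst.prodMk hVi)).log).pow_const 2
  have hi : Integrable (fun z : (Fin (n + 1) → Y) × Θ =>
      (Real.log (f z.2 (z.1 i)) - Real.log (predictive π f z.1 (z.1 i))) ^ 2)
      ((Measure.pi fun _ => P) ⊗ₘ hr.kernel n) := by
    rw [← hlaw, integrable_map_measure hm.aestronglyMeasurable (hV.prodMk hϑ).aemeasurable]
    exact hr.integrable_sq_log_draw_sub hB hB2 hV hϑ hVlaw hlaw i
  have h1 := Measure.integral_compProd hi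
  rw [← hlaw, integral_map (hV.prodMk hϑ).aemeasurable hm.aestronglyMeasurable] at h1
  exact h1

end RegularModel

end Draws

/-! ### The stacking objective -/

section Objective

variable {K : ℕ} {Θ Y : Type*} [MeasurableSpace Θ] [MetricSpace Y] [MeasurableSpace Y]
  [BorelSpace Y] {lam : Measure Y} [SFinite lam] [lam.IsOpenPosMeasure]
  {π : Fin K → Measure Θ} [∀ k, SigmaFinite (π k)] {f : Fin K → Θ → Y → ℝ} {w : Fin K → ℝ}
  {P : Measure Y} [IsProbabilityMeasure P]
  {Ω : Type*} [MeasurableSpace Ω] {μ : Measure Ω} [IsProbabilityMeasure μ]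
  {n S : ℕ} [NeZero S] {V : Ω → Fin (n + 1) → Y} {ϑ : Fin K → Fin S → Ω → Θ}

/-- The two terms are dominated by the mean of the common envelope over the data and by its
expectation. -/
theorem memLp_two_stackingObjective_sub (hw : w ∈ stdSimplex ℝ (Fin K))
    (hr : ∀ k, RegularModel lam (π k) (f k) (logEnvelope (π k) (f k)))
    (hH : MemLp (stackedEnvelope π f w) 2 P) (hV : Measurable V)
    (hϑ : ∀ k s, Measurable (ϑ k s)) (hVlaw : μ.map V = Measure.pi fun _ => P)
    (hlaw : ∀ k s, μ.map (fun ω => (V ω, ϑ k s ω)) =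
      (Measure.pi fun _ => P) ⊗ₘ (hr k).kernel n) :
    MemLp (fun ω => stackingObjective f w (V ω) (fun k s => ϑ k s ω) -
      stackedElpd P π f w (V ω)) 2 μ := by
  have hVi : ∀ i, Measurable fun ω => V ω i := fun i => (measurable_pi_apply i).comp hV
  have hHP := hH.integrable (by norm_num)
  refine MemLp.sub ?_ ?_
  · have hHV : MemLp (fun ω => (∑ i, stackedEnvelope π f w (V ω i)) / (n + 1 : ℕ)) 2 μ := by
      have h1 := memLp_two_sum_div P (n + 1) hH
      rw [← hVlaw] at h1
      exact h1.comp_of_map hV.aemeasurable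
    refine hHV.mono ?_ ?_
    · refine Measurable.aestronglyMeasurable (Measurable.const_mul ?_ _)
      exact Finset.measurable_sum _ fun i _ => (Finset.measurable_sum _ fun k _ =>
        (measurable_psisLoo (hr k).meas (fun s => hϑ k s) (hVi i)).const_mul _).log
    · have hall : ∀ᵐ ω ∂μ, ∀ k s i, f k (ϑ k s ω) (V ω i) ∈
          Set.Icc (Real.exp (-logEnvelope (π k) (f k) (V ω i)))
            (Real.exp (logEnvelope (π k) (f k) (V ω i))) := by
        simp_rw [ae_all_iff]
        exact fun k s i => (hr k).ae_draw_mem_Icc (hr k).continuous_logEnvelope.measurable hV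
          (hϑ k s) (hlaw k s) i
      filter_upwards [hall] with ω h
      have h1 : ∀ i, |Real.log (∑ k, w k * psisLoo (f k) (fun s => ϑ k s ω) (V ω i))| ≤
          stackedEnvelope π f w (V ω i) := fun i =>
        (abs_log_sum_le hw fun k _ => (pos_and_abs_log_le_of_mem_Icc
          (psisLoo_mem_Icc fun s => h k s i)).1).trans
          (Finset.sum_le_sum fun k _ => (pos_and_abs_log_le_of_mem_Icc
            (psisLoo_mem_Icc fun s => h k s i)).2)
      rw [Real.norm_eq_abs, Real.norm_of_nonneg (div_nonneg
        (Finset.sum_nonneg fun i _ => stackedEnvelope_nonneg hr _) (Nat.cast_nonneg _)),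
        stackingObjective, abs_mul, abs_of_nonneg (by positivity), one_div, div_eq_inv_mul]
      exact mul_le_mul_of_nonneg_left ((Finset.abs_sum_le_sum_abs _ _).trans
        (Finset.sum_le_sum fun i _ => h1 i)) (by positivity)
  · refine MemLp.of_bound ((measurable_stackedElpd hr n).comp hV).aestronglyMeasurable
      (∫ t, stackedEnvelope π f w t ∂P) (ae_of_all _ fun ω => ?_)
    exact norm_integral_le_of_norm_le hHP
      (ae_of_all _ fun t => abs_stackedLogPredictive_le hw hr (V ω) t)

/-- The mean square error of the stacking objective, in terms of the per-chain errors. -/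
theorem integral_sq_stackingObjective_sub_le (hw : w ∈ stdSimplex ℝ (Fin K))
    (hr : ∀ k, RegularModel lam (π k) (f k) (logEnvelope (π k) (f k)))
    (hB2 : ∀ k, 0 < w k → MemLp (logEnvelope (π k) (f k)) 2 P)
    (hV : Measurable V) (hϑ : ∀ k s, Measurable (ϑ k s))
    (hVlaw : μ.map V = Measure.pi fun _ => P)
    (hlaw : ∀ k s, μ.map (fun ω => (V ω, ϑ k s ω)) =
      (Measure.pi fun _ => P) ⊗ₘ (hr k).kernel n)
    {R : (Fin (n + 1) → Y) → ℝ} (hR2 : MemLp R 2 (Measure.pi fun _ => P))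
    (hR : ∀ v : Fin (n + 1) → Y, |(∑ i, stackedLogPredictive π f w v (v i)) / (n + 1 : ℕ) -
      stackedElpd P π f w v| ≤ R v) (b : ℝ) :
    ∫ ω, (stackingObjective f w (V ω) (fun k s => ϑ k s ω) -
      stackedElpd P π f w (V ω)) ^ 2 ∂μ ≤
      2 * (K * ∑ k with 0 < w k, (Real.exp (2 * b) ^ 6 *
        (∫ v : Fin (n + 1) → Y, (∑ i, ∫ θ, (Real.log (f k θ (v i)) -
          Real.log (predictive (π k) (f k) v (v i))) ^ 2 ∂(chainPosterior (π k) (f k) v)) /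
            (n + 1 : ℕ) ∂(Measure.pi fun _ => P)) +
        4 * ∫ t, {t | b < logEnvelope (π k) (f k) t}.indicator
          (fun t => logEnvelope (π k) (f k) t ^ 2) t ∂P)) +
      2 * ∫ v, R v ^ 2 ∂(Measure.pi fun _ => P) := by
  have hBm : ∀ k, Measurable (logEnvelope (π k) (f k)) := fun k =>
    (hr k).continuous_logEnvelope.measurable
  have hall : ∀ᵐ ω ∂μ, ∀ k s i, f k (ϑ k s ω) (V ω i) ∈
      Set.Icc (Real.exp (-logEnvelope (π k) (f k) (V ω i)))
        (Real.exp (logEnvelope (π k) (f k) (V ω i))) := by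
    simp_rw [ae_all_iff]
    exact fun k s i => (hr k).ae_draw_mem_Icc (hBm k) hV (hϑ k s) (hlaw k s) i
  set x : Fin K → Fin S → Fin (n + 1) → Ω → ℝ := fun k s i ω =>
    (Real.log (f k (ϑ k s ω) (V ω i)) - Real.log (predictive (π k) (f k) (V ω) (V ω i))) ^ 2
    with hx
  set q : Fin K → Y → ℝ := fun k => {t | b < logEnvelope (π k) (f k) t}.indicator
    (fun t => logEnvelope (π k) (f k) t ^ 2) with hq
  set E := Real.exp (2 * b) ^ 6
  have hxi : ∀ k, 0 < w k → ∀ s i, Integrable (x k s i) μ := fun k hk s i =>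
    (hr k).integrable_sq_log_draw_sub (hBm k) (hB2 k hk) hV (hϑ k s) hVlaw (hlaw k s) i
  have hxint : ∀ k, 0 < w k → ∀ s i, ∫ ω, x k s i ω ∂μ = ∫ v : Fin (n + 1) → Y, ∫ θ,
      (Real.log (f k θ (v i)) - Real.log (predictive (π k) (f k) v (v i))) ^ 2
        ∂(chainPosterior (π k) (f k) v) ∂(Measure.pi fun _ => P) := fun k hk s i =>
    (hr k).integral_sq_log_draw_sub (hBm k) (hB2 k hk) hV (hϑ k s) hVlaw (hlaw k s) i
  have hqP : ∀ k, 0 < w k → Integrable (q k) P := fun k hk =>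
    (hB2 k hk).integrable_sq.indicator (measurableSet_lt measurable_const (hBm k))
  have hqV : ∀ k, 0 < w k → ∀ i, Integrable (fun v : Fin (n + 1) → Y => q k (v i)) (μ.map V) :=
    fun k hk i => by
      rw [hVlaw]
      exact integrable_comp_eval (μ := fun _ : Fin (n + 1) => P) (hqP k hk)
  have hqi : ∀ k, 0 < w k → ∀ i, Integrable (fun ω => q k (V ω i)) μ := fun k hk i =>
    (hqV k hk i).comp_measurable hV
  have hqint : ∀ k, 0 < w k → ∀ i, ∫ ω, q k (V ω i) ∂μ = ∫ t, q k t ∂P := fun k hk i => by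
    rw [← integral_map (f := fun v : Fin (n + 1) → Y => q k (v i)) hV.aemeasurable
      (hqV k hk i).1, hVlaw]
    exact integral_comp_eval (μ := fun _ : Fin (n + 1) => P) (hqP k hk).1
  have hRV : Integrable (fun ω => R (V ω) ^ 2) μ := by
    have h1 := hR2.integrable_sq
    rw [← hVlaw] at h1
    exact h1.comp_measurable hV
  have hRint : ∫ ω, R (V ω) ^ 2 ∂μ = ∫ v, R v ^ 2 ∂(Measure.pi fun _ => P) := by
    rw [← hVlaw, integral_map hV.aemeasurable]
    rw [hVlaw]
    exact hR2.integrable_sq.1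
  have hfi : ∀ k, 0 < w k → ∀ i,
      Integrable (fun ω => E * ((∑ s, x k s i ω) / S) + 4 * q k (V ω i)) μ := fun k hk i =>
    (((integrable_finsetSum _ fun s _ => hxi k hk s i).div_const _).const_mul E).add
      ((hqi k hk i).const_mul 4)
  have hfi' : ∀ i, Integrable (fun ω => ∑ k with 0 < w k,
      (E * ((∑ s, x k s i ω) / S) + 4 * q k (V ω i))) μ := fun i =>
    integrable_finsetSum _ fun k hk => hfi k (Finset.mem_filter.mp hk).2 i
  have hgi : Integrable (fun ω => (∑ i, ∑ k with 0 < w k,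
      (E * ((∑ s, x k s i ω) / S) + 4 * q k (V ω i))) / (n + 1 : ℕ)) μ :=
    (integrable_finsetSum _ fun i _ => hfi' i).div_const _
  have hbound : ∀ᵐ ω ∂μ, (stackingObjective f w (V ω) (fun k s => ϑ k s ω) -
      stackedElpd P π f w (V ω)) ^ 2 ≤ 2 * (K * ((∑ i, ∑ k with 0 < w k,
        (E * ((∑ s, x k s i ω) / S) + 4 * q k (V ω i))) / (n + 1 : ℕ))) +
          2 * R (V ω) ^ 2 := by
    filter_upwards [hall] with ω h
    have hd : ∀ i, (Real.log (∑ k, w k * psisLoo (f k) (fun s => ϑ k s ω) (V ω i)) -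
        stackedLogPredictive π f w (V ω) (V ω i)) ^ 2 ≤ K * ∑ k with 0 < w k,
          (E * ((∑ s, x k s i ω) / S) + 4 * q k (V ω i)) := fun i => by
      refine (sq_log_sum_sub_log_sum_le hw (fun k _ => (pos_and_abs_log_le_of_mem_Icc
        (psisLoo_mem_Icc fun s => h k s i)).1) fun k _ => (hr k).pos n (V ω) (V ω i)).trans ?_
      refine mul_le_mul_of_nonneg_left (Finset.sum_le_sum fun k _ => ?_) (Nat.cast_nonneg _)
      exact sq_log_psisLoo_sub_le b (fun s => h k s i)
        ⟨(hr k).le_predictive (V ω) (V ω i), (hr k).predictive_le (V ω) (V ω i)⟩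
    have h1 := sum_div_sq_le fun i => Real.log (∑ k, w k * psisLoo (f k) (fun s => ϑ k s ω)
      (V ω i)) - stackedLogPredictive π f w (V ω) (V ω i)
    have h2 := div_le_div_of_nonneg_right (Finset.sum_le_sum fun i (_ : i ∈ Finset.univ) => hd i)
      (Nat.cast_nonneg (α := ℝ) (n + 1))
    rw [← Finset.mul_sum, mul_div_assoc] at h2
    have h3 := pow_le_pow_left₀ (abs_nonneg _) (hR (V ω)) 2
    rw [sq_abs] at h3
    have h4 := h1.trans h2
    rw [Finset.sum_sub_distrib, sub_div] at h4
    rw [stackingObjective, one_div, ← div_eq_inv_mul]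
    set u := (∑ i, Real.log (∑ k, w k * psisLoo (f k) (fun s => ϑ k s ω) (V ω i))) /
      ((n + 1 : ℕ) : ℝ)
    set u' := (∑ i, stackedLogPredictive π f w (V ω) (V ω i)) / ((n + 1 : ℕ) : ℝ)
    -- The split of the error at `u'`, by `(a + b) ^ 2 ≤ 2 * a ^ 2 + 2 * b ^ 2`.
    nlinarith [sq_nonneg ((u - u') - (u' - stackedElpd P π f w (V ω)))]
  have hS : (S : ℝ) ≠ 0 := Nat.cast_ne_zero.mpr (NeZero.ne S)
  have hN : ((n + 1 : ℕ) : ℝ) ≠ 0 := Nat.cast_ne_zero.mpr n.succ_ne_zero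
  refine (integral_mono_of_nonneg (ae_of_all _ fun ω => sq_nonneg _)
    (((hgi.const_mul _).const_mul 2).add (hRV.const_mul 2)) hbound).trans (le_of_eq ?_)
  refine (integral_add ((hgi.const_mul _).const_mul 2) (hRV.const_mul 2)).trans ?_
  rw [integral_const_mul, integral_const_mul, integral_const_mul, hRint, integral_div,
    integral_finsetSum _ fun i _ => hfi' i]
  congr 3
  have h1 : ∀ i, ∫ ω, ∑ k with 0 < w k, (E * ((∑ s, x k s i ω) / S) + 4 * q k (V ω i)) ∂μ =
      ∑ k with 0 < w k, (E * (∫ v : Fin (n + 1) → Y, ∫ θ, (Real.log (f k θ (v i)) -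
        Real.log (predictive (π k) (f k) v (v i))) ^ 2 ∂(chainPosterior (π k) (f k) v)
          ∂(Measure.pi fun _ => P)) + 4 * ∫ t, q k t ∂P) := fun i => by
    rw [integral_finsetSum _ fun k hk => hfi k (Finset.mem_filter.mp hk).2 i]
    refine Finset.sum_congr rfl fun k hk => ?_
    have hk' := (Finset.mem_filter.mp hk).2
    rw [integral_add (((integrable_finsetSum _ fun s _ => hxi k hk' s i).div_const _).const_mul E)
      ((hqi k hk' i).const_mul 4), integral_const_mul, integral_const_mul, integral_div,
      integral_finsetSum _ fun s _ => hxi k hk' s i, hqint k hk' i]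
    -- All draws have the same expected error, so the mean over draws equals that of a single draw
    -- and `S` disappears.
    simp_rw [hxint k hk']
    rw [Finset.sum_const, Finset.card_univ, Fintype.card_fin, nsmul_eq_mul,
      mul_div_cancel_left₀ _ hS]
  simp_rw [h1]
  rw [Finset.sum_comm, Finset.sum_div]
  refine Finset.sum_congr rfl fun k hk => ?_
  have hk' := (Finset.mem_filter.mp hk).2
  rw [integral_div, integral_finsetSum _ fun i _ =>
    (hr k).integrable_integral_sq_log_sub_predictive (hB2 k hk') i, Finset.sum_add_distrib,
    ← Finset.mul_sum, Finset.sum_const, Finset.card_univ, Fintype.card_fin, nsmul_eq_mul,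
    add_div, mul_div_assoc, mul_div_cancel_left₀ _ hN]

end Objective

/-- A sequence of functions with small second moments is small in `L²`. -/
theorem eLpNorm_two_le_of_integral_sq_le {Ω : Type*} [MeasurableSpace Ω] {μ : Measure Ω}
    {D : Ω → ℝ} (hD : MemLp D 2 μ) {ε : ℝ} (hε : 0 ≤ ε) (h : ∫ ω, D ω ^ 2 ∂μ ≤ ε ^ 2) :
    eLpNorm D 2 μ ≤ ENNReal.ofReal ε := by
  rw [hD.eLpNorm_eq_integral_rpow_norm two_ne_zero ENNReal.ofNat_ne_top]
  refine ENNReal.ofReal_le_ofReal ?_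
  simp only [ENNReal.toReal_ofNat, Real.rpow_two, Real.norm_eq_abs, sq_abs]
  rw [← one_div, ← Real.sqrt_eq_rpow]
  exact Real.sqrt_le_iff.mpr ⟨hε, h⟩

end

/-! ### Assembly of the theorem. -/

theorem corollary1
    -- the chains, the parameter space and the space of observations
    {K : ℕ} {Θ Y : Type*} [MeasurableSpace Θ]
    [MetricSpace Y] [SecondCountableTopology Y] [MeasurableSpace Y] [BorelSpace Y]
    -- the models: prior and likelihood (a density with respect to `lam`) of each chain
    (lam : Measure Y) [SigmaFinite lam] [lam.IsOpenPosMeasure]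
    (prior : Fin K → Measure Θ) [∀ k, SigmaFinite (prior k)]
    (f : Fin K → Θ → Y → ℝ)
    (hf_meas : ∀ k, Measurable (fun z : Θ × Y => f k z.1 z.2))
    (hf_nonneg : ∀ k θ t, 0 ≤ f k θ t)
    (hf_density : ∀ k θ, ∫⁻ t, ENNReal.ofReal (f k θ t) ∂lam = 1)
    (hproper : ∀ k n, 1 ≤ n → ∀ v : Fin n → Y, IsProbabilityMeasure (chainPosterior (prior k) (f k) v))
    -- the weights
    (w : Fin K → ℝ) (hw : w ∈ stdSimplex ℝ (Fin K))
    -- the distribution of an observation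
    (P : Measure Y) [IsProbabilityMeasure P]
    -- first regularity condition: envelopes of the log predictive densities
    (B : Fin K → Y → ℝ)
    (hB : ∀ k n, 1 ≤ n → ∀ (v : Fin n → Y) (t : Y),
      0 < predictive (prior k) (f k) v t ∧ |Real.log (predictive (prior k) (f k) v t)| ≤ B k t)
    (hg : Integrable (fun t => max ((Real.log (∑ k, w k * Real.exp (-B k t))) ^ 4)
      ((Real.log (∑ k, w k * Real.exp (B k t))) ^ 4)) P)
    -- second regularity condition: equicontinuity of the predictive densities
    (hequi : ∀ k, UniformEquicontinuous
      (fun (d : Σ n : ℕ, (Fin (n + 1) → Y)) (t : Y) => predictive (prior k) (f k) d.2 t))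
    -- independent observations from `P`
    {Ω : Type*} [MeasurableSpace Ω] (μ : Measure Ω) [IsProbabilityMeasure μ]
    (y : ℕ → Ω → Y) (hy_meas : ∀ i, Measurable (y i))
    (hy_law : ∀ i, μ.map (y i) = P) (hy_indep : iIndepFun y μ)
    -- `θ n k s` is the `s`-th draw of chain `k` when `n` observations are available; given these
    -- observations it is distributed as the posterior (draws may depend on each other)
    (θ : ℕ → Fin K → ℕ → Ω → Θ) (hθ_meas : ∀ n k s, Measurable (θ n k s))
    (hθ_law : ∀ n, 1 ≤ n → ∀ k s, ∀ A : Set (Fin n → Y), MeasurableSet A →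
      ∀ C : Set Θ, MeasurableSet C →
      μ {ω | (fun i : Fin n => y i ω) ∈ A ∧ θ n k s ω ∈ C} =
        ∫⁻ v in A, chainPosterior (prior k) (f k) v C ∂(Measure.pi fun _ : Fin n => P)) :
    -- the expected log predictive densities exist
    (∀ n, 1 ≤ n → ∀ v : Fin n → Y, Integrable (stackedLogPredictive prior f w v) P) ∧
    -- the differences are square integrable
    (∀ n S, 1 ≤ n → 1 ≤ S →
      MemLp (fun ω => stackingObjective f w (fun i : Fin n => y i ω)
            (fun k (s : Fin S) => θ n k s ω) -
          stackedElpd P prior f w (fun i : Fin n => y i ω)) 2 μ) ∧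
    -- they tend to zero in `L²` when the numbers of observations and of draws tend to infinity
    Tendsto (fun nS : ℕ × ℕ => eLpNorm (fun ω =>
        stackingObjective f w (fun i : Fin nS.1 => y i ω)
            (fun k (s : Fin nS.2) => θ nS.1 k s ω) -
          stackedElpd P prior f w (fun i : Fin nS.1 => y i ω)) 2 μ)
      (atTop ×ˢ atTop) (𝓝 0) := by
  have hr : ∀ k, RegularModel lam (prior k) (f k) (B k) := fun k =>
    { meas := hf_meas k
      nonneg := hf_nonneg k
      density := hf_density k
      proper := fun n v => hproper k (n + 1) n.succ_pos v
      pos := fun n v t => (hB k (n + 1) n.succ_pos v t).1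
      bound := fun n v t => (hB k (n + 1) n.succ_pos v t).2
      equi := hequi k }
  have hr' : ∀ k, RegularModel lam (prior k) (f k) (logEnvelope (prior k) (f k)) := fun k =>
    (hr k).withLogEnvelope
  have hB2 : ∀ k, 0 < w k → MemLp (logEnvelope (prior k) (f k)) 2 P := fun k hk =>
    memLp_two_logEnvelope hw hr hg hk
  have hH : MemLp (stackedEnvelope prior f w) 2 P :=
    memLp_finsetSum _ fun k hk => hB2 k (Finset.mem_filter.mp hk).2
  have hV : ∀ n : ℕ, Measurable fun ω => (fun i : Fin n => y i ω) := fun n =>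
    measurable_pi_iff.mpr fun i => hy_meas i
  have hVlaw : ∀ n : ℕ, μ.map (fun ω => (fun i : Fin n => y i ω)) = Measure.pi fun _ => P :=
    fun n => by
      have h := iIndepFun.map_fun_eq_pi_map (f := fun i : Fin n => y i)
        (fun i => (hy_meas i).aemeasurable) (hy_indep.precomp Fin.val_injective)
      simpa only [hy_law] using h
  have hlaw : ∀ n k s, μ.map (fun ω => ((fun i : Fin (n + 1) => y i ω), θ (n + 1) k s ω)) =
      (Measure.pi fun _ => P) ⊗ₘ (hr' k).kernel n := fun n k s =>
    (hr' k).map_prodMk_eq_compProd (hV (n + 1)) (hθ_meas (n + 1) k s)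
      (hθ_law (n + 1) n.succ_pos k s)
  have hD : ∀ n S, 1 ≤ n → 1 ≤ S →
      MemLp (fun ω => stackingObjective f w (fun i : Fin n => y i ω)
            (fun k (s : Fin S) => θ n k s ω) -
          stackedElpd P prior f w (fun i : Fin n => y i ω)) 2 μ := fun n S hn hS => by
    obtain ⟨m, rfl⟩ := Nat.exists_eq_add_of_le' hn
    have : NeZero S := ⟨by omega⟩
    exact memLp_two_stackingObjective_sub (ϑ := fun k (s : Fin S) => θ (m + 1) k s) hw hr' hH
      (hV (m + 1)) (fun k s => hθ_meas (m + 1) k s) (hVlaw (m + 1)) fun k s => hlaw m k s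
  refine ⟨fun n hn v => ?_, hD, ?_⟩
  · obtain ⟨m, rfl⟩ := Nat.exists_eq_add_of_le' hn
    exact integrable_stackedLogPredictive hw hr' (hH.integrable (by norm_num)) v
  refine ENNReal.tendsto_nhds_zero.mpr fun δ hδ => ?_
  obtain ⟨ε, hε0, hεδ⟩ : ∃ ε : ℝ, 0 < ε ∧ ENNReal.ofReal ε ≤ δ := by
    obtain ⟨e, he0, heδ⟩ := ENNReal.lt_iff_exists_nnreal_btwn.mp hδ
    exact ⟨e, by exact_mod_cast he0, by simpa using heδ.le⟩
  have hm : ∀ k, Measurable (logEnvelope (prior k) (f k)) := fun k =>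
    (hr' k).continuous_logEnvelope.measurable
  -- the envelope is truncated at a level `b` that makes the error of the truncation small
  have hq : Tendsto (fun b : ℕ => 2 * (K * ∑ k with 0 < w k,
      (4 * ∫ t, {t | (b : ℝ) < logEnvelope (prior k) (f k) t}.indicator
        (fun t => logEnvelope (prior k) (f k) t ^ 2) t ∂P))) atTop (𝓝 0) := by
    have h := ((tendsto_finsetSum (Finset.univ.filter fun k => 0 < w k) fun k hk =>
      (tendsto_integral_indicator_sq (hm k) (hB2 k (Finset.mem_filter.mp hk).2)).const_mul
        4).const_mul (K : ℝ)).const_mul 2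
    simpa using h
  obtain ⟨b, hb⟩ := (hq.eventually (eventually_le_nhds (by positivity : 0 < ε ^ 2 / 4))).exists
  have hT : Tendsto (fun n : ℕ => 2 * (K * ∑ k with 0 < w k, (Real.exp (2 * b) ^ 6 *
      ∫ v : Fin (n + 1) → Y, (∑ i, ∫ θ, (Real.log (f k θ (v i)) -
        Real.log (predictive (prior k) (f k) v (v i))) ^ 2 ∂(chainPosterior (prior k) (f k) v)) /
          (n + 1 : ℕ) ∂(Measure.pi fun _ => P)))) atTop (𝓝 0) := by
    have h := ((tendsto_finsetSum (Finset.univ.filter fun k => 0 < w k) fun k hk =>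
      ((hr' k).tendsto_integral_sq_log_sub_predictive (hm k)
        (hB2 k (Finset.mem_filter.mp hk).2)).const_mul
          (Real.exp (2 * b) ^ 6)).const_mul (K : ℝ)).const_mul 2
    simpa using h
  -- The uniform law contributes `2 * 18 * (ε / 12) ^ 2 = ε ^ 2 / 4`, as much as is allowed to the
  -- truncation and to the posterior deviation of the log likelihood.
  obtain ⟨R, -, -, hR2, hRe, hR⟩ := exists_uniform_law_stacked (P := P) hw hr' hH
    (show 0 < ε / 12 by positivity)
  -- The threshold for `n` is uniform in `S ≥ 1`, which gives the joint limit in any manner.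
  have hlarge : ∀ᶠ n in atTop, ∀ S, 1 ≤ S → eLpNorm (fun ω =>
      stackingObjective f w (fun i : Fin n => y i ω) (fun k (s : Fin S) => θ n k s ω) -
        stackedElpd P prior f w (fun i : Fin n => y i ω)) 2 μ ≤ δ := by
    rw [← map_add_atTop_eq_nat 1, eventually_map]
    filter_upwards [hT.eventually (eventually_le_nhds (by positivity : 0 < ε ^ 2 / 4)),
      (tendsto_add_atTop_nat 1).eventually hRe] with n h1 h2 S hS
    have : NeZero S := ⟨by omega⟩
    refine (eLpNorm_two_le_of_integral_sq_le (hD (n + 1) S n.succ_pos hS) hε0.le ?_).trans hεδ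
    refine (integral_sq_stackingObjective_sub_le (ϑ := fun k (s : Fin S) => θ (n + 1) k s) hw hr'
      hB2 (hV (n + 1)) (fun k s => hθ_meas (n + 1) k s) (hVlaw (n + 1)) (fun k s => hlaw n k s)
      (hR2 (n + 1)) (hR n) b).trans ?_
    rw [Finset.sum_add_distrib]
    nlinarith
  filter_upwards [hlarge.prod_inl atTop, (eventually_ge_atTop 1).prod_inr atTop] with nS h1 h2
  exact h1 nS.2 h2
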